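/- Let $l>-\frac12$ and let $q:(0,\infty)\to\mathbb R$ be locally integrable on $(0,\infty)$ with $x\,q(x)\in L^p(0,1)$ for some $p\in I_l$, where $I_l=[1,\infty]$ if $l>0$ and $I_l=[1,\frac{-1}{2l})$ if $-\frac12<l\le 0$ (with $\frac{-1}{2l}=\infty$ for $l=0$). Let $\tau=-\frac{d^2}{dx^2}+\frac{l(l+1)}{x^2}+q(x)$. Let $\phi(z,x)$ and $\theta(z,x)$ be solutions of $\tau u=zu$ on $(0,\infty)$ which for every $x>0$ are real entire in $z$ and which for every $z\in\mathbb C$ satisfy $\phi(z,x)=x^{l+1}(1+o(1))$ and $\theta(z,x)=x^{-l}\big(\frac1{2l+1}+o(1)\big)$ as $x\to0$. Set $n_l=\lfloor l+\frac12\rfloor$ and $\varepsilon_l=n_l-l\in(-\frac12,\frac12]$, let $(x)_k=x(x+1)\cdots(x+k-1)$, let $C^\phi_{l,k}=\frac{(-1)^k}{4^k(l+3/2)_k}$, and let $W^{1,p}(0,1)$ be the space of absolutely continuous functions on $[0,1]$ whose derivative is in $L^p(0,1)$. Primes denote derivatives with respect to $x$. Then there is a real entire function $F$ such that for every $z_0\in\mathbb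 C$ there are functions $\widetilde\theta_k(z_0,\cdot),\widehat\theta_k(z_0,\cdot)$, $k\in\mathbb N_0$, with, for all $z\in\mathbb C$ and $x>0$, $$\theta(z,x)=\frac{x^{-l}}{2l+1}\sum_{k=0}^\infty\frac{x^{2k}\widetilde\theta_k(z_0,x)}{k!}(z-z_0)^k+F(z)\phi(z,x),$$ $$\theta'(z,x)=\frac{x^{-l-1}}{2l+1}\sum_{k=0}^\infty\frac{x^{2k}\widehat\theta_k(z_0,x)}{k!}(z-z_0)^k+F(z)\phi'(z,x),$$ and with the following properties. 1. Let $l+\frac12\notin\mathbb N$. For every $k$, $\widetilde\theta_k(z_0,0)=C^\theta_{l,k}:=\frac{(-1)^k}{4^k(-l+\frac12)_k}$ (as a limit $x\to0$), and $\widetilde\theta_k(z_0,\cdot)\in W^{1,r}(0,1)$ for every $r\in I_l$ with $r\le p$, where, if $k\ge n_l\ge1$ and $\varepsilon_l\in[0,\frac12)$, one requires in addition $r<\frac1{2\varepsilon_l}$ ($=\infty$ for $\varepsilon_l=0$). 2. Let $l+\frac12=n_l\in\mathbb N$, and put $C^\theta_{l,k}:=\frac1{4^k(l-k+\frac12)_k}$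 for $k<n_l$ and $\hat C^\theta_{l,k}:=-\binom{k}{n_l}\frac{C^\phi_{l,k-n_l}}{4^l\,\Gamma(l+\frac12)}$ for $k\ge n_l$. If $k<n_l$, then $\widetilde\theta_k(z_0,\cdot)\in W^{1,p}(0,1)$ and $\widetilde\theta_k(z_0,0)=C^\theta_{l,k}$. If $k\ge n_l$ and $p>1$, then $\widetilde\theta_k(z_0,\cdot)-\hat C^\theta_{l,k}\log(x)\in W^{1,\tilde p}(0,1)$ for every $\tilde p\in[1,p)$. If $k\ge n_l$ and $p=1$, then $\widetilde\theta_k(z_0,x)=\hat C^\theta_{l,k}\log(x)(1+o(1))$ as $x\to0$. 3. $\widehat\theta_k$ satisfies 1. and 2. with $C^\theta_{l,k}$, $\hat C^\theta_{l,k}$ replaced by $(-l+2k)C^\theta_{l,k}$, $(-l+2k)\hat C^\theta_{l,k}$. 4. $\widetilde\theta_k(z_0,\cdot)$ is differentiable on $(0,\infty)$, and $\lim_{x\to0}x\widetilde\theta_k'(z_0,x)=0$ for all $k\in\mathbb N_0$ if $l+\frac12\notin\mathbb N$, and for $k\le n_l-1$ if $l+\frac12\in\mathbb N$. If $l+\frac12\in\mathbb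 N$ and $k\ge n_l$, then $\lim_{x\to0}x\widetilde\theta_k'(z_0,x)=\hat C^\theta_{l,k}$ if $p>1$, and $\lim_{x\to0}x^{1+\varepsilon}\widetilde\theta_k'(z_0,x)=0$ for every $\varepsilon>0$ if $p=1$. Moreover, polynomial parts of $F$ of degree up to $n_l$ can be absorbed in the series: if a real entire $F$ has all these properties, then so does $F-P$ for every real polynomial $P$ of degree at most $n_l$ (with other $\widetilde\theta_k,\widehat\theta_k$). -/

import Mathlib

open MeasureTheory Set Filter Topology
open scoped ENNReal

noncomputable section

namespace Bessel

/-- `f` is a real entire function: entire, with `f (conj z) = conj (f z)`. -/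
structure IsRealEntire (f : ℂ → ℂ) : Prop where
  differentiable : Differentiable ℂ f
  real : ∀ z, f (starRingEnd ℂ z) = starRingEnd ℂ (f z)

/-- `u` solves `-u'' + (l(l+1)/x² + q) u = z u` on `(0, ∞)` in the Carathéodory sense: `u` is
differentiable on `(0, ∞)` and its derivative is locally absolutely continuous with
`u'' = (l(l+1)/x² + q - z) u` almost everywhere (written in integrated form; for `q` locally
integrable the integrand is integrable on compact subintervals). -/
structure IsSolution (l : ℝ) (q : ℝ → ℝ) (z : ℂ) (u : ℝ → ℂ) : Prop where
  differentiableAt : ∀ x, 0 < x → DifferentiableAt ℝ u x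
  deriv_sub : ∀ a b, 0 < a → 0 < b →
    deriv u b - deriv u a = ∫ x in a..b, (((l * (l + 1) / x ^ 2 + q x : ℝ) : ℂ) - z) * u x

/-- `φ(z, x)` is the real entire solution of `τ u = z u` with `φ(z, x) = x^(l+1) (1 + o(1))`
as `x → 0`. -/
structure IsFirstSolution (l : ℝ) (q : ℝ → ℝ) (φ : ℂ → ℝ → ℂ) : Prop where
  solution : ∀ z, IsSolution l q z (φ z)
  realEntire : ∀ x, 0 < x → IsRealEntire (fun z => φ z x)
  asymptotics : ∀ z, Tendsto (fun x : ℝ => ((x ^ (-(l + 1)) : ℝ) : ℂ) * φ z x) (𝓝[>] 0) (𝓝 1)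

/-- `θ(z, x)` is a real entire solution of `τ u = z u` with
`θ(z, x) = x^(-l) (1 / (2l+1) + o(1))` as `x → 0`. -/
structure IsSecondSolution (l : ℝ) (q : ℝ → ℝ) (θ : ℂ → ℝ → ℂ) : Prop where
  solution : ∀ z, IsSolution l q z (θ z)
  realEntire : ∀ x, 0 < x → IsRealEntire (fun z => θ z x)
  asymptotics : ∀ z, Tendsto (fun x : ℝ => ((x ^ l : ℝ) : ℂ) * θ z x) (𝓝[>] 0)
    (𝓝 (((1 / (2 * l + 1) : ℝ)) : ℂ))

/-- `f ∈ W^{1,p}(0,1)`: on `(0,1)`, `f` is an absolutely continuous function whose derivative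
lies in `L^p(0,1)` (used for `p ≥ 1` only). -/
def MemW1 (p : ℝ≥0∞) (f : ℝ → ℂ) : Prop :=
  ∃ (c : ℂ) (g : ℝ → ℂ), MemLp g p (volume.restrict (Ioo (0 : ℝ) 1)) ∧
    ∀ x ∈ Ioo (0 : ℝ) 1, f x = c + ∫ y in (0 : ℝ)..x, g y

/-- The set `I_l` of exponents: `[1, ∞]` if `0 < l`, and `[1, -1/(2l))` if `-1/2 < l ≤ 0`
(`-1/(2l)` being `∞` for `l = 0`). -/
def expSet (l : ℝ) : Set ℝ≥0∞ :=
  {p | 1 ≤ p ∧ (l ≤ 0 → p < (ENNReal.ofReal (-(2 * l)))⁻¹)}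

/-- `n_l = ⌊l + 1/2⌋`. -/
def nl (l : ℝ) : ℕ := ⌊l + 1 / 2⌋₊

/-- `ε_l = n_l - l`. -/
def epsl (l : ℝ) : ℝ := (nl l : ℝ) - l

/-- `l + 1/2` is a natural number. -/
def IsHalfInt (l : ℝ) : Prop := ∃ n : ℕ, l + 1 / 2 = (n : ℝ)

/-- The exponents admitted for the `k`-th coefficient if `l + 1/2 ∉ ℕ`: those in `I_l`, with the
additional restriction `p < 1 / (2 ε_l)` (`= ∞` for `ε_l = 0`) if `k ≥ n_l ≥ 1` and `ε_l ≥ 0`. -/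
def coeffExpSet (l : ℝ) (k : ℕ) : Set ℝ≥0∞ :=
  {p | p ∈ expSet l ∧
    (nl l ≤ k → 1 ≤ nl l → 0 ≤ epsl l → p < (ENNReal.ofReal (2 * epsl l))⁻¹)}

/-- The Pochhammer symbol `(x)_k = x (x+1) ⋯ (x+k-1)`. -/
def poch (x : ℝ) (k : ℕ) : ℝ := (ascPochhammer ℝ k).eval x

/-- `C^φ_{l,k} = (-1)^k / (4^k (l + 3/2)_k)`. -/
def phiConst (l : ℝ) (k : ℕ) : ℝ := (-1) ^ k / (4 ^ k * poch (l + 3 / 2) k)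

open Classical in
/-- `C^θ_{l,k}` (in the case `l + 1/2 ∈ ℕ` it is used for `k < n_l` only). -/
def thetaConst (l : ℝ) (k : ℕ) : ℝ :=
  if IsHalfInt l then 1 / (4 ^ k * poch (l - k + 1 / 2) k)
  else (-1) ^ k / (4 ^ k * poch (-l + 1 / 2) k)

/-- The coefficient `Ĉ^θ_{l,k}` of the logarithm, for `l + 1/2 = n_l ∈ ℕ` and `k ≥ n_l`. -/
def thetaLogConst (l : ℝ) (k : ℕ) : ℝ :=
  -((k.choose (nl l) : ℝ) * phiConst l (k - nl l)) / ((4 : ℝ) ^ l * Real.Gamma (l + 1 / 2))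

/-- The regularity of the `k`-th coefficient function `f` at exponent `p`, with value `c` at `x = 0`
or, for `l + 1/2 ∈ ℕ` and `k ≥ n_l`, with the logarithmic term `d * log x`. -/
structure CoeffNature (l : ℝ) (p : ℝ≥0∞) (k : ℕ) (c d : ℝ) (f : ℝ → ℂ) : Prop where
  regular : ¬ IsHalfInt l →
    (∀ r ∈ coeffExpSet l k, r ≤ p → MemW1 r f) ∧ Tendsto f (𝓝[>] 0) (𝓝 (c : ℂ))
  half_lt : IsHalfInt l → k < nl l → MemW1 p f ∧ Tendsto f (𝓝[>] 0) (𝓝 (c : ℂ))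
  half_ge : IsHalfInt l → nl l ≤ k → 1 < p →
    ∀ r : ℝ≥0∞, 1 ≤ r → r < p → MemW1 r (fun x => f x - ((d * Real.log x : ℝ) : ℂ))
  half_ge_one : IsHalfInt l → nl l ≤ k → p = 1 →
    Tendsto (fun x => f x / ((Real.log x : ℝ) : ℂ)) (𝓝[>] 0) (𝓝 (d : ℂ))

/-- The behaviour of `x f'(x)` as `x → 0` for the `k`-th coefficient function `f` of `θ`. -/
structure DerivLimits (l : ℝ) (p : ℝ≥0∞) (k : ℕ) (f : ℝ → ℂ) : Prop where
  differentiableAt : ∀ x, 0 < x → DifferentiableAt ℝ f x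
  regular : (¬ IsHalfInt l ∨ k < nl l) →
    Tendsto (fun x : ℝ => (x : ℂ) * deriv f x) (𝓝[>] 0) (𝓝 0)
  half_ge : IsHalfInt l → nl l ≤ k → 1 < p →
    Tendsto (fun x : ℝ => (x : ℂ) * deriv f x) (𝓝[>] 0) (𝓝 (thetaLogConst l k : ℂ))
  half_ge_one : IsHalfInt l → nl l ≤ k → p = 1 → ∀ ε : ℝ, 0 < ε →
    Tendsto (fun x : ℝ => ((x ^ (1 + ε) : ℝ) : ℂ) * deriv f x) (𝓝[>] 0) (𝓝 0)

/-- The Frobenius type representation of `θ` and of its `x`-derivative around `z₀`, with the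
coefficient functions `a k = θ̃_k(z₀, ·)`, `b k = θ̂_k(z₀, ·)` and the function `F`. -/
structure IsFrobeniusRep (l : ℝ) (p : ℝ≥0∞) (φ θ : ℂ → ℝ → ℂ) (F : ℂ → ℂ) (z₀ : ℂ)
    (a b : ℕ → ℝ → ℂ) : Prop where
  summable : ∀ (z : ℂ) (x : ℝ), 0 < x →
    Summable (fun k : ℕ => (x : ℂ) ^ (2 * k) * a k x / (k.factorial : ℂ) * (z - z₀) ^ k)
  eq_series : ∀ (z : ℂ) (x : ℝ), 0 < x →
    θ z x = ((x ^ (-l) / (2 * l + 1) : ℝ) : ℂ) *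
      (∑' k : ℕ, (x : ℂ) ^ (2 * k) * a k x / (k.factorial : ℂ) * (z - z₀) ^ k) + F z * φ z x
  summable_deriv : ∀ (z : ℂ) (x : ℝ), 0 < x →
    Summable (fun k : ℕ => (x : ℂ) ^ (2 * k) * b k x / (k.factorial : ℂ) * (z - z₀) ^ k)
  deriv_eq_series : ∀ (z : ℂ) (x : ℝ), 0 < x →
    deriv (θ z) x = ((x ^ (-l - 1) / (2 * l + 1) : ℝ) : ℂ) *
      (∑' k : ℕ, (x : ℂ) ^ (2 * k) * b k x / (k.factorial : ℂ) * (z - z₀) ^ k)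
        + F z * deriv (φ z) x
  nature : ∀ k, CoeffNature l p k (thetaConst l k) (thetaLogConst l k) (a k)
  nature_deriv : ∀ k, CoeffNature l p k
    ((-l + 2 * k) * thetaConst l k) ((-l + 2 * k) * thetaLogConst l k) (b k)
  limits : ∀ k, DerivLimits l p k (a k)

/-- `θ` has a Frobenius type representation with the function `F` around every `z₀`. -/
def HasFrobeniusRep (l : ℝ) (p : ℝ≥0∞) (φ θ : ℂ → ℝ → ℂ) (F : ℂ → ℂ) : Prop :=
  ∀ z₀ : ℂ, ∃ a b : ℕ → ℝ → ℂ, IsFrobeniusRep l p φ θ F z₀ a b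

end Bessel

end

open MeasureTheory Set Filter Topology
open scoped ENNReal

noncomputable section

namespace Bessel

/-! Construction at a fixed z₀. Starting from f₀ = θ(z₀,·), solve (τ - z₀) f_{k+1} = f_k by
variation of parameters with the fundamental system φ(z₀,·), θ(z₀,·), whose Wronskian is 1; the
generating function Σ f_k (z - z₀)^k then solves τu = zu. For k < n_l the product θ(z₀,·) f_k can be
as large as x^(2k-2l) with 2k - 2l ≤ -1, so its integral starts at 1. From k = n_l on it starts at
0, and each Volterra step gains x² and a factor of order 1/k, so the series is entire in z
(`IsFund.exists_secondChain`, `IsChain.tsum`). The sum has the leading behaviour of θ(z,·), and a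
solution that is o(x^(-l)) is a multiple of φ(z,·). Hence θ = Σ f_k (z - z₀)^k + G φ, where G is
entire because it is locally a quotient with denominator φ(·,x) (`IsSystem.exists_rep`). The
coefficient functions are θ̃_k = (2l+1) k! x^(l-2k) f_k.

Regularity at 0. At scale x^m a solution is split into its components along x^(l+1) and x^(-l). Each
satisfies a scalar Euler equation x y' = σ y + S + x h, with σ = l+1-m and σ = -l-m respectively; S
= ∓x^(2-m) f_{k-1} is the previous coefficient and h carries x q. The function E = σ y + S obeys x
E' = σ E + x h̃ with h̃ in L^r. It can be integrated from 0 if σ < 0 and from 1 if σ > 1 - 1/r, and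
Hardy's inequalities put E/x in L^r with E → 0 (`euler_regularity`). For m = -l + 2k the two
exponents are 2l+1-2k and -2k, and every positive value of the first must exceed 1 - 1/r: this is
what I_l (at k = 0) and the bound r < 1/(2ε_l) (at k = n_l) encode. The value σ = 0 occurs exactly
for l + 1/2 = k = n_l; this resonance creates the logarithm. For p > 1 the logarithm is subtracted
and Hardy's inequality applies to the remainder (`IsSecondChain.log_isReg`); for p = 1 only the
leading asymptotics survive (`IsSecondChain.log_asymptotics`).

One F for all z₀. The terms with k > n_l add up to o(x^(l+1)), so θ(z,x) = P_x(z) + x^(l+1) (G(z) +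
o(1)) with deg P_x ≤ n_l. This expansion does not mention z₀ and determines G up to a polynomial of
degree at most n_l (`HasPolyExpansion.sub_eq_eval`). Such polynomials can be moved into the series,
since (z - z₀)^j φ contributes to the k-th coefficient only a multiple of x^(2l+1-2j) times a
regular function (`IsFrobeniusRep.shift`). Symmetrising the G found at z₀ = 0 under complex
conjugation gives a real entire F that serves every z₀. -/

/-! ### Calculus of locally absolutely continuous functions on the half-line -/

/-- On `(0, ∞)`, `f` is a primitive of the locally integrable function `g`. -/
structure IsPrim (f g : ℝ → ℂ) : Prop where
  integrable : ∀ a b, 0 < a → 0 < b → IntervalIntegrable g volume a b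
  sub_eq : ∀ a b, 0 < a → 0 < b → f b - f a = ∫ x in a..b, g x

theorem uIcc_subset_Ioi {a b : ℝ} (ha : 0 < a) (hb : 0 < b) : uIcc a b ⊆ Ioi 0 := fun _ hx =>
  lt_of_lt_of_le (lt_min ha hb) hx.1

theorem uIoc_subset_Ioi {a b : ℝ} (ha : 0 < a) (hb : 0 < b) : uIoc a b ⊆ Ioi 0 :=
  uIoc_subset_uIcc.trans (uIcc_subset_Ioi ha hb)

theorem _root_.ContinuousOn.intervalIntegrable_of_pos {f : ℝ → ℂ} (hf : ContinuousOn f (Ioi 0))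
    {a b : ℝ} (ha : 0 < a) (hb : 0 < b) : IntervalIntegrable f volume a b :=
  (hf.mono (uIcc_subset_Ioi ha hb)).intervalIntegrable

namespace IsPrim

variable {f g f₁ g₁ : ℝ → ℂ}

theorem eq_add (h : IsPrim f g) {a x : ℝ} (ha : 0 < a) (hx : 0 < x) :
    f x = f a + ∫ t in a..x, g t := by
  rw [← h.sub_eq a x ha hx]; ring

theorem congr (h : IsPrim f g) (hf : ∀ x, 0 < x → f₁ x = f x) (hg : ∀ x, 0 < x → g₁ x = g x) :
    IsPrim f₁ g₁ := by
  refine ⟨fun a b ha hb => (h.integrable a b ha hb).congr ?_, fun a b ha hb => ?_⟩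
  · exact fun x hx => (hg x (uIoc_subset_Ioi ha hb hx)).symm
  · rw [hf a ha, hf b hb, h.sub_eq a b ha hb]
    exact intervalIntegral.integral_congr fun x hx => (hg x (uIcc_subset_Ioi ha hb hx)).symm

/-- The real and imaginary parts are real primitives; each is multiplied by the constant 1 or I and
the two are added. -/
theorem absolutelyContinuousOnInterval_integral {g : ℝ → ℂ} {a b : ℝ}
    (h : IntervalIntegrable g volume a b) :
    AbsolutelyContinuousOnInterval (fun x => ∫ t in a..x, g t) a b := by
  have hconst : ∀ c : ℂ, AbsolutelyContinuousOnInterval (fun _ : ℝ => c) a b := fun c =>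
    (LipschitzWith.const c).lipschitzOnWith.absolutelyContinuousOnInterval (K := 0)
  have hre := (IntervalIntegrable.absolutelyContinuousOnInterval_intervalIntegral
    (f := fun t => (g t).re) (c := a) ⟨h.1.re, h.2.re⟩ left_mem_uIcc).smul (hconst 1)
  have him := (IntervalIntegrable.absolutelyContinuousOnInterval_intervalIntegral
    (f := fun t => (g t).im) (c := a) ⟨h.1.im, h.2.im⟩ left_mem_uIcc).smul (hconst Complex.I)
  have hadd := hre.add him
  rw [absolutelyContinuousOnInterval_iff] at hadd ⊢
  intro ε hε
  obtain ⟨δ, hδ, H⟩ := hadd ε hε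
  refine ⟨δ, hδ, fun E hE hlt => lt_of_le_of_lt (le_of_eq ?_) (H E hE hlt)⟩
  have heq : ∀ x ∈ uIcc a b, ∫ t in a..x, g t =
      (((fun x => ∫ t in a..x, (g t).re) • fun _ : ℝ => (1 : ℂ)) +
        ((fun x => ∫ t in a..x, (g t).im) • fun _ : ℝ => Complex.I)) x := by
    intro x hx
    have hx' : IntervalIntegrable g volume a x := h.mono_set (uIcc_subset_uIcc_left hx)
    have e1 : ∫ t in a..x, (g t).re = (∫ t in a..x, g t).re :=
      Complex.reCLM.intervalIntegral_comp_comm hx'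
    have e2 : ∫ t in a..x, (g t).im = (∫ t in a..x, g t).im :=
      Complex.imCLM.intervalIntegral_comp_comm hx'
    simp only [Pi.add_apply, Pi.smul_apply', e1, e2]
    apply Complex.ext <;> simp
  refine Finset.sum_congr rfl fun i hi => ?_
  have hi' := hE.1 i hi
  rw [heq _ hi'.1, heq _ hi'.2]

theorem continuousOn (h : IsPrim f g) : ContinuousOn f (Ioi 0) := by
  intro x hx
  have hx' : (0 : ℝ) < x := hx
  have h1 := (absolutelyContinuousOnInterval_integral
    (h.integrable (x / 2) (x + 1) (by positivity) (by positivity))).continuousOn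
  have h2 : ContinuousAt (fun y => f (x / 2) + ∫ t in x / 2..y, g t) x := by
    refine ContinuousAt.add continuousAt_const (h1.continuousAt ?_)
    rw [uIcc_of_le (by linarith)]
    exact Icc_mem_nhds (by linarith) (by linarith)
  refine (h2.congr ?_).continuousWithinAt
  filter_upwards [Ioi_mem_nhds hx'] with y hy
  exact (h.eq_add (by positivity) hy).symm

theorem add (h : IsPrim f g) (h₁ : IsPrim f₁ g₁) :
    IsPrim (fun x => f x + f₁ x) (fun x => g x + g₁ x) := by
  refine ⟨fun a b ha hb => (h.integrable a b ha hb).add (h₁.integrable a b ha hb),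
    fun a b ha hb => ?_⟩
  rw [intervalIntegral.integral_add (h.integrable a b ha hb) (h₁.integrable a b ha hb),
    ← h.sub_eq a b ha hb, ← h₁.sub_eq a b ha hb]
  ring

theorem const_mul (h : IsPrim f g) (c : ℂ) : IsPrim (fun x => c * f x) (fun x => c * g x) := by
  refine ⟨fun a b ha hb => (h.integrable a b ha hb).const_mul c, fun a b ha hb => ?_⟩
  rw [intervalIntegral.integral_const_mul, ← h.sub_eq a b ha hb]
  ring

theorem sub (h : IsPrim f g) (h₁ : IsPrim f₁ g₁) :
    IsPrim (fun x => f x - f₁ x) (fun x => g x - g₁ x) :=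
  (h.add (h₁.const_mul (-1))).congr (fun _ _ => by ring) (fun _ _ => by ring)

theorem const (c : ℂ) : IsPrim (fun _ => c) (fun _ => 0) :=
  ⟨fun _ _ _ _ => intervalIntegrable_const, fun _ _ _ _ => by simp⟩

theorem of_hasDerivAt (hf : ∀ x, 0 < x → HasDerivAt f (g x) x) (hg : ContinuousOn g (Ioi 0)) :
    IsPrim f g := by
  have hi : ∀ a b : ℝ, 0 < a → 0 < b → IntervalIntegrable g volume a b := fun a b ha hb =>
    hg.intervalIntegrable_of_pos ha hb
  refine ⟨hi, fun a b ha hb => ?_⟩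
  exact (intervalIntegral.integral_eq_sub_of_hasDerivAt
    (fun x hx => hf x (uIcc_subset_Ioi ha hb hx)) (hi a b ha hb)).symm

theorem hasDerivAt (h : IsPrim f g) (hg : ContinuousOn g (Ioi 0)) {x : ℝ} (hx : 0 < x) :
    HasDerivAt f (g x) x := by
  have h1 : HasDerivAt (fun y => ∫ t in x..y, g t) (g x) x := by
    refine intervalIntegral.integral_hasDerivAt_right IntervalIntegrable.refl ?_
      (hg.continuousAt (Ioi_mem_nhds hx))
    exact hg.stronglyMeasurableAtFilter isOpen_Ioi x hx
  have h2 := h1.const_add (f x)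
  refine h2.congr_of_eventuallyEq ?_
  filter_upwards [Ioi_mem_nhds hx] with y hy
  exact h.eq_add hx hy

/-- The product minus the primitive of the Leibniz expression is absolutely continuous with
derivative zero almost everywhere, hence constant. All manipulations of Wronskians, scalings and
variation of parameters below reduce to this rule, because second derivatives exist only almost
everywhere. -/
theorem mul (h : IsPrim f g) (h₁ : IsPrim f₁ g₁) :
    IsPrim (fun x => f x * f₁ x) (fun x => g x * f₁ x + f x * g₁ x) := by
  have hi : ∀ a b : ℝ, 0 < a → 0 < b →
      IntervalIntegrable (fun x => g x * f₁ x + f x * g₁ x) volume a b := fun a b ha hb =>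
    ((h.integrable a b ha hb).mul_continuousOn (h₁.continuousOn.mono (uIcc_subset_Ioi ha hb))).add
      ((h₁.integrable a b ha hb).continuousOn_mul (h.continuousOn.mono (uIcc_subset_Ioi ha hb)))
  refine ⟨hi, fun a b ha hb => ?_⟩
  have hac : ∀ {f g : ℝ → ℂ}, IsPrim f g → AbsolutelyContinuousOnInterval
      (fun x => f a + ∫ t in a..x, g t) a b := fun {f g} h =>
    AbsolutelyContinuousOnInterval.add
      ((LipschitzWith.const (f a)).lipschitzOnWith.absolutelyContinuousOnInterval (K := 0))
      (absolutelyContinuousOnInterval_integral (h.integrable a b ha hb))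
  have h0 : ∀ᵐ x, x ∈ uIcc a b → HasDerivAt
      ((fun x => f a + ∫ t in a..x, g t) • (fun x => f₁ a + ∫ t in a..x, g₁ t) -
        fun x => ∫ t in a..x, (g t * f₁ t + f t * g₁ t)) 0 x := by
    filter_upwards [(h.integrable a b ha hb).ae_hasDerivAt_integral,
      (h₁.integrable a b ha hb).ae_hasDerivAt_integral,
      (hi a b ha hb).ae_hasDerivAt_integral] with x h1 h2 h3 hx
    have h4 := (((h1 hx a left_mem_uIcc).const_add (f a)).mul
      ((h2 hx a left_mem_uIcc).const_add (f₁ a))).sub (h3 hx a left_mem_uIcc)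
    have hx0 := uIcc_subset_Ioi ha hb hx
    rw [← h.eq_add ha hx0, ← h₁.eq_add ha hx0, sub_self] at h4
    exact h4
  obtain ⟨C, hC⟩ := (((hac h).smul (hac h₁)).sub
    (absolutelyContinuousOnInterval_integral (hi a b ha hb))).const_of_ae_hasDerivAt_zero h0
  have ea := hC a left_mem_uIcc
  have eb := hC b right_mem_uIcc
  simp only [Pi.sub_apply, smul_eq_mul, Pi.mul_apply] at ea eb
  rw [← h.eq_add ha hb, ← h₁.eq_add ha hb] at eb
  simp only [intervalIntegral.integral_same, sub_zero, add_zero] at ea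
  rw [ea, ← eb]; ring

theorem cpow_ofReal (s : ℝ) : IsPrim (fun x => ((x ^ s : ℝ) : ℂ))
    (fun x => (s : ℂ) * ((x ^ (s - 1) : ℝ) : ℂ)) := by
  refine of_hasDerivAt (fun x hx => ?_) ?_
  · have := (Real.hasDerivAt_rpow_const (p := s) (Or.inl hx.ne')).ofReal_comp
    simpa using this
  · refine continuousOn_const.mul (Complex.continuous_ofReal.comp_continuousOn ?_)
    exact continuousOn_id.rpow_const fun x hx => Or.inl (ne_of_gt hx)

theorem log : IsPrim (fun x => ((Real.log x : ℝ) : ℂ)) (fun x => ((x⁻¹ : ℝ) : ℂ)) := by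
  refine of_hasDerivAt (fun x hx => (Real.hasDerivAt_log hx.ne').ofReal_comp) ?_
  exact Complex.continuous_ofReal.comp_continuousOn
    (continuousOn_inv₀.mono fun x hx => ne_of_gt hx)

/-- A primitive of a function that is integrable near `0` extends to `0`. -/
theorem exists_tendsto (h : IsPrim f g) (hg : IntegrableOn g (Ioo 0 1)) :
    ∃ c, Tendsto f (𝓝[>] 0) (𝓝 c) ∧ ∀ x ∈ Ioc (0 : ℝ) 1, f x = c + ∫ t in (0 : ℝ)..x, g t := by
  have hi : IntervalIntegrable g volume 0 1 := by
    rw [intervalIntegrable_iff_integrableOn_Ioo_of_le zero_le_one]; exact hg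
  have hsub : ∀ x ∈ Ioc (0 : ℝ) 1, IntervalIntegrable g volume 0 x := fun x hx =>
    hi.mono_set (by rw [uIcc_of_le hx.1.le, uIcc_of_le zero_le_one]; exact Icc_subset_Icc_right hx.2)
  have hrep : ∀ x ∈ Ioc (0 : ℝ) 1,
      f x = (f 1 - ∫ t in (0 : ℝ)..1, g t) + ∫ t in (0 : ℝ)..x, g t := by
    intro x hx
    have h1 := h.sub_eq x 1 hx.1 one_pos
    have h2 := intervalIntegral.integral_add_adjacent_intervals (hsub x hx)
      (h.integrable x 1 hx.1 one_pos)
    rw [← h2, ← h1]; ring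
  refine ⟨_, ?_, hrep⟩
  have hc : ContinuousOn (fun x => ∫ t in (0 : ℝ)..x, g t) (uIcc 0 1) :=
    intervalIntegral.continuousOn_primitive_interval' hi left_mem_uIcc
  have h0 : Tendsto (fun x => ∫ t in (0 : ℝ)..x, g t) (𝓝[>] 0) (𝓝 0) := by
    have := hc 0 left_mem_uIcc
    rw [ContinuousWithinAt, intervalIntegral.integral_same] at this
    refine this.mono_left (nhdsWithin_le_iff.2 ?_)
    rw [uIcc_of_le zero_le_one]
    exact mem_of_superset (Ioc_mem_nhdsGT one_pos) Ioc_subset_Icc_self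
  have h1 := h0.const_add (f 1 - ∫ t in (0 : ℝ)..1, g t)
  rw [add_zero] at h1
  refine h1.congr' ?_
  filter_upwards [Ioc_mem_nhdsGT one_pos] with x hx
  exact (hrep x hx).symm

/-- The primitive starting at `0` of a function that is integrable near `0`. -/
theorem integral_zero (hg : ContinuousOn g (Ioi 0)) (hi : ∀ x, 0 < x → IntervalIntegrable g volume 0 x) :
    IsPrim (fun x => ∫ t in (0 : ℝ)..x, g t) g := by
  refine ⟨fun a b ha hb => hg.intervalIntegrable_of_pos ha hb, fun a b ha hb => ?_⟩
  exact intervalIntegral.integral_interval_sub_left (hi b hb) (hi a ha)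

theorem integral_one (hg : ContinuousOn g (Ioi 0)) :
    IsPrim (fun x => ∫ t in (1 : ℝ)..x, g t) g := by
  have hi := fun (a b : ℝ) (ha : 0 < a) (hb : 0 < b) =>
    hg.intervalIntegrable_of_pos ha hb
  exact ⟨hi, fun a b ha hb => intervalIntegral.integral_interval_sub_left (hi 1 b one_pos hb)
    (hi 1 a one_pos ha)⟩

end IsPrim

/-! ### Schur's test and Hardy inequalities on the unit interval -/

/-- Lebesgue measure on `(0, 1)`. -/
abbrev unitMeasure : Measure ℝ := volume.restrict (Ioo (0 : ℝ) 1)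

theorem ae_unitMeasure : ∀ᵐ x ∂unitMeasure, x ∈ Ioo (0 : ℝ) 1 :=
  ae_restrict_mem measurableSet_Ioo

/-- Schur's test for exponents in `(1, ∞)`. -/
theorem lintegral_schur {k : ℝ → ℝ → ℝ≥0∞} (hk : Measurable (Function.uncurry k))
    {h ρ : ℝ → ℝ≥0∞} (hh : Measurable h) (hρ : Measurable ρ) {r s : ℝ}
    (hrs : r.HolderConjugate s) (hρ0 : ∀ x ∈ Ioo (0 : ℝ) 1, ρ x ≠ 0) (hρt : ∀ x, ρ x ≠ ⊤) {C : ℝ≥0∞}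
    (h1 : ∀ x ∈ Ioo (0 : ℝ) 1, ∫⁻ t, k x t * ρ t ^ s ∂unitMeasure ≤ C * ρ x ^ s)
    (h2 : ∀ t ∈ Ioo (0 : ℝ) 1, ∫⁻ x, k x t * ρ x ^ r ∂unitMeasure ≤ C * ρ t ^ r) :
    ∫⁻ x, (∫⁻ t, k x t * h t ∂unitMeasure) ^ r ∂unitMeasure
      ≤ C ^ (r / s) * (C * ∫⁻ t, h t ^ r ∂unitMeasure) := by
  have hr0 : 0 < r := hrs.pos
  have hs0 : 0 < s := hrs.symm.pos
  have hkx : ∀ x, Measurable (k x) := fun x => hk.comp measurable_prodMk_left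
  have hkt : ∀ t, Measurable (fun x => k x t) := fun t => hk.comp measurable_prodMk_right
  have hg : Measurable (fun t => (ρ t)⁻¹ * h t) := hρ.inv.mul hh
  have hgr : Measurable (fun t => ((ρ t)⁻¹ * h t) ^ r) := hg.pow_const r
  have hρr : Measurable (fun t => ρ t ^ r) := hρ.pow_const r
  -- Hölder's inequality for the measure k(x,t) dt, applied to the factorisation h = ρ · (ρ⁻¹ h).
  have key : ∀ x ∈ Ioo (0 : ℝ) 1, (∫⁻ t, k x t * h t ∂unitMeasure) ^ r ≤
      C ^ (r / s) * (ρ x ^ r * ∫⁻ t, k x t * ((ρ t)⁻¹ * h t) ^ r ∂unitMeasure) := by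
    intro x hx
    have hm1 : AEMeasurable ρ (unitMeasure.withDensity (k x)) := hρ.aemeasurable
    have hm2 : AEMeasurable (fun t => (ρ t)⁻¹ * h t) (unitMeasure.withDensity (k x)) :=
      hg.aemeasurable
    have e0 : ∫⁻ t, k x t * h t ∂unitMeasure =
        ∫⁻ t, (ρ * fun t => (ρ t)⁻¹ * h t) t ∂(unitMeasure.withDensity (k x)) := by
      rw [lintegral_withDensity_eq_lintegral_mul _ (hkx x) (hρ.mul hg)]
      refine lintegral_congr_ae ?_
      filter_upwards [ae_unitMeasure] with t ht
      simp only [Pi.mul_apply]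
      rw [← mul_assoc (ρ t), ENNReal.mul_inv_cancel (hρ0 t ht) (hρt t), one_mul]
    have e1 : ∫⁻ t, ρ t ^ s ∂(unitMeasure.withDensity (k x)) ≤ C * ρ x ^ s := by
      rw [lintegral_withDensity_eq_lintegral_mul _ (hkx x) (hρ.pow_const s)]
      exact h1 x hx
    have e2 : ∫⁻ t, ((ρ t)⁻¹ * h t) ^ r ∂(unitMeasure.withDensity (k x)) =
        ∫⁻ t, k x t * ((ρ t)⁻¹ * h t) ^ r ∂unitMeasure := by
      rw [lintegral_withDensity_eq_lintegral_mul _ (hkx x) hgr]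
      rfl
    have e3 := ENNReal.lintegral_mul_le_Lp_mul_Lq (unitMeasure.withDensity (k x)) hrs.symm hm1 hm2
    rw [← e0, e2] at e3
    calc (∫⁻ t, k x t * h t ∂unitMeasure) ^ r
        ≤ ((C * ρ x ^ s) ^ (1 / s) *
            (∫⁻ t, k x t * ((ρ t)⁻¹ * h t) ^ r ∂unitMeasure) ^ (1 / r)) ^ r := by
          refine ENNReal.rpow_le_rpow (e3.trans ?_) hr0.le
          gcongr
      _ = _ := by
          rw [ENNReal.mul_rpow_of_nonneg _ _ hr0.le, ← ENNReal.rpow_mul, ← ENNReal.rpow_mul,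
            one_div_mul_cancel hr0.ne', ENNReal.rpow_one,
            ENNReal.mul_rpow_of_nonneg _ _ (by positivity), ← ENNReal.rpow_mul, mul_assoc]
          congr 2
          · ring
          · rw [← mul_assoc s, mul_one_div_cancel hs0.ne', one_mul]
  have hJm : Measurable (fun x => ∫⁻ t, k x t * ((ρ t)⁻¹ * h t) ^ r ∂unitMeasure) := by
    apply Measurable.lintegral_prod_right' (f := fun z : ℝ × ℝ => k z.1 z.2 * ((ρ z.2)⁻¹ * h z.2) ^ r)
    exact hk.mul (((hρ.comp measurable_snd).inv.mul (hh.comp measurable_snd)).pow_const r)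
  calc ∫⁻ x, (∫⁻ t, k x t * h t ∂unitMeasure) ^ r ∂unitMeasure
      ≤ ∫⁻ x, C ^ (r / s) * (ρ x ^ r * ∫⁻ t, k x t * ((ρ t)⁻¹ * h t) ^ r ∂unitMeasure)
          ∂unitMeasure := by
        refine lintegral_mono_ae ?_
        filter_upwards [ae_unitMeasure] with x hx using key x hx
    _ = C ^ (r / s) * ∫⁻ x, ∫⁻ t, ρ x ^ r * (k x t * ((ρ t)⁻¹ * h t) ^ r) ∂unitMeasure
          ∂unitMeasure := by
        rw [lintegral_const_mul _ (show Measurable (fun x => ρ x ^ r *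
          ∫⁻ t, k x t * ((ρ t)⁻¹ * h t) ^ r ∂unitMeasure) from hρr.mul hJm)]
        congr 1
        refine lintegral_congr fun x => ?_
        exact (lintegral_const_mul _ ((hkx x).mul hgr)).symm
    _ = C ^ (r / s) * ∫⁻ t, ∫⁻ x, ρ x ^ r * (k x t * ((ρ t)⁻¹ * h t) ^ r) ∂unitMeasure
          ∂unitMeasure := by
        congr 1
        refine lintegral_lintegral_swap (Measurable.aemeasurable ?_)
        exact ((hρ.comp measurable_fst).pow_const r).mul
          (hk.mul (((hρ.comp measurable_snd).inv.mul (hh.comp measurable_snd)).pow_const r))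
    _ ≤ C ^ (r / s) * ∫⁻ t, C * h t ^ r ∂unitMeasure := by
        gcongr C ^ (r / s) * ?_
        refine lintegral_mono_ae ?_
        filter_upwards [ae_unitMeasure] with t ht
        calc ∫⁻ x, ρ x ^ r * (k x t * ((ρ t)⁻¹ * h t) ^ r) ∂unitMeasure
            = ∫⁻ x, ((ρ t)⁻¹ * h t) ^ r * (k x t * ρ x ^ r) ∂unitMeasure :=
              lintegral_congr fun x => by ring
          _ = ((ρ t)⁻¹ * h t) ^ r * ∫⁻ x, k x t * ρ x ^ r ∂unitMeasure :=
              lintegral_const_mul _ ((hkt t).mul (hρ.pow_const r))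
          _ ≤ ((ρ t)⁻¹ * h t) ^ r * (C * ρ t ^ r) := by gcongr; exact h2 t ht
          _ = C * ((ρ t)⁻¹ * h t * ρ t) ^ r := by
              rw [ENNReal.mul_rpow_of_nonneg ((ρ t)⁻¹ * h t) _ hr0.le]; ring
          _ = C * h t ^ r := by
              rw [mul_right_comm, ENNReal.inv_mul_cancel (hρ0 t ht) (hρt t), one_mul]
    _ = C ^ (r / s) * (C * ∫⁻ t, h t ^ r ∂unitMeasure) := by
        rw [lintegral_const_mul _ (hh.pow_const r)]

/-- Schur's test on `(0, 1)` with power weights, for all exponents in `[1, ∞]`. -/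
theorem memLp_of_kernel_le {k : ℝ → ℝ → ℝ≥0∞} (hk : Measurable (Function.uncurry k)) {r : ℝ≥0∞}
    (hr : 1 ≤ r) {C : ℝ≥0∞} (hC : C ≠ ⊤)
    (h1 : ∀ x ∈ Ioo (0 : ℝ) 1, ∫⁻ t, k x t * ENNReal.ofReal (t ^ (-r.toReal⁻¹)) ∂unitMeasure
      ≤ C * ENNReal.ofReal (x ^ (-r.toReal⁻¹)))
    (h2 : ∀ t ∈ Ioo (0 : ℝ) 1, ∫⁻ x, k x t * ENNReal.ofReal (x ^ (-(1 - r.toReal⁻¹))) ∂unitMeasure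
      ≤ C * ENNReal.ofReal (t ^ (-(1 - r.toReal⁻¹))))
    {f h : ℝ → ℂ} (hh : MemLp h r unitMeasure) (hf : AEStronglyMeasurable f unitMeasure)
    (hfh : ∀ x ∈ Ioo (0 : ℝ) 1, ‖f x‖ₑ ≤ ∫⁻ t, k x t * ‖h t‖ₑ ∂unitMeasure) :
    MemLp f r unitMeasure := by
  refine ⟨hf, ?_⟩
  have hhm := hh.1.enorm
  set H : ℝ → ℝ≥0∞ := hhm.mk _ with hH
  have hHm : Measurable H := hhm.measurable_mk
  have hHae : ∀ᵐ t ∂unitMeasure, ‖h t‖ₑ = H t := hhm.ae_eq_mk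
  have hfH : ∀ᵐ x ∂unitMeasure, ‖f x‖ₑ ≤ ∫⁻ t, k x t * H t ∂unitMeasure := by
    filter_upwards [ae_unitMeasure] with x hx
    refine (hfh x hx).trans (le_of_eq (lintegral_congr_ae ?_))
    filter_upwards [hHae] with t ht
    rw [ht]
  rcases eq_or_ne r ⊤ with rfl | hrt
  · have hb := hh.2
    rw [eLpNorm_exponent_top] at hb ⊢
    have hHb : ∀ᵐ t ∂unitMeasure, H t ≤ eLpNormEssSup h unitMeasure := by
      filter_upwards [hHae, enorm_ae_le_eLpNormEssSup h unitMeasure] with t h1 h2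
      rw [← h1]; exact h2
    refine lt_of_le_of_lt (eLpNormEssSup_le_of_ae_enorm_bound
      (C := C * eLpNormEssSup h unitMeasure) ?_) (ENNReal.mul_lt_top hC.lt_top hb)
    filter_upwards [hfH, ae_unitMeasure] with x hx hx01
    -- At r = ∞ the conventions give `r.toReal⁻¹ = 0`, so the first test condition reads ∫ k(x,t) dt
    -- ≤ C.
    have h1x := h1 x hx01
    simp only [ENNReal.toReal_top, inv_zero, neg_zero, Real.rpow_zero, ENNReal.ofReal_one,
      mul_one] at h1x
    refine hx.trans ?_
    calc ∫⁻ t, k x t * H t ∂unitMeasure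
        ≤ ∫⁻ t, k x t * eLpNormEssSup h unitMeasure ∂unitMeasure := by
          refine lintegral_mono_ae ?_
          filter_upwards [hHb] with t ht
          gcongr
      _ = (∫⁻ t, k x t ∂unitMeasure) * eLpNormEssSup h unitMeasure :=
          lintegral_mul_const _ (hk.comp measurable_prodMk_left)
      _ ≤ _ := by gcongr
  · have hr0 : r ≠ 0 := (zero_lt_one.trans_le hr).ne'
    have hhr := hh.2
    rw [eLpNorm_lt_top_iff_lintegral_rpow_enorm_lt_top hr0 hrt] at hhr ⊢
    have hHr : ∫⁻ t, H t ^ r.toReal ∂unitMeasure < ⊤ := by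
      refine lt_of_le_of_lt (le_of_eq (lintegral_congr_ae ?_)) hhr
      filter_upwards [hHae] with t ht
      rw [ht]
    have hr1 : 1 ≤ r.toReal := by
      rw [← ENNReal.toReal_one]; exact ENNReal.toReal_mono hrt hr
    have hle : ∫⁻ x, ‖f x‖ₑ ^ r.toReal ∂unitMeasure ≤
        ∫⁻ x, (∫⁻ t, k x t * H t ∂unitMeasure) ^ r.toReal ∂unitMeasure := by
      refine lintegral_mono_ae ?_
      filter_upwards [hfH] with x hx
      gcongr
    refine lt_of_le_of_lt hle ?_
    rcases hr1.eq_or_lt with h1r | h1r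
    -- At r = 1 the second test condition reads ∫ k(x,t) dx ≤ C, and Tonelli suffices.
    · rw [← h1r] at h2 hHr ⊢
      simp only [inv_one, sub_self, neg_zero, Real.rpow_zero, ENNReal.ofReal_one,
        mul_one, ENNReal.rpow_one] at h2 hHr ⊢
      rw [lintegral_lintegral_swap (hk.mul (hHm.comp measurable_snd)).aemeasurable]
      refine lt_of_le_of_lt ?_ (ENNReal.mul_lt_top hC.lt_top hHr)
      rw [← lintegral_const_mul _ hHm]
      refine lintegral_mono_ae ?_
      filter_upwards [ae_unitMeasure] with t ht
      rw [lintegral_mul_const _ (show Measurable (fun x => k x t) from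
        hk.comp measurable_prodMk_right)]
      gcongr
      exact h2 t ht
    -- With r' the conjugate exponent, the weight t^(-1/(r r')) has r'-th power t^(-1/r) and r-th
    -- power t^(-1/r'), the two test functions of the hypotheses.
    · set ρ : ℝ → ℝ≥0∞ := fun t => ENNReal.ofReal (t ^ (-(r.toReal⁻¹ * (1 - r.toReal⁻¹)))) with hρ
      have hrs : r.toReal.HolderConjugate (1 - r.toReal⁻¹)⁻¹ := by
        rw [Real.holderConjugate_iff]
        refine ⟨h1r, by rw [inv_inv]; ring⟩
      have hs0 : 0 < 1 - r.toReal⁻¹ := by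
        have := inv_lt_one_of_one_lt₀ h1r
        linarith
      have hρpos : ∀ x ∈ Ioo (0 : ℝ) 1, 0 < x ^ (-(r.toReal⁻¹ * (1 - r.toReal⁻¹))) :=
        fun x hx => Real.rpow_pos_of_pos hx.1 _
      have hρs : ∀ x ∈ Ioo (0 : ℝ) 1, ρ x ^ (1 - r.toReal⁻¹)⁻¹ =
          ENNReal.ofReal (x ^ (-r.toReal⁻¹)) := fun x hx => by
        rw [hρ, ENNReal.ofReal_rpow_of_pos (hρpos x hx), ← Real.rpow_mul hx.1.le]
        congr 2
        field_simp
      have hρr : ∀ x ∈ Ioo (0 : ℝ) 1, ρ x ^ r.toReal =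
          ENNReal.ofReal (x ^ (-(1 - r.toReal⁻¹))) := fun x hx => by
        rw [hρ, ENNReal.ofReal_rpow_of_pos (hρpos x hx), ← Real.rpow_mul hx.1.le]
        congr 2
        have : r.toReal ≠ 0 := by positivity
        field_simp
      refine lt_of_le_of_lt (lintegral_schur hk hHm (ρ := ρ) ?_ hrs ?_ ?_ (C := C) ?_ ?_) ?_
      · exact (measurable_id.pow_const _).ennreal_ofReal
      · exact fun x hx => by simpa [hρ] using hρpos x hx
      · exact fun x => ENNReal.ofReal_ne_top
      · intro x hx
        rw [hρs x hx]
        refine le_trans (le_of_eq (lintegral_congr_ae ?_)) (h1 x hx)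
        filter_upwards [ae_unitMeasure] with t ht
        rw [hρs t ht]
      · intro x hx
        rw [hρr x hx]
        refine le_trans (le_of_eq (lintegral_congr_ae ?_)) (h2 x hx)
        filter_upwards [ae_unitMeasure] with t ht
        rw [hρr t ht]
      · refine ENNReal.mul_lt_top (ENNReal.rpow_lt_top_of_nonneg ?_ hC)
          (ENNReal.mul_lt_top hC.lt_top hHr)
        exact div_nonneg hrs.pos.le hrs.symm.pos.le

theorem lintegral_rpow_lower {e x : ℝ} (he : -1 < e) (hx : 0 < x) :
    ∫⁻ t, (if t < x then ENNReal.ofReal (t ^ e) else 0) ∂unitMeasure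
      ≤ ENNReal.ofReal ((e + 1)⁻¹ * x ^ (e + 1)) := by
  have hi : IntervalIntegrable (fun t : ℝ => t ^ e) volume 0 x :=
    intervalIntegral.intervalIntegrable_rpow' he
  have e1 : ∫ t in Ioc 0 x, t ^ e = (e + 1)⁻¹ * x ^ (e + 1) := by
    rw [← intervalIntegral.integral_of_le hx.le, integral_rpow (Or.inl he),
      Real.zero_rpow (by linarith)]
    ring
  rw [← e1, ofReal_integral_eq_lintegral_ofReal hi.1
    ((ae_restrict_mem measurableSet_Ioc).mono fun t ht => Real.rpow_nonneg ht.1.le _),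
    ← lintegral_indicator measurableSet_Ioc, ← lintegral_indicator measurableSet_Ioo]
  refine lintegral_mono fun t => ?_
  by_cases h1 : t ∈ Ioo (0 : ℝ) 1
  · rw [indicator_of_mem h1]
    split_ifs with h2
    · rw [indicator_of_mem (show t ∈ Ioc 0 x from ⟨h1.1, h2.le⟩)]
    · exact zero_le
  · rw [indicator_of_notMem h1]
    exact zero_le

theorem lintegral_rpow_upper {e x : ℝ} (he : e < -1) (hx : 0 < x) :
    ∫⁻ t, (if x < t then ENNReal.ofReal (t ^ e) else 0) ∂unitMeasure
      ≤ ENNReal.ofReal ((-(e + 1))⁻¹ * x ^ (e + 1)) := by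
  have hi := integrableOn_Ioi_rpow_of_lt he hx
  have e1 : ∫ t in Ioi x, t ^ e = (-(e + 1))⁻¹ * x ^ (e + 1) := by
    rw [integral_Ioi_rpow_of_lt he hx, inv_neg]
    ring
  rw [← e1, ofReal_integral_eq_lintegral_ofReal hi
    ((ae_restrict_mem measurableSet_Ioi).mono fun t ht =>
      Real.rpow_nonneg (hx.trans ht).le _),
    ← lintegral_indicator measurableSet_Ioi, ← lintegral_indicator measurableSet_Ioo]
  refine lintegral_mono fun t => ?_
  by_cases h1 : t ∈ Ioo (0 : ℝ) 1
  · rw [indicator_of_mem h1]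
    split_ifs with h2
    · rw [indicator_of_mem (show t ∈ Ioi x from h2)]
    · exact zero_le
  · rw [indicator_of_notMem h1]
    exact zero_le

/-- The kernel of the operator `h ↦ x ^ (σ - 1) ∫₀ˣ t ^ (-σ) h(t) dt`. -/
def lowerKernel (σ x t : ℝ) : ℝ≥0∞ :=
  if t < x then ENNReal.ofReal (x ^ (σ - 1) * t ^ (-σ)) else 0

/-- The kernel of the operator `h ↦ x ^ (σ - 1) ∫ₓ¹ t ^ (-σ) h(t) dt`. -/
def upperKernel (σ x t : ℝ) : ℝ≥0∞ :=
  if x < t then ENNReal.ofReal (x ^ (σ - 1) * t ^ (-σ)) else 0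

theorem measurable_lowerKernel (σ : ℝ) : Measurable (Function.uncurry (lowerKernel σ)) :=
  Measurable.ite (measurableSet_lt measurable_snd measurable_fst)
    ((measurable_fst.pow_const _).mul (measurable_snd.pow_const _)).ennreal_ofReal measurable_const

theorem measurable_upperKernel (σ : ℝ) : Measurable (Function.uncurry (upperKernel σ)) :=
  Measurable.ite (measurableSet_lt measurable_fst measurable_snd)
    ((measurable_fst.pow_const _).mul (measurable_snd.pow_const _)).ennreal_ofReal measurable_const

/-- Bounds a power integral against a power kernel, after pulling out the factor `y ^ b`. -/
theorem lintegral_kernel_aux {P : ℝ → Prop} [DecidablePred P] {b e e' c y : ℝ} (hc : 0 ≤ c)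
    (hy : 0 < y) {K : ℝ → ℝ≥0∞}
    (hK : ∀ t ∈ Ioo (0 : ℝ) 1, K t = if P t then ENNReal.ofReal (y ^ b * t ^ e) else 0)
    (hP : MeasurableSet {t | P t}) {a : ℝ}
    (hb : ∫⁻ t, (if P t then ENNReal.ofReal (t ^ (e + a)) else 0) ∂unitMeasure ≤
      ENNReal.ofReal (c * y ^ e')) :
    ∫⁻ t, K t * ENNReal.ofReal (t ^ a) ∂unitMeasure ≤
      ENNReal.ofReal c * ENNReal.ofReal (y ^ (b + e')) := by
  have e1 : ∫⁻ t, K t * ENNReal.ofReal (t ^ a) ∂unitMeasure =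
      ENNReal.ofReal (y ^ b) *
        ∫⁻ t, (if P t then ENNReal.ofReal (t ^ (e + a)) else 0) ∂unitMeasure := by
    rw [← lintegral_const_mul _ (show Measurable (fun t : ℝ =>
      if P t then ENNReal.ofReal (t ^ (e + a)) else 0) from
      Measurable.ite hP (measurable_id.pow_const _).ennreal_ofReal measurable_const)]
    refine lintegral_congr_ae ?_
    filter_upwards [ae_unitMeasure] with t ht
    rw [hK t ht]
    split_ifs
    · have := ht.1
      rw [← ENNReal.ofReal_mul (by positivity), ← ENNReal.ofReal_mul (by positivity),
        Real.rpow_add this, mul_assoc]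
    · simp
  rw [e1]
  calc _ ≤ ENNReal.ofReal (y ^ b) * ENNReal.ofReal (c * y ^ e') := by gcongr
    _ = _ := by
      rw [← ENNReal.ofReal_mul (by positivity), ← ENNReal.ofReal_mul hc, Real.rpow_add hy]
      congr 1; ring

/-- Hardy's inequality. On the test powers both Schur integrals give the same constant 1/(1 - 1/r -
σ), and `hσ` is what makes them converge, one at 0 and the other at infinity. -/
theorem memLp_of_lowerKernel_le {σ : ℝ} {r : ℝ≥0∞} (hr : 1 ≤ r) (hσ : σ < 1 - r.toReal⁻¹)
    {f h : ℝ → ℂ} (hh : MemLp h r unitMeasure) (hf : AEStronglyMeasurable f unitMeasure)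
    (hfh : ∀ x ∈ Ioo (0 : ℝ) 1, ‖f x‖ₑ ≤ ∫⁻ t, lowerKernel σ x t * ‖h t‖ₑ ∂unitMeasure) :
    MemLp f r unitMeasure := by
  have hc : 0 < (1 - r.toReal⁻¹ - σ)⁻¹ := inv_pos.2 (by linarith)
  refine memLp_of_kernel_le (measurable_lowerKernel σ) hr
    (C := ENNReal.ofReal (1 - r.toReal⁻¹ - σ)⁻¹) ENNReal.ofReal_ne_top ?_ ?_ hh hf hfh
  · intro x hx
    have h1 := lintegral_rpow_lower (e := -σ + -r.toReal⁻¹) (x := x) (by linarith) hx.1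
    have e0 : -σ + -r.toReal⁻¹ + 1 = 1 - r.toReal⁻¹ - σ := by ring
    rw [e0] at h1
    have h2 := lintegral_kernel_aux (P := fun t => t < x) (b := σ - 1) hc.le hx.1
      (K := lowerKernel σ x) (fun t _ => rfl) measurableSet_Iio h1
    convert h2 using 4
    ring
  · intro t ht
    have h1 := lintegral_rpow_upper (e := (σ - 1) + -(1 - r.toReal⁻¹)) (x := t) (by linarith) ht.1
    have e0 : -((σ - 1) + -(1 - r.toReal⁻¹) + 1) = 1 - r.toReal⁻¹ - σ := by ring
    rw [e0] at h1
    have h2 := lintegral_kernel_aux (P := fun x => t < x) (b := -σ) hc.le ht.1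
      (K := fun x => lowerKernel σ x t) (fun x _ => by simp only [lowerKernel, mul_comm])
      measurableSet_Ioi h1
    convert h2 using 4
    ring

/-- The dual Hardy inequality: the roles of 0 and infinity are exchanged, which reverses the
condition on σ. -/
theorem memLp_of_upperKernel_le {σ : ℝ} {r : ℝ≥0∞} (hr : 1 ≤ r) (hσ : 1 - r.toReal⁻¹ < σ)
    {f h : ℝ → ℂ} (hh : MemLp h r unitMeasure) (hf : AEStronglyMeasurable f unitMeasure)
    (hfh : ∀ x ∈ Ioo (0 : ℝ) 1, ‖f x‖ₑ ≤ ∫⁻ t, upperKernel σ x t * ‖h t‖ₑ ∂unitMeasure) :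
    MemLp f r unitMeasure := by
  have hc : 0 < (σ - (1 - r.toReal⁻¹))⁻¹ := inv_pos.2 (by linarith)
  refine memLp_of_kernel_le (measurable_upperKernel σ) hr
    (C := ENNReal.ofReal (σ - (1 - r.toReal⁻¹))⁻¹) ENNReal.ofReal_ne_top ?_ ?_ hh hf hfh
  · intro x hx
    have h1 := lintegral_rpow_upper (e := -σ + -r.toReal⁻¹) (x := x) (by linarith) hx.1
    have e0 : -(-σ + -r.toReal⁻¹ + 1) = σ - (1 - r.toReal⁻¹) := by ring
    rw [e0] at h1
    have h2 := lintegral_kernel_aux (P := fun t => x < t) (b := σ - 1) hc.le hx.1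
      (K := upperKernel σ x) (fun t _ => rfl) measurableSet_Ioi h1
    convert h2 using 4
    ring
  · intro t ht
    have h1 := lintegral_rpow_lower (e := (σ - 1) + -(1 - r.toReal⁻¹)) (x := t) (by linarith) ht.1
    have e0 : (σ - 1) + -(1 - r.toReal⁻¹) + 1 = σ - (1 - r.toReal⁻¹) := by ring
    rw [e0] at h1
    have h2 := lintegral_kernel_aux (P := fun x => x < t) (b := -σ) hc.le ht.1
      (K := fun x => upperKernel σ x t) (fun x _ => by simp only [upperKernel, mul_comm])
      measurableSet_Iio h1
    convert h2 using 4
    ring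

theorem norm_rpow_ofReal {x : ℝ} (hx : 0 < x) (s : ℝ) : ‖((x ^ s : ℝ) : ℂ)‖ = x ^ s := by
  rw [Complex.norm_real, Real.norm_of_nonneg (Real.rpow_nonneg hx.le s)]

theorem rpow_ofReal_mul {x : ℝ} (hx : 0 < x) (s t : ℝ) :
    ((x ^ s : ℝ) : ℂ) * ((x ^ t : ℝ) : ℂ) = ((x ^ (s + t) : ℝ) : ℂ) := by
  rw [← Complex.ofReal_mul, Real.rpow_add hx]

theorem continuousOn_rpow_ofReal (s : ℝ) : ContinuousOn (fun x : ℝ => ((x ^ s : ℝ) : ℂ)) (Ioi 0) :=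
  Complex.continuous_ofReal.comp_continuousOn
    (continuousOn_id.rpow_const fun _ hx => Or.inl (ne_of_gt hx))

theorem _root_.ContinuousOn.aestronglyMeasurable_unit {f : ℝ → ℂ} (hf : ContinuousOn f (Ioi 0)) :
    AEStronglyMeasurable f unitMeasure :=
  (hf.mono fun _ hx => hx.1).aestronglyMeasurable measurableSet_Ioo

theorem memLp_rpow {s : ℝ} {r : ℝ≥0∞} (hr : 1 ≤ r) (hs : -r.toReal⁻¹ < s) :
    MemLp (fun x : ℝ => ((x ^ s : ℝ) : ℂ)) r unitMeasure := by
  have hm := (continuousOn_rpow_ofReal s).aestronglyMeasurable_unit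
  rcases eq_or_ne r ⊤ with rfl | hrt
  · refine MemLp.of_bound hm 1 ?_
    filter_upwards [ae_unitMeasure] with x hx
    rw [norm_rpow_ofReal hx.1]
    simp only [ENNReal.toReal_top, inv_zero, neg_zero] at hs
    exact Real.rpow_le_one hx.1.le hx.2.le hs.le
  · have hr0 : r ≠ 0 := (zero_lt_one.trans_le hr).ne'
    have hrp : 0 < r.toReal := ENNReal.toReal_pos hr0 hrt
    rw [← integrable_norm_rpow_iff hm hr0 hrt]
    have h1 : IntegrableOn (fun x : ℝ => x ^ (s * r.toReal)) (Ioo 0 1) := by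
      rw [intervalIntegral.integrableOn_Ioo_rpow_iff one_pos]
      have := mul_lt_mul_of_pos_right hs hrp
      rwa [neg_mul, inv_mul_cancel₀ hrp.ne'] at this
    refine h1.congr ?_
    filter_upwards [ae_unitMeasure] with x hx
    rw [norm_rpow_ofReal hx.1, Real.rpow_mul hx.1.le]

/-- `∫ₓ¹ (x/t)^σ |h(t)| dt → 0` as `x → 0`. -/
theorem tendsto_upper_average {σ : ℝ} (hσ : 0 < σ) {h : ℝ → ℂ} (hh : Integrable h unitMeasure) :
    Tendsto (fun x : ℝ => ∫ t, (if x < t then (x / t) ^ σ * ‖h t‖ else 0) ∂unitMeasure)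
      (𝓝[>] 0) (𝓝 0) := by
  have h0 : 𝓝 (0 : ℝ) = 𝓝 (∫ _, (0 : ℝ) ∂unitMeasure) := by simp
  rw [h0]
  refine tendsto_integral_filter_of_dominated_convergence (fun t => ‖h t‖) ?_ ?_ hh.norm ?_
  · refine Eventually.of_forall fun x => ?_
    have hm : Measurable fun t : ℝ => (x / t) ^ σ := (measurable_const.div measurable_id).pow_const σ
    exact AEStronglyMeasurable.indicator (s := Ioi x)
      (hm.aestronglyMeasurable.mul hh.1.norm) measurableSet_Ioi
  · filter_upwards [self_mem_nhdsWithin] with x hx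
    filter_upwards with t
    split_ifs with hxt
    · have hx0 : (0 : ℝ) < x := hx
      have ht0 : 0 < t := hx0.trans hxt
      rw [Real.norm_of_nonneg (by positivity)]
      have : (x / t) ^ σ ≤ 1 := Real.rpow_le_one (by positivity) ((div_le_one ht0).2 hxt.le) hσ.le
      exact mul_le_of_le_one_left (norm_nonneg _) this
    · simp
  · filter_upwards [ae_unitMeasure] with t ht
    have h1 : Tendsto (fun x : ℝ => (x / t) ^ σ * ‖h t‖) (𝓝[>] 0) (𝓝 0) := by
      have hc : ContinuousAt (fun x : ℝ => (x / t) ^ σ * ‖h t‖) 0 :=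
        ((continuousAt_id.div_const t).rpow_const (Or.inr hσ.le)).mul continuousAt_const
      have := hc.tendsto
      simp only [zero_div, Real.zero_rpow hσ.ne', zero_mul] at this
      exact this.mono_left nhdsWithin_le_nhds
    refine h1.congr' ?_
    filter_upwards [Ioo_mem_nhdsGT ht.1] with x hx
    rw [if_pos hx.2]

/-! ### The scalar Euler equation x y' = σ y + S + x f near 0 -/

/-- The function x^(-σ) E is a primitive of x^(-σ) h. If σ < 0, it is integrated from 0, where the
hypothesis supplies the value zero; if σ > 1 - 1/r, it is integrated from 1. The two Hardy
inequalities then bound E/x. The limit of E comes from (x/t)^σ ≤ 1 on the range of integration: it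
gives a bound by ∫₀ˣ |h| in the first case and dominated convergence in the second. -/
theorem euler_homogeneous {σ : ℝ} {r : ℝ≥0∞} (hr : 1 ≤ r) {E h : ℝ → ℂ}
    (hE : IsPrim E (fun x => σ * (E x / x) + h x)) (hh : MemLp h r unitMeasure)
    (hcase : (σ < 0 ∧ Tendsto (fun x : ℝ => ((x ^ (-σ) : ℝ) : ℂ) * E x) (𝓝[>] 0) (𝓝 0)) ∨
      1 - r.toReal⁻¹ < σ) :
    MemLp (fun x => E x / x) r unitMeasure ∧ Tendsto E (𝓝[>] 0) (𝓝 0) := by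
  have hh1 : IntegrableOn h (Ioo 0 1) := hh.integrable hr
  have hEc : ContinuousOn (fun x => E x / x) (Ioi 0) := hE.continuousOn.div
    Complex.continuous_ofReal.continuousOn fun x hx => by
      exact_mod_cast ne_of_gt (show (0 : ℝ) < x from hx)
  have hEm := hEc.aestronglyMeasurable_unit
  have hD : IsPrim (fun x => ((x ^ (-σ) : ℝ) : ℂ) * E x) (fun x => ((x ^ (-σ) : ℝ) : ℂ) * h x) := by
    refine ((IsPrim.cpow_ofReal (-σ)).mul hE).congr (fun _ _ => rfl) fun x hx => ?_
    have hxc : (x : ℂ) ≠ 0 := by exact_mod_cast hx.ne'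
    rw [Real.rpow_sub_one hx.ne']
    push_cast
    field_simp
    ring
  have hED : ∀ x, 0 < x → E x = ((x ^ σ : ℝ) : ℂ) * (((x ^ (-σ) : ℝ) : ℂ) * E x) := fun x hx => by
    rw [← mul_assoc, rpow_ofReal_mul hx, add_neg_cancel, Real.rpow_zero]; simp
  have hED' : ∀ x, 0 < x → E x / x =
      ((x ^ (σ - 1) : ℝ) : ℂ) * (((x ^ (-σ) : ℝ) : ℂ) * E x) := fun x hx => by
    have hxc : (x : ℂ) ≠ 0 := by exact_mod_cast hx.ne'
    conv_lhs => rw [hED x hx]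
    rw [Real.rpow_sub_one hx.ne']
    push_cast
    field_simp
  rcases hcase with ⟨hσ, h0⟩ | hσ
  · have hbd : ∀ t ∈ Ioo (0 : ℝ) 1, ‖((t ^ (-σ) : ℝ) : ℂ)‖ ≤ 1 := fun t ht => by
      rw [norm_rpow_ofReal ht.1]
      exact Real.rpow_le_one ht.1.le ht.2.le (by linarith)
    have hint : IntegrableOn (fun x => ((x ^ (-σ) : ℝ) : ℂ) * h x) (Ioo 0 1) := by
      refine hh1.bdd_mul (c := 1) (continuousOn_rpow_ofReal _).aestronglyMeasurable_unit ?_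
      filter_upwards [ae_unitMeasure] with t ht using hbd t ht
    obtain ⟨c, hc, hrep⟩ := hD.exists_tendsto hint
    -- The assumed decay rules out the homogeneous solution x^σ, which is unbounded for σ < 0.
    have hc0 : c = 0 := tendsto_nhds_unique hc h0
    subst hc0
    refine ⟨memLp_of_lowerKernel_le hr (σ := σ) ?_ hh hEm fun x hx => ?_, ?_⟩
    · have : r.toReal⁻¹ ≤ 1 := by
        rcases eq_or_ne r ⊤ with rfl | hrt
        · simp
        · refine inv_le_one_of_one_le₀ ?_
          rw [← ENNReal.toReal_one]; exact ENNReal.toReal_mono hrt hr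
      linarith
    · rw [hED' x hx.1, hrep x ⟨hx.1, hx.2.le⟩, zero_add, ← intervalIntegral.integral_const_mul,
        intervalIntegral.integral_of_le hx.1.le]
      refine (enorm_integral_le_lintegral_enorm _).trans ?_
      rw [← lintegral_indicator measurableSet_Ioc, ← lintegral_indicator measurableSet_Ioo,
        ← lintegral_congr_ae (f := (Ioo 0 x).indicator _)
        (indicator_ae_eq_of_ae_eq_set Ioo_ae_eq_Ioc)]
      refine lintegral_mono fun t => ?_
      by_cases ht : t ∈ Ioo 0 x
      · rw [indicator_of_mem ht, indicator_of_mem (show t ∈ Ioo (0 : ℝ) 1 from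
          ⟨ht.1, ht.2.trans hx.2⟩), lowerKernel, if_pos ht.2, ← mul_assoc, enorm_mul,
          ← Complex.ofReal_mul]
        gcongr
        rw [← ofReal_norm, Complex.norm_real, Real.norm_of_nonneg]
        exact mul_nonneg (Real.rpow_nonneg hx.1.le _) (Real.rpow_nonneg ht.1.le _)
      · rw [indicator_of_notMem ht]; exact zero_le
    · have hi : IntervalIntegrable (fun t => ‖h t‖) volume 0 1 := by
        rw [intervalIntegrable_iff_integrableOn_Ioo_of_le zero_le_one]; exact hh1.norm
      have hlim : Tendsto (fun x => ∫ t in (0 : ℝ)..x, ‖h t‖) (𝓝[>] 0) (𝓝 0) := by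
        have hc := intervalIntegral.continuousOn_primitive_interval' hi left_mem_uIcc 0
          left_mem_uIcc
        rw [ContinuousWithinAt, intervalIntegral.integral_same] at hc
        refine hc.mono_left (nhdsWithin_le_iff.2 ?_)
        rw [uIcc_of_le zero_le_one]
        exact mem_of_superset (Ioc_mem_nhdsGT one_pos) Ioc_subset_Icc_self
      refine squeeze_zero_norm' ?_ hlim
      filter_upwards [Ioo_mem_nhdsGT one_pos] with x hx
      rw [hED x hx.1, hrep x ⟨hx.1, hx.2.le⟩, zero_add, ← intervalIntegral.integral_const_mul]
      refine intervalIntegral.norm_integral_le_of_norm_le hx.1.le ?_ (hi.mono_set ?_)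
      · filter_upwards with t ht
        rw [← mul_assoc, norm_mul, norm_mul, norm_rpow_ofReal hx.1, norm_rpow_ofReal ht.1]
        refine mul_le_of_le_one_left (norm_nonneg _) ?_
        rw [Real.rpow_neg ht.1.le, ← div_eq_mul_inv]
        exact (div_le_one (Real.rpow_pos_of_pos ht.1 _)).2
          (Real.rpow_le_rpow_of_nonpos ht.1 ht.2 hσ.le)
      · rw [uIcc_of_le hx.1.le, uIcc_of_le zero_le_one]; exact Icc_subset_Icc_right hx.2.le
  · have hr1 : r.toReal⁻¹ ≤ 1 := by
      rcases eq_or_ne r ⊤ with rfl | hrt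
      · simp
      · refine inv_le_one_of_one_le₀ ?_
        rw [← ENNReal.toReal_one]; exact ENNReal.toReal_mono hrt hr
    have hσ0 : 0 < σ := by linarith
    -- Now x^(-σ) h need not be integrable at 0. The homogeneous part E(1) x^σ is harmless because
    -- x^(σ-1) lies in L^r.
    set U : ℝ → ℂ := fun x => ∫ t in x..1, ((t ^ (-σ) : ℝ) : ℂ) * h t with hU
    have hDU : ∀ x, 0 < x → ((x ^ (-σ) : ℝ) : ℂ) * E x = E 1 - U x := fun x hx => by
      have := hD.sub_eq x 1 hx one_pos
      rw [hU]; simp only [← this]; simp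
    have hUm : ContinuousOn U (Ioi 0) := by
      have : ContinuousOn (fun x => E 1 - ((x ^ (-σ) : ℝ) : ℂ) * E x) (Ioi 0) :=
        continuousOn_const.sub hD.continuousOn
      refine this.congr fun x hx => ?_
      simp only [hDU x hx]; ring
    constructor
    · have e1 : MemLp (fun x : ℝ => E 1 * ((x ^ (σ - 1) : ℝ) : ℂ)) r unitMeasure :=
        (memLp_rpow hr (by linarith)).const_mul _
      have e2 : MemLp (fun x : ℝ => ((x ^ (σ - 1) : ℝ) : ℂ) * U x) r unitMeasure := by
        refine memLp_of_upperKernel_le hr hσ hh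
          ((continuousOn_rpow_ofReal _).mul hUm).aestronglyMeasurable_unit fun x hx => ?_
        rw [hU, ← intervalIntegral.integral_const_mul,
          intervalIntegral.integral_of_le hx.2.le]
        refine (enorm_integral_le_lintegral_enorm _).trans ?_
        rw [← lintegral_indicator measurableSet_Ioc, ← lintegral_indicator measurableSet_Ioo,
          ← lintegral_congr_ae (f := (Ioo x 1).indicator _)
          (indicator_ae_eq_of_ae_eq_set Ioo_ae_eq_Ioc)]
        refine lintegral_mono fun t => ?_
        by_cases ht : t ∈ Ioo x 1
        · have ht0 : 0 < t := hx.1.trans ht.1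
          rw [indicator_of_mem ht, indicator_of_mem (show t ∈ Ioo (0 : ℝ) 1 from
            ⟨ht0, ht.2⟩), upperKernel, if_pos ht.1, ← mul_assoc, enorm_mul,
            ← Complex.ofReal_mul]
          gcongr
          rw [← ofReal_norm, Complex.norm_real, Real.norm_of_nonneg]
          exact mul_nonneg (Real.rpow_nonneg hx.1.le _) (Real.rpow_nonneg ht0.le _)
        · rw [indicator_of_notMem ht]; exact zero_le
      refine (e1.sub e2).ae_eq ?_
      filter_upwards [ae_unitMeasure] with x hx
      simp only [Pi.sub_apply]
      rw [hED' x hx.1, hDU x hx.1]; ring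
    · have e1 : Tendsto (fun x : ℝ => ((x ^ σ : ℝ) : ℂ) * E 1) (𝓝[>] 0) (𝓝 0) := by
        have hc : ContinuousAt (fun x : ℝ => ((x ^ σ : ℝ) : ℂ) * E 1) 0 :=
          (Complex.continuous_ofReal.continuousAt.comp
            (continuousAt_id.rpow_const (Or.inr hσ0.le))).mul continuousAt_const
        have := hc.tendsto
        simp only [Real.zero_rpow hσ0.ne', Complex.ofReal_zero, zero_mul] at this
        exact this.mono_left nhdsWithin_le_nhds
      have e2 : Tendsto (fun x : ℝ => ((x ^ σ : ℝ) : ℂ) * U x) (𝓝[>] 0) (𝓝 0) := by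
        refine squeeze_zero_norm' ?_ (tendsto_upper_average hσ0 hh1)
        filter_upwards [Ioo_mem_nhdsGT one_pos] with x hx
        rw [hU, ← intervalIntegral.integral_const_mul,
          intervalIntegral.integral_of_le hx.2.le]
        refine (norm_integral_le_integral_norm _).trans (le_of_eq ?_)
        rw [← integral_indicator measurableSet_Ioc, ← integral_indicator measurableSet_Ioo,
          ← integral_congr_ae (f := (Ioo x 1).indicator _)
          (indicator_ae_eq_of_ae_eq_set Ioo_ae_eq_Ioc)]
        congr 1
        ext t
        by_cases ht : t ∈ Ioo x 1
        · have ht0 : 0 < t := hx.1.trans ht.1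
          rw [indicator_of_mem ht, indicator_of_mem (show t ∈ Ioo (0 : ℝ) 1 from
            ⟨ht0, ht.2⟩), if_pos ht.1, ← mul_assoc, norm_mul, norm_mul, norm_rpow_ofReal hx.1,
            norm_rpow_ofReal ht0, Real.div_rpow hx.1.le ht0.le, Real.rpow_neg ht0.le]
          rfl
        · rw [indicator_of_notMem ht]
          by_cases h01 : t ∈ Ioo (0 : ℝ) 1
          · rw [indicator_of_mem h01, if_neg fun h => ht ⟨h, h01.2⟩]
          · rw [indicator_of_notMem h01]
      have := e1.sub e2
      rw [sub_zero] at this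
      refine this.congr' ?_
      filter_upwards [self_mem_nhdsWithin] with x hx
      rw [hED x hx, hDU x hx]; ring

/-- On `(0, ∞)`, `f` is a primitive of a function that lies in `L^r(0, 1)`. -/
def IsReg (r : ℝ≥0∞) (f : ℝ → ℂ) : Prop := ∃ g, IsPrim f g ∧ MemLp g r unitMeasure

namespace IsReg

variable {r : ℝ≥0∞} {f g : ℝ → ℂ}

theorem memW1 (hr : 1 ≤ r) (h : IsReg r f) : MemW1 r f := by
  obtain ⟨g, hg, hgr⟩ := h
  obtain ⟨c, -, hc⟩ := hg.exists_tendsto (hgr.integrable hr)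
  exact ⟨c, g, hgr, fun x hx => hc x ⟨hx.1, hx.2.le⟩⟩

theorem exists_tendsto (hr : 1 ≤ r) (h : IsReg r f) : ∃ c, Tendsto f (𝓝[>] 0) (𝓝 c) := by
  obtain ⟨g, hg, hgr⟩ := h
  obtain ⟨c, hc, -⟩ := hg.exists_tendsto (hgr.integrable hr)
  exact ⟨c, hc⟩

theorem add (hf : IsReg r f) (hg : IsReg r g) : IsReg r (fun x => f x + g x) := by
  obtain ⟨f', hf, hfr⟩ := hf
  obtain ⟨g', hg, hgr⟩ := hg
  exact ⟨_, hf.add hg, hfr.add hgr⟩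

theorem const_mul (hf : IsReg r f) (c : ℂ) : IsReg r (fun x => c * f x) := by
  obtain ⟨f', hf, hfr⟩ := hf
  exact ⟨_, hf.const_mul c, hfr.const_mul c⟩

theorem sub (hf : IsReg r f) (hg : IsReg r g) : IsReg r (fun x => f x - g x) := by
  obtain ⟨f', hf, hfr⟩ := hf
  obtain ⟨g', hg, hgr⟩ := hg
  exact ⟨_, hf.sub hg, hfr.sub hgr⟩

theorem const (c : ℂ) : IsReg r (fun _ => c) := ⟨_, IsPrim.const c, MemLp.zero'⟩

theorem mono {r' : ℝ≥0∞} (hf : IsReg r f) (h : r' ≤ r) : IsReg r' f := by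
  obtain ⟨f', hf, hfr⟩ := hf
  exact ⟨f', hf, hfr.mono_exponent h⟩

theorem congr (hf : IsReg r f) (h : ∀ x, 0 < x → g x = f x) : IsReg r g := by
  obtain ⟨f', hf, hfr⟩ := hf
  exact ⟨f', hf.congr h fun _ _ => rfl, hfr⟩

theorem continuousOn (hf : IsReg r f) : ContinuousOn f (Ioi 0) := by
  obtain ⟨f', hf, -⟩ := hf
  exact hf.continuousOn

end IsReg

/-- Regularity at `0` for the inhomogeneous Euler equation `x y' = σ y + S + x f`. -/
theorem euler_regularity {σ : ℝ} {r : ℝ≥0∞} (hr : 1 ≤ r) {y S f : ℝ → ℂ}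
    (hy : IsPrim y (fun x => (σ * y x + S x) / x + f x)) (hS : IsReg r S)
    (hf : MemLp f r unitMeasure)
    (hcase : (σ < 0 ∧ Tendsto (fun x : ℝ => ((x ^ (-σ) : ℝ) : ℂ) * (σ * y x + S x)) (𝓝[>] 0) (𝓝 0)) ∨
      1 - r.toReal⁻¹ < σ ∨ (σ = 0 ∧ ∀ x, 0 < x → S x = 0)) :
    IsReg r y ∧ Tendsto (fun x => σ * y x + S x) (𝓝[>] 0) (𝓝 0) := by
  obtain ⟨S', hS, hS'⟩ := hS
  have main : ((σ < 0 ∧ Tendsto (fun x : ℝ => ((x ^ (-σ) : ℝ) : ℂ) * (σ * y x + S x))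
      (𝓝[>] 0) (𝓝 0)) ∨ 1 - r.toReal⁻¹ < σ) →
      IsReg r y ∧ Tendsto (fun x => σ * y x + S x) (𝓝[>] 0) (𝓝 0) := by
    intro hc
    -- For E = σ y + S the source S enters only through its derivative, which lies in L^r; and y' =
    -- E/x + f.
    have hE : IsPrim (fun x => σ * y x + S x)
        (fun x => σ * ((σ * y x + S x) / x) + (σ * f x + S' x)) :=
      ((hy.const_mul σ).add hS).congr (fun _ _ => rfl) fun _ _ => by ring
    obtain ⟨h1, h2⟩ := euler_homogeneous hr hE ((hf.const_mul σ).add hS') hc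
    exact ⟨⟨_, hy, h1.add hf⟩, h2⟩
  rcases hcase with h | h | ⟨h1, h2⟩
  · exact main (Or.inl h)
  · exact main (Or.inr h)
  · subst h1
    refine ⟨⟨f, hy.congr (fun _ _ => rfl) fun x hx => by simp [h2 x hx], hf⟩, ?_⟩
    refine tendsto_const_nhds.congr' ?_
    filter_upwards [self_mem_nhdsWithin] with x hx
    simp [h2 x hx]

/-! ### Solutions of the radial equation and their components at scale x^m -/

/-- `f` solves `-f'' + (l(l+1)/x² + Q) f = g` on `(0, ∞)`, and `f'` is its derivative. -/
structure IsSol (l : ℝ) (Q g f f' : ℝ → ℂ) : Prop where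
  prim : IsPrim f f'
  prim_deriv : IsPrim f' (fun x => (((l * (l + 1) / x ^ 2 : ℝ) : ℂ) + Q x) * f x - g x)

theorem IsPrim.eq_of_deriv_zero {f : ℝ → ℂ} (h : IsPrim f fun _ => 0) {x y : ℝ} (hx : 0 < x)
    (hy : 0 < y) : f x = f y := by
  have := h.sub_eq y x hy hx
  simpa [sub_eq_zero] using this

namespace IsSol

variable {l : ℝ} {Q g g₁ f f' f₁ f₁' : ℝ → ℂ}

theorem hasDerivAt (h : IsSol l Q g f f') {x : ℝ} (hx : 0 < x) : HasDerivAt f (f' x) x :=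
  h.prim.hasDerivAt h.prim_deriv.continuousOn hx

theorem continuousOn (h : IsSol l Q g f f') : ContinuousOn f (Ioi 0) := h.prim.continuousOn

theorem continuousOn_deriv (h : IsSol l Q g f f') : ContinuousOn f' (Ioi 0) :=
  h.prim_deriv.continuousOn

theorem sub (h : IsSol l Q g f f') (h₁ : IsSol l Q g₁ f₁ f₁') :
    IsSol l Q (fun x => g x - g₁ x) (fun x => f x - f₁ x) (fun x => f' x - f₁' x) :=
  ⟨h.prim.sub h₁.prim, (h.prim_deriv.sub h₁.prim_deriv).congr (fun _ _ => rfl) fun _ _ => by ring⟩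

theorem wronskian (h : IsSol l Q (fun _ => 0) f f') (h₁ : IsSol l Q (fun _ => 0) f₁ f₁') {x y : ℝ}
    (hx : 0 < x) (hy : 0 < y) : f x * f₁' x - f' x * f₁ x = f y * f₁' y - f' y * f₁ y := by
  refine IsPrim.eq_of_deriv_zero (f := fun x => f x * f₁' x - f' x * f₁ x) ?_ hx hy
  exact ((h.prim.mul h₁.prim_deriv).sub (h.prim_deriv.mul h₁.prim)).congr (fun _ _ => rfl)
    fun _ _ => by ring

end IsSol

theorem intervalIntegrable_potential {l : ℝ} {Q : ℝ → ℂ}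
    (hQ : ∀ a b, 0 < a → 0 < b → IntervalIntegrable Q volume a b) {a b : ℝ} (ha : 0 < a)
    (hb : 0 < b) :
    IntervalIntegrable (fun x => ((l * (l + 1) / x ^ 2 : ℝ) : ℂ) + Q x) volume a b := by
  refine IntervalIntegrable.add (ContinuousOn.intervalIntegrable_of_pos ?_ ha hb) (hQ a b ha hb)
  refine Complex.continuous_ofReal.comp_continuousOn (continuousOn_const.div (by fun_prop) ?_)
  intro x hx
  have : (0 : ℝ) < x := hx
  positivity

theorem IsSolution.isSol {l : ℝ} {q : ℝ → ℝ} {z : ℂ} {u : ℝ → ℂ} (h : IsSolution l q z u)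
    (hq : ∀ a b, 0 < a → 0 < b → IntervalIntegrable (fun x => (q x : ℂ) - z) volume a b) :
    IsSol l (fun x => (q x : ℂ) - z) (fun _ => 0) u (deriv u) := by
  have hc : ContinuousOn u (Ioi 0) := fun x hx =>
    (h.differentiableAt x hx).continuousAt.continuousWithinAt
  have h2 : IsPrim (deriv u) (fun x => (((l * (l + 1) / x ^ 2 : ℝ) : ℂ) + ((q x : ℂ) - z)) * u x
      - 0) := by
    have hi : ∀ a b, 0 < a → 0 < b → IntervalIntegrable
        (fun x => (((l * (l + 1) / x ^ 2 : ℝ) : ℂ) + ((q x : ℂ) - z)) * u x - 0) volume a b := by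
      intro a b ha hb
      simp only [sub_zero]
      exact (intervalIntegrable_potential hq ha hb).mul_continuousOn
        (hc.mono (uIcc_subset_Ioi ha hb))
    refine ⟨hi, fun a b ha hb => ?_⟩
    rw [h.deriv_sub a b ha hb]
    congr 1; ext x; push_cast; ring
  exact ⟨IsPrim.of_hasDerivAt (fun x hx => (h.differentiableAt x hx).hasDerivAt) h2.continuousOn, h2⟩

theorem tendsto_rpow_zero {s : ℝ} (hs : 0 < s) :
    Tendsto (fun x : ℝ => ((x ^ s : ℝ) : ℂ)) (𝓝[>] 0) (𝓝 0) := by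
  have hc : ContinuousAt (fun x : ℝ => ((x ^ s : ℝ) : ℂ)) 0 :=
    Complex.continuous_ofReal.continuousAt.comp (continuousAt_id.rpow_const (Or.inr hs.le))
  have := hc.tendsto
  simp only [Real.zero_rpow hs.ne', Complex.ofReal_zero] at this
  exact this.mono_left nhdsWithin_le_nhds

theorem exists_bound_of_tendsto {f : ℝ → ℂ} (hf : ContinuousOn f (Ioi 0)) {c : ℂ}
    (hc : Tendsto f (𝓝[>] 0) (𝓝 c)) (X : ℝ) : ∃ C, 0 < C ∧ ∀ x ∈ Ioc 0 X, ‖f x‖ ≤ C := by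
  have h1 : ∀ᶠ x in 𝓝[>] (0 : ℝ), ‖f x‖ < ‖c‖ + 1 := hc.norm.eventually_lt_const (by linarith)
  obtain ⟨δ, hδ, h1⟩ := mem_nhdsGT_iff_exists_Ioo_subset.1 h1
  have hδ0 : (0 : ℝ) < δ := hδ
  obtain ⟨M, hM⟩ := (isCompact_Icc (a := δ / 2) (b := X)).exists_bound_of_continuousOn
    (hf.mono fun x hx => lt_of_lt_of_le (by positivity) hx.1)
  refine ⟨max (‖c‖ + 1) M, lt_max_of_lt_left (by positivity), fun x hx => ?_⟩
  rcases lt_or_ge x δ with h | h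
  · exact (h1 ⟨hx.1, h⟩).le.trans (le_max_left _ _)
  · exact (hM x ⟨by linarith, hx.2⟩).trans (le_max_right _ _)

/-- Multiplication by a continuous function that has a limit at `0` preserves `L^r(0, 1)`. -/
theorem memLp_mul_of_tendsto {w f : ℝ → ℂ} {r : ℝ≥0∞} (hw : MemLp w r unitMeasure)
    (hf : ContinuousOn f (Ioi 0)) {c : ℂ} (hc : Tendsto f (𝓝[>] 0) (𝓝 c)) :
    MemLp (fun x => w x * f x) r unitMeasure := by
  obtain ⟨C, -, hC⟩ := exists_bound_of_tendsto hf hc 1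
  refine MemLp.of_le_mul (c := C) hw (hw.1.mul hf.aestronglyMeasurable_unit) ?_
  filter_upwards [ae_unitMeasure] with x hx
  rw [norm_mul, mul_comm]
  exact mul_le_mul_of_nonneg_right (hC x ⟨hx.1, hx.2.le⟩) (norm_nonneg _)

/-- `x^s f(x)` -/
def scale (s : ℝ) (f : ℝ → ℂ) : ℝ → ℂ := fun x => ((x ^ s : ℝ) : ℂ) * f x

theorem continuousOn_scale {f : ℝ → ℂ} (s : ℝ) (hf : ContinuousOn f (Ioi 0)) :
    ContinuousOn (scale s f) (Ioi 0) := (continuousOn_rpow_ofReal s).mul hf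

theorem norm_scale (s : ℝ) (f : ℝ → ℂ) {x : ℝ} (hx : 0 < x) : ‖scale s f x‖ = x ^ s * ‖f x‖ := by
  rw [scale, norm_mul, norm_rpow_ofReal hx]

theorem scale_scale (s t : ℝ) (f : ℝ → ℂ) {x : ℝ} (hx : 0 < x) :
    scale s (scale t f) x = scale (s + t) f x := by
  rw [scale, scale, scale, ← mul_assoc, rpow_ofReal_mul hx]

/-- The component of `f` along `x^(l+1)`, at scale `x^m`. -/
def upper (l m : ℝ) (f f' : ℝ → ℂ) : ℝ → ℂ := fun x => scale (1 - m) f' x + l * scale (-m) f x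

/-- The component of `f` along `x^(-l)`, at scale `x^m`. -/
def lower (l m : ℝ) (f f' : ℝ → ℂ) : ℝ → ℂ := fun x => (l + 1) * scale (-m) f x - scale (1 - m) f' x

theorem upper_add_lower (l m : ℝ) (f f' : ℝ → ℂ) (x : ℝ) :
    upper l m f f' x + lower l m f f' x = (2 * l + 1) * scale (-m) f x := by
  simp only [upper, lower]; ring

theorem scale_deriv_eq (l m : ℝ) (f f' : ℝ → ℂ) (x : ℝ) :
    (2 * l + 1) * scale (1 - m) f' x = (l + 1) * upper l m f f' x - l * lower l m f f' x := by
  simp only [upper, lower]; ring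

theorem rpow_scale_identities {x : ℝ} (hx : 0 < x) (m : ℝ) :
    x ^ (-m - 1) = x ^ (-m) / x ∧ x ^ (1 - m) = x ^ (-m) * x ∧ x ^ (1 - m - 1) = x ^ (-m) ∧
      x ^ (2 - m) = x ^ (-m) * x ^ 2 := by
  refine ⟨Real.rpow_sub_one hx.ne' _, ?_, by congr 1; ring, ?_⟩
  · rw [sub_eq_neg_add, Real.rpow_add hx, Real.rpow_one]
  · rw [sub_eq_neg_add, Real.rpow_add hx, Real.rpow_two]

namespace IsSol

variable {l : ℝ} {Q g f f' : ℝ → ℂ}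

/-- This component annihilates x^(-l), so the singular part of the equation decouples into a scalar
Euler equation with exponent l+1-m. The potential enters only through the product of x Q with the
rescaled solution, where the L^p hypothesis can be used. The lower component is symmetric, with
exponent -l-m. -/
theorem isPrim_upper (h : IsSol l Q g f f') (m : ℝ) : IsPrim (upper l m f f')
    (fun x => (((l + 1 - m : ℝ) : ℂ) * upper l m f f' x + -scale (2 - m) g x) / x
      + (x * Q x) * scale (-m) f x) := by
  refine ((((IsPrim.cpow_ofReal (1 - m)).mul h.prim_deriv)).add
    (((IsPrim.cpow_ofReal (-m)).mul h.prim).const_mul l)).congr (fun _ _ => rfl) fun x hx => ?_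
  have hxc : (x : ℂ) ≠ 0 := by exact_mod_cast hx.ne'
  obtain ⟨e1, e2, e3, e4⟩ := rpow_scale_identities hx m
  simp only [upper, scale, e1, e2, e3, e4]
  push_cast
  field_simp
  ring

theorem isPrim_lower (h : IsSol l Q g f f') (m : ℝ) : IsPrim (lower l m f f')
    (fun x => (((-l - m : ℝ) : ℂ) * lower l m f f' x + scale (2 - m) g x) / x
      + -((x * Q x) * scale (-m) f x)) := by
  refine ((((IsPrim.cpow_ofReal (-m)).mul h.prim).const_mul (l + 1)).sub
    ((IsPrim.cpow_ofReal (1 - m)).mul h.prim_deriv)).congr (fun _ _ => rfl) fun x hx => ?_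
  have hxc : (x : ℂ) ≠ 0 := by exact_mod_cast hx.ne'
  obtain ⟨e1, e2, e3, e4⟩ := rpow_scale_identities hx m
  simp only [lower, scale, e1, e2, e3, e4]
  push_cast
  field_simp
  ring

end IsSol

/-- The alternatives under which `euler_regularity` applies to `x y' = σ y + S + x f`. -/
def EulerCase (σ : ℝ) (r : ℝ≥0∞) (y S : ℝ → ℂ) : Prop :=
  (σ < 0 ∧ Tendsto (fun x : ℝ => ((x ^ (-σ) : ℝ) : ℂ) * (σ * y x + S x)) (𝓝[>] 0) (𝓝 0)) ∨
    1 - r.toReal⁻¹ < σ ∨ (σ = 0 ∧ ∀ x, 0 < x → S x = 0)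

theorem IsReg.of_const_mul {r : ℝ≥0∞} {f : ℝ → ℂ} {c : ℂ} (hc : c ≠ 0)
    (h : IsReg r fun x => c * f x) : IsReg r f :=
  (h.const_mul c⁻¹).congr fun x _ => by rw [inv_mul_cancel_left₀ hc]

/-- Regularity of a solution at scale `x^m`, from that of its two components. -/
theorem IsSol.isReg {l : ℝ} (hl : -(1 / 2) < l) {Q g f f' : ℝ → ℂ} (h : IsSol l Q g f f') (m : ℝ)
    {r : ℝ≥0∞} (hr : 1 ≤ r) (hg : IsReg r (scale (2 - m) g))
    (hf : MemLp (fun x => (x * Q x) * scale (-m) f x) r unitMeasure)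
    (hu : EulerCase (l + 1 - m) r (upper l m f f') (fun x => -scale (2 - m) g x))
    (hl' : EulerCase (-l - m) r (lower l m f f') (scale (2 - m) g)) :
    IsReg r (scale (-m) f) ∧ IsReg r (scale (1 - m) f') ∧
      Tendsto (fun x => scale (1 - m) f' x - m * scale (-m) f x) (𝓝[>] 0) (𝓝 0) ∧
      Tendsto (fun x => ((l + 1 - m : ℝ) : ℂ) * upper l m f f' x - scale (2 - m) g x) (𝓝[>] 0) (𝓝 0) ∧
      Tendsto (fun x => ((-l - m : ℝ) : ℂ) * lower l m f f' x + scale (2 - m) g x) (𝓝[>] 0) (𝓝 0) := by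
  have hl0 : (2 * l + 1 : ℂ) ≠ 0 := by
    have : (2 * l + 1 : ℝ) ≠ 0 := by linarith
    exact_mod_cast this
  have hg' : IsReg r (fun x => -scale (2 - m) g x) :=
    (hg.const_mul (-1)).congr fun _ _ => by ring
  obtain ⟨u1, u2⟩ := euler_regularity hr (h.isPrim_upper m) hg' hf hu
  obtain ⟨l1, l2⟩ := euler_regularity hr (h.isPrim_lower m) hg hf.neg hl'
  refine ⟨?_, ?_, ?_, by simpa only [sub_eq_add_neg] using u2, l2⟩
  · exact IsReg.of_const_mul hl0 ((u1.add l1).congr fun x _ => (upper_add_lower l m f f' x).symm)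
  · exact IsReg.of_const_mul hl0 (((u1.const_mul (l + 1)).sub (l1.const_mul l)).congr
      fun x _ => scale_deriv_eq l m f f' x)
  -- The sources have opposite signs and cancel; what is left is 2l+1 times the required
  -- combination.
  · have := (u2.add l2).const_mul ((2 * l + 1 : ℂ)⁻¹)
    rw [add_zero, mul_zero] at this
    refine this.congr fun x => ?_
    rw [inv_mul_eq_iff_eq_mul₀ hl0]
    simp only [upper, lower]
    push_cast
    ring

theorem isReg_zero {r : ℝ≥0∞} (s : ℝ) : IsReg r (scale s fun _ => 0) :=
  (IsReg.const 0).congr fun _ _ => by simp [scale]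

/-- The solution asymptotic to `x^(l+1)`: its regularity at `0`. -/
theorem IsSol.isReg_first {l : ℝ} (hl : -(1 / 2) < l) {Q u u' : ℝ → ℂ}
    (h : IsSol l Q (fun _ => 0) u u') {p : ℝ≥0∞} (hp : 1 ≤ p)
    (hQ : MemLp (fun x => x * Q x) p unitMeasure) {c : ℂ}
    (hu : Tendsto (scale (-(l + 1)) u) (𝓝[>] 0) (𝓝 c)) :
    IsReg p (scale (-(l + 1)) u) ∧ IsReg p (scale (1 - (l + 1)) u') ∧
      Tendsto (fun x => scale (1 - (l + 1)) u' x - ((l + 1 : ℝ) : ℂ) * scale (-(l + 1)) u x)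
        (𝓝[>] 0) (𝓝 0) := by
  have hf := memLp_mul_of_tendsto hQ (continuousOn_scale _ h.continuousOn) hu
  -- At m = l+1 the upper exponent is 0 and there is no source. This gives the upper component a
  -- limit before anything is known about the lower one.
  have hup : EulerCase (l + 1 - (l + 1)) p (upper l (l + 1) u u')
      (fun x => -scale (2 - (l + 1)) (fun _ => 0) x) :=
    Or.inr (Or.inr ⟨by ring, fun x _ => by simp [scale]⟩)
  have hα := (euler_regularity hp (h.isPrim_upper (l + 1))
    ((isReg_zero (2 - (l + 1))).const_mul (-1) |>.congr fun _ _ => by ring) hf hup).1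
  obtain ⟨α₀, hα₀⟩ := hα.exists_tendsto hp
  -- The lower exponent is -(2l+1) < 0. The boundary condition holds because the lower component
  -- converges, being a combination of the rescaled solution and the upper component.
  have hlow : EulerCase (-l - (l + 1)) p (lower l (l + 1) u u') (scale (2 - (l + 1)) fun _ => 0) := by
    refine Or.inl ⟨by linarith, ?_⟩
    have hβ : Tendsto (lower l (l + 1) u u') (𝓝[>] 0) (𝓝 ((2 * l + 1) * c - α₀)) := by
      refine ((hu.const_mul (2 * l + 1 : ℂ)).sub hα₀).congr fun x => ?_
      rw [← upper_add_lower]; ring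
    have := (tendsto_rpow_zero (s := -(-l - (l + 1))) (by linarith)).mul
      ((hβ.const_mul ((-l - (l + 1) : ℝ) : ℂ)).add_const 0)
    rw [zero_mul] at this
    refine this.congr fun x => ?_
    simp [scale]
  obtain ⟨h1, h2, h3, -⟩ := h.isReg hl (l + 1) hp (isReg_zero _) hf hup hlow
  exact ⟨h1, h2, h3⟩

theorem zero_le_inv_toReal (r : ℝ≥0∞) : 0 ≤ r.toReal⁻¹ := inv_nonneg.2 ENNReal.toReal_nonneg

/-- The exponent condition `r < 1/s` in real terms. -/
theorem lt_inv_toReal_of_lt {r : ℝ≥0∞} (hr : 1 ≤ r) {s : ℝ} (hs : 0 ≤ s)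
    (h : r < (ENNReal.ofReal s)⁻¹) : s < r.toReal⁻¹ := by
  have hrt : r ≠ ⊤ := ne_top_of_lt h
  have hr0 : 0 < r.toReal := ENNReal.toReal_pos (zero_lt_one.trans_le hr).ne' hrt
  rw [ENNReal.lt_inv_iff_lt_inv, ENNReal.ofReal_lt_iff_lt_toReal hs, ENNReal.toReal_inv] at h
  · exact h
  · exact ENNReal.inv_ne_top.2 (zero_lt_one.trans_le hr).ne'

/-- This is the role of I_l: at scale x^(-l) the upper component has exponent 2l+1, which must
exceed 1 - 1/r. For l > 0 that is automatic. -/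
theorem expSet_inv {l : ℝ} {r : ℝ≥0∞} (hr : r ∈ expSet l) : 1 - r.toReal⁻¹ < 2 * l + 1 := by
  rcases lt_or_ge 0 l with h | h
  · have := zero_le_inv_toReal r
    linarith
  · have := lt_inv_toReal_of_lt hr.1 (s := -(2 * l)) (by linarith) (hr.2 h)
    linarith

/-- Solutions asymptotic to multiples of `x^(-l)`: their regularity at `0`. -/
theorem IsSol.isReg_second {l : ℝ} (hl : -(1 / 2) < l) {Q v v' : ℝ → ℂ}
    (h : IsSol l Q (fun _ => 0) v v') {p : ℝ≥0∞} (hp : p ∈ expSet l)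
    (hQ : MemLp (fun x => x * Q x) p unitMeasure) {c : ℂ}
    (hv : Tendsto (scale l v) (𝓝[>] 0) (𝓝 c)) :
    IsReg p (scale l v) ∧ IsReg p (scale (1 + l) v') ∧
      Tendsto (fun x => scale (1 + l) v' x + l * scale l v x) (𝓝[>] 0) (𝓝 0) := by
  have e1 : - -l = l := neg_neg l
  have e2 : 1 - -l = 1 + l := by ring
  have hf := memLp_mul_of_tendsto hQ (continuousOn_scale _ h.continuousOn) hv
  -- At m = -l the upper exponent is 2l+1, handled by integration from 1, and the lower exponent is
  -- 0 with no source.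
  obtain ⟨h1, h2, h3, -⟩ := h.isReg hl (-l) hp.1 (isReg_zero _) (by rwa [e1])
    (Or.inr (Or.inl (by have := expSet_inv hp; linarith)))
    (Or.inr (Or.inr ⟨by ring, fun x _ => by simp [scale]⟩))
  rw [e1, e2] at *
  refine ⟨h1, h2, h3.congr fun x => ?_⟩
  push_cast; ring

/-! ### Fundamental systems, variation of parameters and a priori bounds -/

/-- A fundamental system of solutions with the behaviour of `x^(l+1)` and `x^(-l)` at `0`. -/
structure IsFund (l : ℝ) (Q u u' v v' : ℝ → ℂ) : Prop where
  first : IsSol l Q (fun _ => 0) u u'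
  second : IsSol l Q (fun _ => 0) v v'
  bound : ∀ X : ℝ, ∃ C, 0 < C ∧ ∀ x ∈ Ioc 0 X, ‖u x‖ ≤ C * x ^ (l + 1) ∧ ‖u' x‖ ≤ C * x ^ l ∧
    ‖v x‖ ≤ C * x ^ (-l) ∧ ‖v' x‖ ≤ C * x ^ (-l - 1)
  wronskian : ∀ x, 0 < x → v x * u' x - v' x * u x = 1

theorem norm_le_of_scale_le {s t C : ℝ} (hst : s + t = 0) {f : ℝ → ℂ} {x : ℝ} (hx : 0 < x)
    (h : ‖scale s f x‖ ≤ C) : ‖f x‖ ≤ C * x ^ t := by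
  have e : ‖f x‖ = x ^ t * ‖scale s f x‖ := by
    rw [norm_scale _ _ hx, ← mul_assoc, ← Real.rpow_add hx, add_comm t s, hst, Real.rpow_zero, one_mul]
  rw [e, mul_comm]
  have := Real.rpow_pos_of_pos hx t
  gcongr

/-- The derivatives have the expected leading terms by the regularity results, which gives the
bounds. The Wronskian is constant, and its limit at 0 is ((l+1) + l)/(2l+1) = 1; this explains the
normalisation 1/(2l+1) of the second solution. -/
theorem isFund_of_asymptotics {l : ℝ} (hl : -(1 / 2) < l) {Q u u' v v' : ℝ → ℂ} {p : ℝ≥0∞}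
    (hp : p ∈ expSet l) (hQ : MemLp (fun x => x * Q x) p unitMeasure)
    (hu : IsSol l Q (fun _ => 0) u u') (hv : IsSol l Q (fun _ => 0) v v')
    (hu0 : Tendsto (scale (-(l + 1)) u) (𝓝[>] 0) (𝓝 1))
    (hv0 : Tendsto (scale l v) (𝓝[>] 0) (𝓝 ((1 / (2 * l + 1) : ℝ) : ℂ))) :
    IsFund l Q u u' v v' := by
  obtain ⟨-, hu1, hu2⟩ := hu.isReg_first hl hp.1 hQ hu0
  obtain ⟨-, hv1, hv2⟩ := hv.isReg_second hl hp hQ hv0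
  have hu3 : Tendsto (scale (1 - (l + 1)) u') (𝓝[>] 0) (𝓝 ((l + 1 : ℝ) : ℂ)) := by
    have := hu2.add (hu0.const_mul ((l + 1 : ℝ) : ℂ))
    rw [zero_add, mul_one] at this
    exact this.congr fun x => by ring
  have hv3 : Tendsto (scale (1 + l) v') (𝓝[>] 0) (𝓝 (-(l * ((1 / (2 * l + 1) : ℝ) : ℂ)))) := by
    have := hv2.sub (hv0.const_mul (l : ℂ))
    rw [zero_sub] at this
    exact this.congr fun x => by ring
  refine ⟨hu, hv, fun X => ?_, fun x hx => ?_⟩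
  · obtain ⟨C1, hC1, h1⟩ := exists_bound_of_tendsto (continuousOn_scale _ hu.continuousOn) hu0 X
    obtain ⟨C2, hC2, h2⟩ := exists_bound_of_tendsto (continuousOn_scale _ hu.continuousOn_deriv) hu3 X
    obtain ⟨C3, hC3, h3⟩ := exists_bound_of_tendsto (continuousOn_scale _ hv.continuousOn) hv0 X
    obtain ⟨C4, hC4, h4⟩ := exists_bound_of_tendsto (continuousOn_scale _ hv.continuousOn_deriv) hv3 X
    refine ⟨C1 + C2 + C3 + C4, by positivity, fun x hx => ⟨?_, ?_, ?_, ?_⟩⟩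
    · exact norm_le_of_scale_le (by ring) hx.1 ((h1 x hx).trans (by linarith))
    · exact norm_le_of_scale_le (by ring) hx.1 ((h2 x hx).trans (by linarith))
    · exact norm_le_of_scale_le (by ring) hx.1 ((h3 x hx).trans (by linarith))
    · exact norm_le_of_scale_le (by ring) hx.1 ((h4 x hx).trans (by linarith))
  · have hlim := (hv0.mul hu3).sub (hv3.mul hu0)
    have hconst : Tendsto (fun y => scale l v y * scale (1 - (l + 1)) u' y -
        scale (1 + l) v' y * scale (-(l + 1)) u y) (𝓝[>] 0) (𝓝 (v x * u' x - v' x * u x)) := by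
      refine tendsto_const_nhds.congr' ?_
      filter_upwards [self_mem_nhdsWithin] with y hy
      have hy' : (0 : ℝ) < y := hy
      rw [hv.wronskian hu hx hy']
      have e1 : ((y ^ l : ℝ) : ℂ) * ((y ^ (1 - (l + 1)) : ℝ) : ℂ) = 1 := by
        rw [rpow_ofReal_mul hy']; simp
      have e2 : ((y ^ (1 + l) : ℝ) : ℂ) * ((y ^ (-(l + 1)) : ℝ) : ℂ) = 1 := by
        rw [rpow_ofReal_mul hy']; ring_nf; simp
      simp only [scale]
      linear_combination (-(v y * u' y)) * e1 + (v' y * u y) * e2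
    rw [tendsto_nhds_unique hconst hlim]
    have : (2 * l + 1 : ℂ) ≠ 0 := by
      have : (2 * l + 1 : ℝ) ≠ 0 := by linarith
      exact_mod_cast this
    push_cast
    field_simp
    ring

/-- The solution operator `g ↦ v ∫₀ˣ u g - u ∫_cˣ v g`, with outer factors `a`, `b` in place
of `u`, `v`. -/
def greenOp (u v a b : ℝ → ℂ) (c : ℝ) (g : ℝ → ℂ) : ℝ → ℂ := fun x =>
  b x * (∫ t in (0 : ℝ)..x, u t * g t) - a x * ∫ t in c..x, v t * g t

theorem intervalIntegrable_zero_of_continuousOn {f : ℝ → ℂ} (hf : ContinuousOn f (Ioi 0))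
    {y : ℝ} (hy : 0 < y) (h : IntervalIntegrable f volume 0 y) {x : ℝ} (hx : 0 < x) :
    IntervalIntegrable f volume 0 x :=
  h.trans (hf.intervalIntegrable_of_pos hy hx)

/-- Variation of parameters: in the first derivative the boundary terms cancel, and in the second
they combine to -g because the Wronskian is 1. The lower limit c = 0 needs v g to be integrable at
0, while c = 1 does not. -/
theorem IsFund.greenOp_isSol {l : ℝ} {Q u u' v v' : ℝ → ℂ} (F : IsFund l Q u u' v v') {g : ℝ → ℂ}
    (hg : ContinuousOn g (Ioi 0)) {c : ℝ}
    (hu : IntervalIntegrable (fun t => u t * g t) volume 0 1)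
    (hv : c = 1 ∨ c = 0 ∧ IntervalIntegrable (fun t => v t * g t) volume 0 1) :
    IsSol l Q g (greenOp u v u v c g) (greenOp u v u' v' c g) := by
  have cu := F.first.continuousOn.mul hg
  have cv := F.second.continuousOn.mul hg
  have hU : IsPrim (fun x => ∫ t in (0 : ℝ)..x, u t * g t) fun t => u t * g t :=
    IsPrim.integral_zero cu fun x hx => intervalIntegrable_zero_of_continuousOn cu one_pos hu hx
  have hV : IsPrim (fun x => ∫ t in c..x, v t * g t) fun t => v t * g t := by
    rcases hv with rfl | ⟨rfl, hv⟩
    · exact IsPrim.integral_one cv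
    · exact IsPrim.integral_zero cv
        fun x hx => intervalIntegrable_zero_of_continuousOn cv one_pos hv hx
  refine ⟨?_, ?_⟩
  · refine ((F.second.prim.mul hU).sub (F.first.prim.mul hV)).congr (fun _ _ => rfl) fun x hx => ?_
    simp only [greenOp]; ring
  · refine ((F.second.prim_deriv.mul hU).sub (F.first.prim_deriv.mul hV)).congr (fun _ _ => rfl)
      fun x hx => ?_
    have := F.wronskian x hx
    simp only [greenOp]
    linear_combination (g x) * this

theorem integral_rpow_zero {e x : ℝ} (he : -1 < e) :
    ∫ t in (0 : ℝ)..x, t ^ e = x ^ (e + 1) / (e + 1) := by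
  rw [integral_rpow (Or.inl he), Real.zero_rpow (by linarith), sub_zero]

theorem integral_bound_of_rpow {f : ℝ → ℂ} (hf : ContinuousOn f (Ioi 0)) {X M e : ℝ} (he : -1 < e)
    (h : ∀ t ∈ Ioc 0 X, ‖f t‖ ≤ M * t ^ e) {x : ℝ} (hx : x ∈ Ioc 0 X) :
    IntervalIntegrable f volume 0 x ∧ ‖∫ t in (0 : ℝ)..x, f t‖ ≤ M * (x ^ (e + 1) / (e + 1)) := by
  have hi : IntervalIntegrable (fun t : ℝ => M * t ^ e) volume 0 x :=
    (intervalIntegral.intervalIntegrable_rpow' he).const_mul M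
  have hb : ∀ t ∈ Ioc 0 x, ‖f t‖ ≤ M * t ^ e := fun t ht => h t ⟨ht.1, ht.2.trans hx.2⟩
  constructor
  · refine hi.mono_fun ?_ ?_
    · rw [uIoc_of_le hx.1.le]
      exact (hf.mono fun t ht => ht.1).aestronglyMeasurable measurableSet_Ioc
    · rw [uIoc_of_le hx.1.le]
      filter_upwards [ae_restrict_mem measurableSet_Ioc] with t ht
      exact (hb t ht).trans (le_abs_self _)
  · rw [← integral_rpow_zero he, ← intervalIntegral.integral_const_mul]
    exact intervalIntegral.norm_integral_le_of_norm_le hx.1.le (Eventually.of_forall hb) hi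

/-- A weight on `(0, 1]` that grows more slowly than every negative power. -/
structure IsWeight (w : ℝ → ℝ) : Prop where
  one_le : ∀ x ∈ Ioc (0 : ℝ) 1, 1 ≤ w x
  slow : ∀ δ : ℝ, 0 < δ → ∃ C, 0 < C ∧ ∀ x ∈ Ioc (0 : ℝ) 1, ∀ y ∈ Ioc 0 x, w y ≤ C * (x / y) ^ δ * w x

theorem isWeight_one : IsWeight fun _ => 1 := by
  refine ⟨fun _ _ => le_rfl, fun δ hδ => ⟨1, one_pos, fun x hx y hy => ?_⟩⟩
  rw [one_mul, mul_one]
  exact Real.one_le_rpow ((one_le_div hy.1).2 hy.2) hδ.le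

theorem isWeight_log : IsWeight fun x => 1 - Real.log x := by
  have h1 : ∀ x ∈ Ioc (0 : ℝ) 1, 1 ≤ 1 - Real.log x := fun x hx => by
    have := Real.log_nonpos hx.1.le hx.2
    linarith
  refine ⟨h1, fun δ hδ => ⟨1 + 1 / δ, by positivity, fun x hx y hy => ?_⟩⟩
  have hxy : 1 ≤ x / y := (one_le_div hy.1).2 hy.2
  have e : 1 - Real.log y = 1 - Real.log x + Real.log (x / y) := by
    rw [Real.log_div hx.1.ne' hy.1.ne']; ring
  have h2 := Real.log_le_rpow_div (by linarith : 0 ≤ x / y) hδ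
  have h3 : 1 ≤ (x / y) ^ δ := Real.one_le_rpow hxy hδ.le
  have h4 := Real.log_nonneg hxy
  have h5 := h1 x hx
  calc 1 - Real.log y ≤ (1 + Real.log (x / y)) * (1 - Real.log x) := by
        rw [e]; nlinarith
    _ ≤ ((x / y) ^ δ + (x / y) ^ δ / δ) * (1 - Real.log x) := by gcongr
    _ = _ := by ring

theorem IsWeight.le_rpow {w : ℝ → ℝ} (hw : IsWeight w) {δ : ℝ} (hδ : 0 < δ) :
    ∃ C, 0 < C ∧ ∀ x ∈ Ioc (0 : ℝ) 1, w x ≤ C * x ^ (-δ) := by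
  obtain ⟨C, hC, h⟩ := hw.slow δ hδ
  have h1 : 0 < w 1 := one_pos.trans_le (hw.one_le 1 ⟨one_pos, le_rfl⟩)
  refine ⟨C * w 1, by positivity, fun x hx => ?_⟩
  have := h 1 ⟨one_pos, le_rfl⟩ x hx
  rw [one_div, Real.inv_rpow hx.1.le, ← Real.rpow_neg hx.1.le] at this
  linarith

/-- A slowly growing weight passes through the integral of t^e like a constant: w(t) is compared
with w(x) at the cost of (x/t)^δ, with δ half of the available slack e+1. The constant depends only
on e and w. -/
theorem IsWeight.integral_bound {w : ℝ → ℝ} (hw : IsWeight w) {e : ℝ} (he : -1 < e) :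
    ∃ C, 0 < C ∧ ∀ (f : ℝ → ℂ) (M : ℝ), 0 ≤ M → ContinuousOn f (Ioi 0) →
      (∀ t ∈ Ioc (0 : ℝ) 1, ‖f t‖ ≤ M * (t ^ e * w t)) →
      IntervalIntegrable f volume 0 1 ∧
        ∀ x ∈ Ioc (0 : ℝ) 1, ‖∫ t in (0 : ℝ)..x, f t‖ ≤ C * M * (x ^ (e + 1) * w x) := by
  set δ := (e + 1) / 2 with hδ
  have hδ0 : 0 < δ := by rw [hδ]; linarith
  obtain ⟨C, hC, hs⟩ := hw.slow δ hδ0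
  have he' : -1 < e - δ := by rw [hδ]; linarith
  refine ⟨C / (e - δ + 1), div_pos hC (by linarith), fun f M hM hf hb => ?_⟩
  have key : ∀ x ∈ Ioc (0 : ℝ) 1, ∀ t ∈ Ioc 0 x, ‖f t‖ ≤ (M * C * x ^ δ * w x) * t ^ (e - δ) := by
    intro x hx t ht
    have h1 := hs x hx t ht
    refine (hb t ⟨ht.1, ht.2.trans hx.2⟩).trans ?_
    have htp := Real.rpow_pos_of_pos ht.1 e
    calc M * (t ^ e * w t) ≤ M * (t ^ e * (C * (x / t) ^ δ * w x)) := by gcongr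
      _ = _ := by
        rw [Real.div_rpow hx.1.le ht.1.le, Real.rpow_sub ht.1]
        have := Real.rpow_pos_of_pos ht.1 δ
        field_simp
  refine ⟨(integral_bound_of_rpow hf he' (key 1 ⟨one_pos, le_rfl⟩) ⟨one_pos, le_rfl⟩).1,
    fun x hx => ?_⟩
  refine (integral_bound_of_rpow hf he' (key x hx) ⟨hx.1, le_rfl⟩).2.trans (le_of_eq ?_)
  have e1 : x ^ (e + 1) = x ^ δ * x ^ (e - δ + 1) := by
    rw [← Real.rpow_add hx.1]; congr 1; ring
  rw [e1]
  have : e - δ + 1 ≠ 0 := by linarith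
  field_simp

theorem norm_mul_le_rpow {C M s t r ω : ℝ} {x : ℝ} (hx : 0 < x) {u g : ℂ} (hu : ‖u‖ ≤ C * x ^ s)
    (hg : ‖g‖ ≤ M * (x ^ t * ω)) (hr : s + t = r) (hC : 0 ≤ C) :
    ‖u * g‖ ≤ C * M * (x ^ r * ω) := by
  rw [norm_mul, ← hr, Real.rpow_add hx]
  have := Real.rpow_pos_of_pos hx s
  calc ‖u‖ * ‖g‖ ≤ (C * x ^ s) * (M * (x ^ t * ω)) := by gcongr
    _ = _ := by ring

/-- A priori bounds for the Volterra operator. -/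
theorem IsFund.volterra_bound {l : ℝ} (hl : -(1 / 2) < l) {Q u u' v v' : ℝ → ℂ}
    (F : IsFund l Q u u' v v') {w : ℝ → ℝ} (hw : IsWeight w) {g : ℝ → ℂ}
    (hg : ContinuousOn g (Ioi 0)) {M s : ℝ} (hM : 0 ≤ M) (hs : -2 < s)
    (hb : ∀ x ∈ Ioc (0 : ℝ) 1, ‖g x‖ ≤ M * (x ^ (l + 1 + s) * w x)) :
    IsSol l Q g (greenOp u v u v 0 g) (greenOp u v u' v' 0 g) ∧
    ∃ M', 0 ≤ M' ∧ ∀ x ∈ Ioc (0 : ℝ) 1,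
      ‖greenOp u v u v 0 g x‖ ≤ M' * (x ^ (l + 3 + s) * w x) ∧
      ‖greenOp u v u' v' 0 g x‖ ≤ M' * (x ^ (l + 2 + s) * w x) := by
  obtain ⟨C, hC, hF⟩ := F.bound 1
  obtain ⟨A, hA, h1⟩ := hw.integral_bound (e := 2 * l + 2 + s) (by linarith)
  obtain ⟨B, hB, h2⟩ := hw.integral_bound (e := 1 + s) (by linarith)
  obtain ⟨i1, b1⟩ := h1 _ (C * M) (by positivity) (F.first.continuousOn.mul hg)
    fun t ht => norm_mul_le_rpow ht.1 (hF t ht).1 (hb t ht) (by ring) hC.le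
  obtain ⟨i2, b2⟩ := h2 _ (C * M) (by positivity) (F.second.continuousOn.mul hg)
    fun t ht => norm_mul_le_rpow ht.1 (hF t ht).2.2.1 (hb t ht) (by ring) hC.le
  refine ⟨F.greenOp_isSol hg i1 (Or.inr ⟨rfl, i2⟩), C * (A * (C * M)) + C * (B * (C * M)),
    by positivity, fun x hx => ⟨?_, ?_⟩⟩
  · rw [add_mul]
    refine (norm_sub_le _ _).trans (add_le_add ?_ ?_)
    · exact norm_mul_le_rpow hx.1 (hF x hx).2.2.1 (b1 x hx) (by ring) hC.le
    · exact norm_mul_le_rpow hx.1 (hF x hx).1 (b2 x hx) (by ring) hC.le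
  · rw [add_mul]
    refine (norm_sub_le _ _).trans (add_le_add ?_ ?_)
    · exact norm_mul_le_rpow hx.1 (hF x hx).2.2.2 (b1 x hx) (by ring) hC.le
    · exact norm_mul_le_rpow hx.1 (hF x hx).2.1 (b2 x hx) (by ring) hC.le

theorem integral_bound_upper {f : ℝ → ℂ} {M e : ℝ} (hM : 0 ≤ M) (he : e ≤ -1)
    (h : ∀ t ∈ Ioc (0 : ℝ) 1, ‖f t‖ ≤ M * t ^ e) {x : ℝ} (hx : x ∈ Ioc (0 : ℝ) 1) :
    ‖∫ t in (1 : ℝ)..x, f t‖ ≤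
      M * (if e = -1 then -Real.log x else x ^ (e + 1) / (-(e + 1))) := by
  have h0 : (0 : ℝ) ∉ uIcc x 1 := by
    rw [uIcc_of_le hx.2]; exact fun h => absurd h.1 (not_le.2 hx.1)
  have hi : IntervalIntegrable (fun t : ℝ => M * t ^ e) volume x 1 :=
    (intervalIntegral.intervalIntegrable_rpow (Or.inr h0)).const_mul M
  rw [intervalIntegral.integral_symm, norm_neg]
  have h1 : ‖∫ t in x..(1 : ℝ), f t‖ ≤ ∫ t in x..(1 : ℝ), M * t ^ e :=
    intervalIntegral.norm_integral_le_of_norm_le hx.2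
      (Eventually.of_forall fun t ht => h t ⟨hx.1.trans ht.1, ht.2⟩) hi
  rw [intervalIntegral.integral_const_mul] at h1
  refine h1.trans (mul_le_mul_of_nonneg_left ?_ hM)
  split_ifs with hc
  · subst hc
    simp_rw [Real.rpow_neg_one]
    rw [integral_inv h0, one_div, Real.log_inv]
  · rw [integral_rpow (Or.inr ⟨hc, h0⟩), Real.one_rpow, div_neg, ← neg_div]
    have he1 : e + 1 < 0 := by
      rcases he.lt_or_eq with h | h
      · linarith
      · exact absurd h hc
    rw [div_le_div_right_of_neg he1]
    linarith

/-- A priori bounds for the Green operator. -/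
theorem IsFund.green_bound {l : ℝ} {Q u u' v v' : ℝ → ℂ}
    (F : IsFund l Q u u' v v') {w : ℝ → ℝ} (hw : IsWeight w) {g : ℝ → ℂ}
    (hg : ContinuousOn g (Ioi 0)) {M t : ℝ} (hM : 0 ≤ M) (ht : -2 < t)
    (hcase : t - 2 * l < -1 ∨ t - 2 * l = -1 ∧ ∀ x ∈ Ioc (0 : ℝ) 1, -Real.log x ≤ w x)
    (hb : ∀ x ∈ Ioc (0 : ℝ) 1, ‖g x‖ ≤ M * x ^ (-l + t)) :
    IsSol l Q g (greenOp u v u v 1 g) (greenOp u v u' v' 1 g) ∧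
    ∃ M', 0 ≤ M' ∧ ∀ x ∈ Ioc (0 : ℝ) 1,
      ‖greenOp u v u v 1 g x‖ ≤ M' * (x ^ (-l + t + 2) * w x) ∧
      ‖greenOp u v u' v' 1 g x‖ ≤ M' * (x ^ (-l - 1 + t + 2) * w x) := by
  obtain ⟨C, hC, hF⟩ := F.bound 1
  have hb' : ∀ x ∈ Ioc (0 : ℝ) 1, ‖g x‖ ≤ M * (x ^ (-l + t) * 1) := by simpa using hb
  have b1 : ∀ x ∈ Ioc (0 : ℝ) 1, IntervalIntegrable (fun t => u t * g t) volume 0 x ∧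
      ‖∫ t in (0 : ℝ)..x, u t * g t‖ ≤ C * M * (x ^ (1 + t + 1) / (1 + t + 1)) := fun x hx =>
    integral_bound_of_rpow (F.first.continuousOn.mul hg) (by linarith)
      (fun y hy => by
        have := norm_mul_le_rpow hy.1 (hF y hy).1 (hb' y hy) (r := 1 + t) (by ring) hC.le
        rwa [mul_one] at this) hx
  have b2 : ∀ x ∈ Ioc (0 : ℝ) 1, ‖∫ t in (1 : ℝ)..x, v t * g t‖ ≤
      C * M * (if t - 2 * l = -1 then -Real.log x
        else x ^ (t - 2 * l + 1) / (-(t - 2 * l + 1))) := fun x hx =>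
    integral_bound_upper (by positivity) (by rcases hcase with h | h <;> linarith [h])
      (fun y hy => by
        have := norm_mul_le_rpow hy.1 (hF y hy).2.2.1 (hb' y hy) (r := t - 2 * l) (by ring) hC.le
        rwa [mul_one] at this) hx
  -- Below the critical exponent -1 the integral is a pure power and the weight is dispensable; at
  -- -1 it is a logarithm, which the weight must dominate.
  obtain ⟨A, hA, b3⟩ : ∃ A, 0 ≤ A ∧ ∀ x ∈ Ioc (0 : ℝ) 1, ‖∫ t in (1 : ℝ)..x, v t * g t‖ ≤
      A * (x ^ (t - 2 * l + 1) * w x) := by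
    rcases hcase with h | ⟨h, hlog⟩
    · have hneg : 0 < -(t - 2 * l + 1) := by linarith
      refine ⟨C * M / (-(t - 2 * l + 1)), by positivity, fun x hx => (b2 x hx).trans ?_⟩
      rw [if_neg h.ne]
      have h1 := hw.one_le x hx
      have h2 := Real.rpow_pos_of_pos hx.1 (t - 2 * l + 1)
      calc _ = C * M / (-(t - 2 * l + 1)) * (x ^ (t - 2 * l + 1) * 1) := by ring
        _ ≤ _ := by gcongr
    · refine ⟨C * M, by positivity, fun x hx => (b2 x hx).trans ?_⟩
      rw [if_pos h, h, neg_add_cancel, Real.rpow_zero, one_mul]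
      have := hlog x hx
      gcongr
  have b4 : ∀ x ∈ Ioc (0 : ℝ) 1, ‖∫ t in (0 : ℝ)..x, u t * g t‖ ≤
      (C * M / (t + 2)) * (x ^ (t + 2) * w x) := fun x hx => by
    refine (b1 x hx).2.trans ?_
    have h1 := hw.one_le x hx
    have h2 := Real.rpow_pos_of_pos hx.1 (t + 2)
    have h3 : 0 < t + 2 := by linarith
    calc _ = C * M / (t + 2) * (x ^ (t + 2) * 1) := by
          rw [show 1 + t + 1 = t + 2 by ring]; ring
      _ ≤ _ := by gcongr
  have h3 : 0 < t + 2 := by linarith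
  refine ⟨F.greenOp_isSol hg (b1 1 ⟨one_pos, le_rfl⟩).1 (Or.inl rfl),
    C * (C * M / (t + 2)) + C * A, by positivity, fun x hx => ⟨?_, ?_⟩⟩
  · rw [add_mul]
    refine (norm_sub_le _ _).trans (add_le_add ?_ ?_)
    · exact norm_mul_le_rpow hx.1 (hF x hx).2.2.1 (b4 x hx) (by ring) hC.le
    · exact norm_mul_le_rpow hx.1 (hF x hx).1 (b3 x hx) (by ring) hC.le
  · rw [add_mul]
    refine (norm_sub_le _ _).trans (add_le_add ?_ ?_)
    · exact norm_mul_le_rpow hx.1 (hF x hx).2.2.2 (b4 x hx) (by ring) hC.le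
    · exact norm_mul_le_rpow hx.1 (hF x hx).2.1 (b3 x hx) (by ring) hC.le

/-- The Volterra operator on powers, with explicit constants on `(0, X]`. -/
theorem IsFund.volterra_rpow_bound {l : ℝ} (hl : -(1 / 2) < l) {Q u u' v v' : ℝ → ℂ}
    (F : IsFund l Q u u' v v') (X : ℝ) : ∃ C, 0 < C ∧ ∀ (g : ℝ → ℂ) (M s : ℝ),
      ContinuousOn g (Ioi 0) → 0 ≤ M → -2 < s →
      (∀ x ∈ Ioc 0 X, ‖g x‖ ≤ M * x ^ (l + 1 + s)) → ∀ x ∈ Ioc 0 X,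
        ‖greenOp u v u v 0 g x‖ ≤ C * M / (s + 2) * x ^ (l + 1 + (s + 2)) ∧
        ‖greenOp u v u' v' 0 g x‖ ≤ C * M / (s + 2) * x ^ (l + (s + 2)) := by
  obtain ⟨C, hC, hF⟩ := F.bound X
  refine ⟨C * C + C * C, by positivity, fun g M s hg hM hs hb x hx => ?_⟩
  have hb' : ∀ x ∈ Ioc 0 X, ‖g x‖ ≤ M * (x ^ (l + 1 + s) * 1) := by simpa using hb
  have hs2 : 0 < s + 2 := by linarith
  -- The exact denominator 2l+3+s is replaced by the smaller s+2, so that both integrals carry the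
  -- factor 1/(s+2) from which the factorials arise.
  have b1 : ‖∫ t in (0 : ℝ)..x, u t * g t‖ ≤ C * M / (s + 2) * (x ^ (2 * l + 3 + s) * 1) := by
    refine (integral_bound_of_rpow (F.first.continuousOn.mul hg) (e := 2 * l + 2 + s) (by linarith)
      (M := C * M) (fun y hy => by
        have := norm_mul_le_rpow hy.1 (hF y hy).1 (hb' y hy) (r := 2 * l + 2 + s) (by ring) hC.le
        rwa [mul_one] at this) hx).2.trans ?_
    have h1 := Real.rpow_pos_of_pos hx.1 (2 * l + 3 + s)
    rw [show 2 * l + 2 + s + 1 = 2 * l + 3 + s by ring]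
    calc _ ≤ C * M * (x ^ (2 * l + 3 + s) / (s + 2)) :=
          mul_le_mul_of_nonneg_left (div_le_div_of_nonneg_left h1.le hs2 (by linarith))
            (by positivity)
      _ = _ := by ring
  have b2 : ‖∫ t in (0 : ℝ)..x, v t * g t‖ ≤ C * M / (s + 2) * (x ^ (s + 2) * 1) := by
    refine (integral_bound_of_rpow (F.second.continuousOn.mul hg) (e := 1 + s) (by linarith)
      (M := C * M) (fun y hy => by
        have := norm_mul_le_rpow hy.1 (hF y hy).2.2.1 (hb' y hy) (r := 1 + s) (by ring) hC.le
        rwa [mul_one] at this) hx).2.trans (le_of_eq ?_)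
    rw [show 1 + s + 1 = s + 2 by ring]; ring
  have e : ∀ r : ℝ, (C * C + C * C) * M / (s + 2) * x ^ r =
      C * (C * M / (s + 2)) * (x ^ r * 1) + C * (C * M / (s + 2)) * (x ^ r * 1) := fun r => by ring
  constructor
  · rw [e]
    refine (norm_sub_le _ _).trans (add_le_add ?_ ?_)
    · exact norm_mul_le_rpow hx.1 (hF x hx).2.2.1 b1 (by ring) hC.le
    · exact norm_mul_le_rpow hx.1 (hF x hx).1 b2 (by ring) hC.le
  · rw [e]
    refine (norm_sub_le _ _).trans (add_le_add ?_ ?_)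
    · exact norm_mul_le_rpow hx.1 (hF x hx).2.2.2 b1 (by ring) hC.le
    · exact norm_mul_le_rpow hx.1 (hF x hx).2.1 b2 (by ring) hC.le

/-! ### Power series in the spectral parameter -/

/-- Each `f k` is locally bounded on `(0, ∞)`, with bounds that are the coefficients of an entire
function. -/
def LocEntire (f : ℕ → ℝ → ℂ) : Prop :=
  ∀ a b : ℝ, 0 < a → ∃ c : ℕ → ℝ, (∀ k, 0 ≤ c k) ∧ (∀ k, ∀ x ∈ Icc a b, ‖f k x‖ ≤ c k) ∧
    ∀ ρ : ℝ, Summable fun k => c k * ρ ^ k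

theorem LocEntire.of_tail {f : ℕ → ℝ → ℂ} (hf : ∀ k, ContinuousOn (f k) (Ioi 0)) (n : ℕ)
    (h : LocEntire fun j => f (j + n)) : LocEntire f := by
  intro a b ha
  obtain ⟨c, hc0, hc, hs⟩ := h a b ha
  choose d hd using fun k => (isCompact_Icc (a := a) (b := b)).exists_bound_of_continuousOn
    ((hf k).mono fun x hx => lt_of_lt_of_le ha hx.1)
  refine ⟨fun k => if k < n then |d k| else c (k - n), fun k => ?_, fun k x hx => ?_, fun ρ => ?_⟩
  · dsimp only
    split_ifs
    · exact abs_nonneg _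
    · exact hc0 _
  · dsimp only
    split_ifs with hk
    · exact (hd k x hx).trans (le_abs_self _)
    · have := hc (k - n) x hx
      simp only [Nat.sub_add_cancel (not_lt.1 hk)] at this
      exact this
  · rw [← summable_nat_add_iff n]
    refine ((hs ρ).mul_right (ρ ^ n)).congr fun k => ?_
    simp only [not_lt.2 (Nat.le_add_left n k), if_false, Nat.add_sub_cancel, pow_add]
    ring

theorem LocEntire.summable {f : ℕ → ℝ → ℂ} (h : LocEntire f) {x : ℝ} (hx : 0 < x) (ζ : ℂ) :
    Summable fun k => f k x * ζ ^ k := by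
  obtain ⟨c, hc0, hc, hs⟩ := h x x hx
  refine Summable.of_norm_bounded (hs ‖ζ‖) fun k => ?_
  rw [norm_mul, norm_pow]
  exact mul_le_mul_of_nonneg_right (hc k x ⟨le_rfl, le_rfl⟩) (by positivity)

theorem LocEntire.differentiable {f : ℕ → ℝ → ℂ} (h : LocEntire f) {x : ℝ} (hx : 0 < x) :
    Differentiable ℂ fun ζ : ℂ => ∑' k, f k x * ζ ^ k := by
  obtain ⟨c, hc0, hc, hs⟩ := h x x hx
  intro ζ
  have hd : DifferentiableOn ℂ (fun ζ : ℂ => ∑' k, f k x * ζ ^ k) (Metric.ball 0 (‖ζ‖ + 1)) := by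
    refine Complex.differentiableOn_tsum_of_summable_norm (hs (‖ζ‖ + 1)) (fun k => ?_)
      Metric.isOpen_ball fun k w hw => ?_
    · exact ((differentiable_id.pow k).const_mul _).differentiableOn
    · rw [norm_mul, norm_pow]
      have : ‖w‖ ≤ ‖ζ‖ + 1 := by simpa using (mem_ball_zero_iff.1 hw).le
      have := hc0 k
      gcongr
      exact hc k x ⟨le_rfl, le_rfl⟩
  exact hd.differentiableAt (Metric.isOpen_ball.mem_nhds (by simp))

/-- Dominated convergence allows summation under the integral. The majorant has the form c_k B(x)
because the potential, which enters the second derivatives, is only locally integrable and not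
locally bounded. -/
theorem IsPrim.tsum {F G : ℕ → ℝ → ℂ} (h : ∀ k, IsPrim (F k) (G k))
    (hF : ∀ x, 0 < x → Summable fun k => F k x)
    (hG : ∀ a b : ℝ, 0 < a → 0 < b → ∃ (c : ℕ → ℝ) (B : ℝ → ℝ), Summable c ∧
      IntervalIntegrable B volume a b ∧ ∀ k, ∀ x ∈ uIoc a b, ‖G k x‖ ≤ c k * B x) :
    IsPrim (fun x => ∑' k, F k x) (fun x => ∑' k, G k x) := by
  have key : ∀ a b : ℝ, 0 < a → 0 < b → IntervalIntegrable (fun x => ∑' k, G k x) volume a b ∧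
      HasSum (fun k => ∫ x in a..b, G k x) (∫ x in a..b, ∑' k, G k x) := by
    intro a b ha hb
    obtain ⟨c, B, hc, hB, hle⟩ := hG a b ha hb
    have hsum : ∀ x ∈ uIoc a b, Summable fun k => G k x := fun x hx =>
      Summable.of_norm_bounded (hc.mul_right (B x)) fun k => hle k x hx
    have hmeas : ∀ k, AEStronglyMeasurable (G k) (volume.restrict (uIoc a b)) := fun k =>
      (intervalIntegrable_iff.1 ((h k).integrable a b ha hb)).1
    have hbs : IntervalIntegrable (fun t => ∑' k, c k * B t) volume a b := by
      simp_rw [tsum_mul_right]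
      exact hB.const_mul _
    refine ⟨?_, intervalIntegral.hasSum_integral_of_dominated_convergence (fun k t => c k * B t)
      hmeas (fun k => Eventually.of_forall fun t ht => hle k t ht)
      (Eventually.of_forall fun t _ => hc.mul_right _) hbs
      (Eventually.of_forall fun t ht => (hsum t ht).hasSum)⟩
    refine hbs.mono_fun ?_ ?_
    · refine aestronglyMeasurable_of_tendsto_ae atTop
        (f := fun (N : ℕ) t => ∑ k ∈ Finset.range N, G k t)
        (fun N => Finset.aestronglyMeasurable_fun_sum _ fun k _ => hmeas k) ?_
      filter_upwards [ae_restrict_mem measurableSet_uIoc] with t ht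
      exact (hsum t ht).hasSum.tendsto_sum_nat
    · filter_upwards [ae_restrict_mem measurableSet_uIoc] with t ht
      refine (tsum_of_norm_bounded (hc.mul_right (B t)).hasSum fun k => hle k t ht).trans ?_
      exact le_abs_self _
  refine ⟨fun a b ha hb => (key a b ha hb).1, fun a b ha hb => ?_⟩
  have h1 := (key a b ha hb).2
  have h2 := ((hF b hb).hasSum.sub (hF a ha).hasSum)
  have h3 : (fun k => ∫ x in a..b, G k x) = fun k => F k b - F k a := by
    ext k; exact ((h k).sub_eq a b ha hb).symm
  rw [h3] at h1
  exact h2.unique h1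

/-- `f 0` solves the homogeneous equation, and `f (k + 1)` the one with source `f k`. -/
structure IsChain (l : ℝ) (Q : ℝ → ℂ) (f f' : ℕ → ℝ → ℂ) : Prop where
  zero : IsSol l Q (fun _ => 0) (f 0) (f' 0)
  succ : ∀ k, IsSol l Q (f k) (f (k + 1)) (f' (k + 1))

theorem IsChain.continuousOn {l : ℝ} {Q : ℝ → ℂ} {f f' : ℕ → ℝ → ℂ} (h : IsChain l Q f f') (k : ℕ) :
    ContinuousOn (f k) (Ioi 0) := by
  cases k with
  | zero => exact h.zero.continuousOn
  | succ k => exact (h.succ k).continuousOn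

theorem IsChain.continuousOn_deriv {l : ℝ} {Q : ℝ → ℂ} {f f' : ℕ → ℝ → ℂ} (h : IsChain l Q f f')
    (k : ℕ) : ContinuousOn (f' k) (Ioi 0) := by
  cases k with
  | zero => exact h.zero.continuousOn_deriv
  | succ k => exact (h.succ k).continuousOn_deriv

/-- The generating function of a chain solves the equation with shifted spectral parameter. -/
theorem IsChain.tsum {l : ℝ} {Q : ℝ → ℂ} {f f' : ℕ → ℝ → ℂ} (h : IsChain l Q f f')
    (hQ : ∀ a b, 0 < a → 0 < b → IntervalIntegrable Q volume a b)
    (hf : LocEntire f) (hf' : LocEntire f') (ζ : ℂ) :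
    IsSol l (fun x => Q x - ζ) (fun _ => 0) (fun x => ∑' k, f k x * ζ ^ k)
      (fun x => ∑' k, f' k x * ζ ^ k) := by
  have hp : ∀ k, IsPrim (fun x => f k x * ζ ^ k) (fun x => f' k x * ζ ^ k) := by
    intro k
    have : IsPrim (f k) (f' k) := by
      cases k with
      | zero => exact h.zero.prim
      | succ k => exact (h.succ k).prim
    exact (this.const_mul (ζ ^ k)).congr (fun _ _ => by ring) fun _ _ => by ring
  -- The index shift, with value 0 at k = 0, treats the homogeneous equation for `f 0` and the
  -- recursion uniformly.
  set prev : ℕ → ℝ → ℂ := fun k => Nat.casesOn k (fun _ => 0) f with hprev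
  have hp' : ∀ k, IsPrim (fun x => f' k x * ζ ^ k) (fun x =>
      ((((l * (l + 1) / x ^ 2 : ℝ) : ℂ) + Q x) * f k x - prev k x) * ζ ^ k) := by
    intro k
    have : IsPrim (f' k) (fun x => (((l * (l + 1) / x ^ 2 : ℝ) : ℂ) + Q x) * f k x - prev k x) := by
      cases k with
      | zero => exact h.zero.prim_deriv
      | succ k => exact (h.succ k).prim_deriv
    exact (this.const_mul (ζ ^ k)).congr (fun _ _ => by ring) fun _ _ => by ring
  have hIcc : ∀ {a b x : ℝ}, x ∈ uIoc a b → x ∈ Icc (min a b) (max a b) := fun hx =>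
    uIoc_subset_uIcc hx
  constructor
  · refine IsPrim.tsum hp (fun x hx => hf.summable hx ζ) fun a b ha hb => ?_
    obtain ⟨c, hc0, hc, hs⟩ := hf' (min a b) (max a b) (lt_min ha hb)
    refine ⟨fun k => c k * ‖ζ‖ ^ k, fun _ => 1, hs _, intervalIntegrable_const, fun k x hx => ?_⟩
    rw [norm_mul, norm_pow, mul_one]
    exact mul_le_mul_of_nonneg_right (hc k x (hIcc hx)) (by positivity)
  · refine (IsPrim.tsum hp' (fun x hx => hf'.summable hx ζ) fun a b ha hb => ?_).congr
      (fun _ _ => rfl) fun x hx => ?_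
    · obtain ⟨c, hc0, hc, hs⟩ := hf (min a b) (max a b) (lt_min ha hb)
      set d : ℕ → ℝ := fun k => Nat.casesOn k 0 c with hd
      have hd0 : ∀ k, 0 ≤ d k := fun k => by
        cases k with
        | zero => exact le_rfl
        | succ k => exact hc0 k
      refine ⟨fun k => c k * ‖ζ‖ ^ k + d k * ‖ζ‖ ^ k,
        fun x => ‖((l * (l + 1) / x ^ 2 : ℝ) : ℂ) + Q x‖ + 1, ?_,
        (intervalIntegrable_potential hQ ha hb).norm.add intervalIntegrable_const,
        fun k x hx => ?_⟩
      · refine (hs _).add ?_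
        rw [← summable_nat_add_iff 1]
        refine ((hs ‖ζ‖).mul_left ‖ζ‖).congr fun k => ?_
        simp only [hd, pow_succ]; ring
      · have h1 : ‖prev k x‖ ≤ d k := by
          cases k with
          | zero => simp [hprev, hd]
          | succ k => exact hc k x (hIcc hx)
        have h2 := hc k x (hIcc hx)
        have h3 := hc0 k
        have h4 := hd0 k
        dsimp only
        rw [norm_mul, norm_pow, ← add_mul, mul_right_comm]
        gcongr
        refine (norm_sub_le _ _).trans ?_
        rw [norm_mul]
        have h5 := norm_nonneg (((l * (l + 1) / x ^ 2 : ℝ) : ℂ) + Q x)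
        nlinarith [mul_le_mul_of_nonneg_left h2 h5, mul_nonneg h4 h5]
    · have s1 := hf.summable hx ζ
      have s2 : HasSum (fun k => prev k x * ζ ^ k) (ζ * ∑' k, f k x * ζ ^ k) := by
        rw [← hasSum_nat_add_iff' 1]
        have e0 : ∑ i ∈ Finset.range 1, prev i x * ζ ^ i = 0 := by simp [hprev]
        rw [e0, sub_zero]
        have e1 : (fun k => prev (k + 1) x * ζ ^ (k + 1)) = fun k => ζ * (f k x * ζ ^ k) := by
          ext k; simp only [hprev, pow_succ]; ring
        rw [e1]
        exact s1.hasSum.mul_left ζ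
      have s3 := (s1.hasSum.mul_left (((l * (l + 1) / x ^ 2 : ℝ) : ℂ) + Q x)).sub s2
      have s4 : (fun k => ((((l * (l + 1) / x ^ 2 : ℝ) : ℂ) + Q x) * f k x - prev k x) * ζ ^ k) =
          fun k => (((l * (l + 1) / x ^ 2 : ℝ) : ℂ) + Q x) * (f k x * ζ ^ k) - prev k x * ζ ^ k := by
        ext k; ring
      rw [s4, s3.tsum_eq]; ring

theorem bound_extend {f : ℝ → ℂ} (hf : ContinuousOn f (Ioi 0)) {M t : ℝ}
    (h : ∀ x ∈ Ioc (0 : ℝ) 1, ‖f x‖ ≤ M * x ^ t) (X : ℝ) :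
    ∃ M', 0 ≤ M' ∧ ∀ x ∈ Ioc 0 X, ‖f x‖ ≤ M' * x ^ t := by
  obtain ⟨B, hB⟩ := (isCompact_Icc (a := (1 : ℝ)) (b := X)).exists_bound_of_continuousOn
    ((continuousOn_scale (-t) hf).mono fun x hx => lt_of_lt_of_le one_pos hx.1)
  refine ⟨|M| + |B|, by positivity, fun x hx => ?_⟩
  rcases le_or_gt x 1 with h1 | h1
  · refine (h x ⟨hx.1, h1⟩).trans ?_
    have := Real.rpow_pos_of_pos hx.1 t
    gcongr
    linarith [le_abs_self M, abs_nonneg B]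
  · refine norm_le_of_scale_le (by ring) hx.1 ((hB x ⟨h1.le, hx.2⟩).trans ?_)
    linarith [le_abs_self B, abs_nonneg M]

/-- Iterates of the Volterra operator: equations and factorial bounds. -/
theorem IsFund.volterra_chain {l : ℝ} (hl : -(1 / 2) < l) {Q u u' v v' : ℝ → ℂ}
    (F : IsFund l Q u u' v v') {h h' : ℕ → ℝ → ℂ} (h0 : ContinuousOn (h 0) (Ioi 0)) {M s : ℝ}
    (hs : -2 < s) (hb : ∀ x ∈ Ioc (0 : ℝ) 1, ‖h 0 x‖ ≤ M * x ^ (l + 1 + s))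
    (hstep : ∀ j, h (j + 1) = greenOp u v u v 0 (h j))
    (hstep' : ∀ j, h' (j + 1) = greenOp u v u' v' 0 (h j)) :
    (∀ j, IsSol l Q (h j) (h (j + 1)) (h' (j + 1))) ∧
    ∀ X, ∃ M B : ℝ, 0 ≤ M ∧ 0 ≤ B ∧ ∀ j : ℕ, ∀ x ∈ Ioc 0 X,
      ‖h j x‖ ≤ M * (B ^ j / j.factorial) * x ^ (l + 1 + (s + 2 * j)) ∧
      ‖h' (j + 1) x‖ ≤ M * (B ^ (j + 1) / (j + 1).factorial) * x ^ (l + (s + 2 * (j + 1))) := by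
  have hM : 0 ≤ M := by
    have := (norm_nonneg _).trans (hb 1 ⟨one_pos, le_rfl⟩)
    simpa using this
  have hsol : ∀ j, (ContinuousOn (h j) (Ioi 0) ∧ ∃ M, 0 ≤ M ∧ ∀ x ∈ Ioc (0 : ℝ) 1,
      ‖h j x‖ ≤ M * x ^ (l + 1 + (s + 2 * j))) ∧ IsSol l Q (h j) (h (j + 1)) (h' (j + 1)) := by
    have step : ∀ j, (ContinuousOn (h j) (Ioi 0) ∧ ∃ M, 0 ≤ M ∧ ∀ x ∈ Ioc (0 : ℝ) 1,
        ‖h j x‖ ≤ M * x ^ (l + 1 + (s + 2 * j))) → IsSol l Q (h j) (h (j + 1)) (h' (j + 1)) ∧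
        ∃ M, 0 ≤ M ∧ ∀ x ∈ Ioc (0 : ℝ) 1,
          ‖h (j + 1) x‖ ≤ M * x ^ (l + 1 + (s + 2 * (j + 1 : ℕ))) := by
      rintro j ⟨hc, M, hM, hb⟩
      have hj : (0 : ℝ) ≤ j := j.cast_nonneg
      obtain ⟨h1, M', hM', h2⟩ := F.volterra_bound hl isWeight_one hc hM (s := s + 2 * j)
        (by linarith) (by simpa using hb)
      rw [hstep j, hstep' j]
      refine ⟨h1, M', hM', fun x hx => ?_⟩
      have := (h2 x hx).1
      rw [mul_one] at this
      convert this using 3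
      push_cast; ring
    intro j
    induction j with
    | zero =>
      have h1 : ContinuousOn (h 0) (Ioi 0) ∧ ∃ M, 0 ≤ M ∧ ∀ x ∈ Ioc (0 : ℝ) 1,
        ‖h 0 x‖ ≤ M * x ^ (l + 1 + (s + 2 * (0 : ℕ))) := ⟨h0, M, hM, by simpa using hb⟩
      exact ⟨h1, (step 0 h1).1⟩
    | succ j ih =>
      have h1 : ContinuousOn (h (j + 1)) (Ioi 0) ∧ ∃ M, 0 ≤ M ∧ ∀ x ∈ Ioc (0 : ℝ) 1,
        ‖h (j + 1) x‖ ≤ M * x ^ (l + 1 + (s + 2 * (j + 1 : ℕ))) :=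
        ⟨ih.2.continuousOn, (step j ih.1).2⟩
      exact ⟨h1, (step (j + 1) h1).1⟩
  refine ⟨fun j => (hsol j).2, fun X => ?_⟩
  obtain ⟨C, hC, hK⟩ := F.volterra_rpow_bound hl X
  obtain ⟨M', hM', hb'⟩ := bound_extend h0 hb X
  -- This κ satisfies κ (j+1) ≤ s + 2j + 2, so the product of the factors 1/(s+2i+2), i < j, is at
  -- most κ^(-j)/j!.
  set κ := min (s + 2) 2 with hκ
  have hκ0 : 0 < κ := lt_min (by linarith) two_pos
  refine ⟨M', C / κ, hM', by positivity, ?_⟩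
  have hden : ∀ j : ℕ, κ * (j + 1) ≤ s + 2 * j + 2 := fun j => by
    have hj : (0 : ℝ) ≤ j := j.cast_nonneg
    have h1 : κ ≤ s + 2 := min_le_left _ _
    have h2 : κ ≤ 2 := min_le_right _ _
    nlinarith
  have hstepb : ∀ j : ℕ, C * (M' * ((C / κ) ^ j / j.factorial)) / (s + 2 * j + 2) ≤
      M' * ((C / κ) ^ (j + 1) / (j + 1).factorial) := fun j => by
    have hj : (0 : ℝ) ≤ j := j.cast_nonneg
    have e : M' * ((C / κ) ^ (j + 1) / (j + 1).factorial) =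
        C * (M' * ((C / κ) ^ j / j.factorial)) / (κ * (j + 1)) := by
      rw [Nat.factorial_succ, pow_succ]; push_cast; field_simp
    rw [e]
    exact div_le_div_of_nonneg_left (by positivity) (by positivity) (hden j)
  have hsj : ∀ j : ℕ, -2 < s + 2 * (j : ℝ) := fun j => by
    have hj : (0 : ℝ) ≤ j := j.cast_nonneg
    linarith
  have hind : ∀ j : ℕ, ∀ x ∈ Ioc 0 X,
      ‖h j x‖ ≤ M' * ((C / κ) ^ j / j.factorial) * x ^ (l + 1 + (s + 2 * j)) := by
    intro j
    induction j with
    | zero => simpa using hb'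
    | succ j ih =>
      intro x hx
      have := (hK (h j) _ _ (hsol j).1.1 (by positivity) (hsj j) ih x hx).1
      rw [hstep j]
      refine this.trans ?_
      rw [show l + 1 + (s + 2 * ((j + 1 : ℕ) : ℝ)) = l + 1 + (s + 2 * j + 2) by push_cast; ring]
      exact mul_le_mul_of_nonneg_right (hstepb j) (Real.rpow_nonneg hx.1.le _)
  intro j x hx
  refine ⟨hind j x hx, ?_⟩
  have := (hK (h j) _ _ (hsol j).1.1 (by positivity) (hsj j) (hind j) x hx).2
  rw [hstep' j]
  refine this.trans ?_
  rw [show l + (s + 2 * ((j : ℝ) + 1)) = l + (s + 2 * j + 2) by ring]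
  exact mul_le_mul_of_nonneg_right (hstepb j) (Real.rpow_nonneg hx.1.le _)

theorem locEntire_of_factorial_bound {f : ℕ → ℝ → ℂ} {t : ℝ}
    (h : ∀ X, ∃ M B : ℝ, 0 ≤ M ∧ 0 ≤ B ∧ ∀ j : ℕ, ∀ x ∈ Ioc 0 X,
      ‖f j x‖ ≤ M * (B ^ j / j.factorial) * x ^ (t + 2 * j)) : LocEntire f := by
  intro a b ha
  obtain ⟨M, B, hM, hB, hb⟩ := h b
  obtain ⟨D, hD⟩ := (isCompact_Icc (a := a) (b := b)).exists_bound_of_continuousOn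
    (f := fun x : ℝ => x ^ t) (continuousOn_id.rpow_const fun x hx =>
      Or.inl (ne_of_gt (lt_of_lt_of_le ha hx.1)))
  have hfac : ∀ j : ℕ, (0 : ℝ) < j.factorial := fun j => by positivity
  refine ⟨fun j => M * (B ^ j / j.factorial) * (|D| * (b ^ 2) ^ j), fun j => by positivity,
    fun j x hx => ?_, fun ρ => ?_⟩
  · have hx0 : 0 < x := lt_of_lt_of_le ha hx.1
    refine (hb j x ⟨hx0, hx.2⟩).trans ?_
    refine mul_le_mul_of_nonneg_left ?_ (by positivity)
    rw [Real.rpow_add hx0, Real.rpow_mul hx0.le, Real.rpow_natCast, Real.rpow_two]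
    have h1 : x ^ t ≤ |D| := (le_abs_self _).trans ((hD x hx).trans (le_abs_self _))
    have h2 := hx.2
    gcongr
  · refine ((Real.summable_pow_div_factorial (B * b ^ 2 * ρ)).mul_left (M * |D|)).congr fun j => ?_
    rw [mul_pow, mul_pow]; ring

/-! ### Frobenius expansions of the two solutions around a spectral parameter -/

/-- Iterated solutions of `(τ - z₀) f_{k+1} = f_k`: the first `n` steps use the Green operator, the
later ones the Volterra operator. -/
def frob (u v : ℝ → ℂ) (n : ℕ) (f₀ : ℝ → ℂ) : ℕ → ℝ → ℂ
  | 0 => f₀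
  | k + 1 => greenOp u v u v (if k < n then 1 else 0) (frob u v n f₀ k)

/-- The derivatives of `frob`. -/
def frobDeriv (u v u' v' : ℝ → ℂ) (n : ℕ) (f₀ f₀' : ℝ → ℂ) : ℕ → ℝ → ℂ
  | 0 => f₀'
  | k + 1 => greenOp u v u' v' (if k < n then 1 else 0) (frob u v n f₀ k)

theorem nl_le {l : ℝ} (hl : -(1 / 2) < l) : (nl l : ℝ) ≤ l + 1 / 2 :=
  Nat.floor_le (by linarith)

theorem lt_nl (l : ℝ) : l + 1 / 2 < nl l + 1 := Nat.lt_floor_add_one _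

theorem IsHalfInt.eq_nl {l : ℝ} (h : IsHalfInt l) : l + 1 / 2 = nl l := by
  obtain ⟨n, hn⟩ := h
  rw [nl, hn, Nat.floor_natCast]

theorem IsHalfInt.one_le_nl {l : ℝ} (hl : -(1 / 2) < l) (h : IsHalfInt l) : 1 ≤ nl l := by
  have := h.eq_nl
  have h1 : (0 : ℝ) < nl l := by linarith
  exact_mod_cast h1

theorem nl_lt_of_not_isHalfInt {l : ℝ} (hl : -(1 / 2) < l) (h : ¬ IsHalfInt l) :
    (nl l : ℝ) < l + 1 / 2 :=
  lt_of_le_of_ne (nl_le hl) fun h' => h ⟨nl l, h'.symm⟩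

open Classical in
/-- The growth of the `k`-th coefficient function of `θ` at `0`. -/
def logWeight (l : ℝ) (k : ℕ) (x : ℝ) : ℝ :=
  if IsHalfInt l ∧ nl l ≤ k then 1 - Real.log x else 1

theorem isWeight_logWeight (l : ℝ) (k : ℕ) : IsWeight (logWeight l k) := by
  by_cases h : IsHalfInt l ∧ nl l ≤ k
  · have : logWeight l k = fun x => 1 - Real.log x := by ext x; simp only [logWeight, if_pos h]
    rw [this]; exact isWeight_log
  · have : logWeight l k = fun _ => 1 := by ext x; simp only [logWeight, if_neg h]
    rw [this]; exact isWeight_one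

/-- Each term beyond index n is at most x^(l+1+s+2) times a summable constant, and s > -2. So only
the terms up to n matter at order x^(l+1), which is what makes `HasPolyExpansion` possible. -/
theorem tendsto_scale_tail {l s M B : ℝ} (hs : -2 < s) {n : ℕ} {f : ℕ → ℝ → ℂ}
    (hb : ∀ j : ℕ, ∀ x ∈ Ioc (0 : ℝ) 1,
      ‖f (j + n) x‖ ≤ M * (B ^ j / j.factorial) * x ^ (l + 1 + (s + 2 * j))) (hM : 0 ≤ M) (hB : 0 ≤ B)
    (hf : LocEntire f) (ζ : ℂ) :
    Tendsto (scale (-(l + 1)) fun x => (∑' k, f k x * ζ ^ k) -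
      ∑ k ∈ Finset.range (n + 1), f k x * ζ ^ k) (𝓝[>] 0) (𝓝 0) := by
  set e : ℕ → ℝ := fun j => M * ‖ζ‖ ^ n * ((B * ‖ζ‖) ^ (j + 1) / (j + 1).factorial) with he
  have hes : Summable e :=
    (((summable_nat_add_iff 1).2 (Real.summable_pow_div_factorial (B * ‖ζ‖)))).mul_left _
  have hlim : Tendsto (fun x : ℝ => x ^ (s + 2) * ∑' j, e j) (𝓝[>] 0) (𝓝 0) := by
    have hc : ContinuousAt (fun x : ℝ => x ^ (s + 2) * ∑' j, e j) 0 :=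
      (continuousAt_id.rpow_const (Or.inr (by linarith))).mul continuousAt_const
    have := hc.tendsto
    rw [Real.zero_rpow (by linarith), zero_mul] at this
    exact this.mono_left nhdsWithin_le_nhds
  refine squeeze_zero_norm' ?_ hlim
  filter_upwards [Ioc_mem_nhdsGT one_pos] with x hx
  have hsum := hf.summable hx.1 ζ
  rw [norm_scale _ _ hx.1, ← hsum.sum_add_tsum_nat_add (n + 1), add_sub_cancel_left]
  have hterm : ∀ j, ‖f (j + (n + 1)) x * ζ ^ (j + (n + 1))‖ ≤ x ^ (l + 1 + (s + 2)) * e j := by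
    intro j
    have h1 := hb (j + 1) x hx
    rw [show j + 1 + n = j + (n + 1) by ring] at h1
    have h2 : x ^ (l + 1 + (s + 2 * ((j + 1 : ℕ) : ℝ))) ≤ x ^ (l + 1 + (s + 2)) := by
      refine Real.rpow_le_rpow_of_exponent_ge hx.1 hx.2 ?_
      have hj : (0 : ℝ) ≤ j := j.cast_nonneg
      push_cast; linarith
    rw [norm_mul, norm_pow]
    calc _ ≤ (M * (B ^ (j + 1) / (j + 1).factorial) * x ^ (l + 1 + (s + 2))) *
          ‖ζ‖ ^ (j + (n + 1)) := by
          gcongr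
          exact h1.trans (mul_le_mul_of_nonneg_left h2 (by positivity))
      _ = _ := by
          rw [he]; simp only [mul_pow]
          rw [show j + (n + 1) = (j + 1) + n by ring, pow_add]
          ring
  have hnorm := tsum_of_norm_bounded (hes.mul_left (x ^ (l + 1 + (s + 2)))).hasSum hterm
  rw [tsum_mul_left] at hnorm
  calc _ ≤ x ^ (-(l + 1)) * (x ^ (l + 1 + (s + 2)) * ∑' j, e j) := by
        refine mul_le_mul_of_nonneg_left ?_ (Real.rpow_nonneg hx.1.le _)
        convert hnorm using 2
    _ = _ := by
        rw [← mul_assoc, ← Real.rpow_add hx.1]; congr 2; ring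

/-- The expansion of the first solution around a spectral parameter. -/
structure IsFirstChain (l : ℝ) (Q u u' : ℝ → ℂ) (f f' : ℕ → ℝ → ℂ) : Prop where
  chain : IsChain l Q f f'
  init : f 0 = u ∧ f' 0 = u'
  entire : LocEntire f
  entire_deriv : LocEntire f'
  bound : ∀ k : ℕ, ∃ M, 0 ≤ M ∧ ∀ x ∈ Ioc (0 : ℝ) 1,
    ‖f k x‖ ≤ M * x ^ (l + 1 + 2 * k) ∧ ‖f' k x‖ ≤ M * x ^ (l + 2 * k)
  tail : ∀ ζ : ℂ, Tendsto (scale (-(l + 1)) fun x => (∑' k, f k x * ζ ^ k) - u x) (𝓝[>] 0) (𝓝 0)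

/-- The expansion of a second solution around a spectral parameter. -/
structure IsSecondChain (l : ℝ) (Q v v' : ℝ → ℂ) (f f' : ℕ → ℝ → ℂ) : Prop where
  chain : IsChain l Q f f'
  init : f 0 = v ∧ f' 0 = v'
  entire : LocEntire f
  entire_deriv : LocEntire f'
  bound : ∀ k : ℕ, ∃ M, 0 ≤ M ∧ ∀ x ∈ Ioc (0 : ℝ) 1,
    ‖f k x‖ ≤ M * (x ^ (-l + 2 * k) * logWeight l k x) ∧
    ‖f' k x‖ ≤ M * (x ^ (-l - 1 + 2 * k) * logWeight l k x)
  tail : ∀ ζ : ℂ, Tendsto (scale (-(l + 1)) fun x => (∑' k, f k x * ζ ^ k) -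
    ∑ k ∈ Finset.range (nl l + 1), f k x * ζ ^ k) (𝓝[>] 0) (𝓝 0)

theorem IsFund.exists_firstChain {l : ℝ} (hl : -(1 / 2) < l) {Q u u' v v' : ℝ → ℂ}
    (F : IsFund l Q u u' v v') : ∃ f f', IsFirstChain l Q u u' f f' := by
  obtain ⟨C, hC, hF⟩ := F.bound 1
  obtain ⟨hsol, hbd⟩ := F.volterra_chain hl (h := frob u v 0 u) (h' := frobDeriv u v u' v' 0 u u')
    F.first.continuousOn (s := 0) (M := C) (by norm_num)
    (fun x hx => by rw [add_zero]; exact (hF x hx).1) (fun j => by simp [frob])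
    (fun j => by simp [frobDeriv])
  have hchain : IsChain l Q (frob u v 0 u) (frobDeriv u v u' v' 0 u u') := ⟨F.first, hsol⟩
  have hent : LocEntire (frob u v 0 u) := by
    refine locEntire_of_factorial_bound (t := l + 1) fun X => ?_
    obtain ⟨M, B, hM, hB, h⟩ := hbd X
    refine ⟨M, B, hM, hB, fun j x hx => ?_⟩
    have := (h j x hx).1
    rwa [zero_add] at this
  have hb : ∀ k : ℕ, ∃ M, 0 ≤ M ∧ ∀ x ∈ Ioc (0 : ℝ) 1,
      ‖frob u v 0 u k x‖ ≤ M * x ^ (l + 1 + 2 * k) ∧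
      ‖frobDeriv u v u' v' 0 u u' k x‖ ≤ M * x ^ (l + 2 * k) := by
    obtain ⟨M, B, hM, hB, h⟩ := hbd 1
    intro k
    cases k with
    | zero =>
      refine ⟨C, hC.le, fun x hx => ⟨?_, ?_⟩⟩
      · simpa [frob] using (hF x hx).1
      · simpa [frobDeriv] using (hF x hx).2.1
    | succ k =>
      refine ⟨M * (B ^ (k + 1) / (k + 1).factorial), by positivity, fun x hx => ⟨?_, ?_⟩⟩
      · have := (h (k + 1) x hx).1
        rwa [zero_add] at this
      · have := (h k x hx).2
        rw [zero_add] at this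
        exact_mod_cast this
  refine ⟨frob u v 0 u, frobDeriv u v u' v' 0 u u', hchain, ⟨rfl, rfl⟩, hent, ?_, hb, fun ζ => ?_⟩
  · refine LocEntire.of_tail hchain.continuousOn_deriv 1 ?_
    refine locEntire_of_factorial_bound (t := l + 2) fun X => ?_
    obtain ⟨M, B, hM, hB, h⟩ := hbd X
    refine ⟨M * B, B, by positivity, hB, fun j x hx => (h j x hx).2.trans ?_⟩
    rw [show l + (0 + 2 * ((j : ℝ) + 1)) = l + 2 + 2 * j by ring]
    refine mul_le_mul_of_nonneg_right ?_ (Real.rpow_nonneg hx.1.le _)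
    rw [mul_assoc, pow_succ', mul_div_assoc]
    gcongr
    exact Nat.le_succ j
  · obtain ⟨M, B, hM, hB, h⟩ := hbd 1
    have := tendsto_scale_tail (n := 0) (f := frob u v 0 u) (l := l) (s := 0) (by norm_num)
      (fun j x hx => (h j x hx).1) hM hB hent ζ
    simpa [frob] using this

/-- Below n_l the integral of v f_k starts at 1, and afterwards at 0, where v f_k has become
integrable because 2k - 2l > -1. From index n_l on the chain is a pure Volterra iteration, so the
factorial bounds apply to it; the finitely many earlier terms do not affect convergence. -/
theorem IsFund.exists_secondChain {l : ℝ} (hl : -(1 / 2) < l) {Q u u' v v' : ℝ → ℂ}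
    (F : IsFund l Q u u' v v') : ∃ f f', IsSecondChain l Q v v' f f' := by
  obtain ⟨C, hC, hF⟩ := F.bound 1
  set n := nl l with hn
  set f := frob u v n v with hf
  set f' := frobDeriv u v u' v' n v v' with hf'
  have hn1 := nl_le hl
  have hn2 := lt_nl l
  have bstep : ∀ k : ℕ, ContinuousOn (f k) (Ioi 0) → (∃ M, 0 ≤ M ∧ ∀ x ∈ Ioc (0 : ℝ) 1,
      ‖f k x‖ ≤ M * (x ^ (-l + 2 * k) * logWeight l k x)) → IsSol l Q (f k) (f (k + 1)) (f' (k + 1)) ∧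
      ∃ M, 0 ≤ M ∧ ∀ x ∈ Ioc (0 : ℝ) 1,
        ‖f (k + 1) x‖ ≤ M * (x ^ (-l + 2 * (k + 1 : ℕ)) * logWeight l (k + 1) x) ∧
        ‖f' (k + 1) x‖ ≤ M * (x ^ (-l - 1 + 2 * (k + 1 : ℕ)) * logWeight l (k + 1) x) := by
    rintro k hc ⟨M, hM, hb⟩
    have hk0 : (0 : ℝ) ≤ k := k.cast_nonneg
    rcases lt_or_ge k n with hk | hk
    · have e1 : f (k + 1) = greenOp u v u v 1 (f k) := by simp [hf, frob, hk]
      have e2 : f' (k + 1) = greenOp u v u' v' 1 (f k) := by simp [hf, hf', frobDeriv, hk]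
      have hkn : (k : ℝ) + 1 ≤ n := by exact_mod_cast hk
      -- Since k+1 ≤ n_l ≤ l + 1/2, the exponent is at most -1. Equality means k+1 = n_l = l + 1/2:
      -- this is the step at which the weight becomes logarithmic.
      have hcase : 2 * (k : ℝ) - 2 * l < -1 ∨ 2 * (k : ℝ) - 2 * l = -1 ∧
          ∀ x ∈ Ioc (0 : ℝ) 1, -Real.log x ≤ logWeight l (k + 1) x := by
        rcases (show 2 * (k : ℝ) - 2 * l ≤ -1 by linarith).lt_or_eq with h | h
        · exact Or.inl h
        · refine Or.inr ⟨h, fun x hx => ?_⟩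
          have hkl : l + 1 / 2 = ((k + 1 : ℕ) : ℝ) := by push_cast; linarith
          have hh : IsHalfInt l := ⟨k + 1, hkl⟩
          have hle : nl l ≤ k + 1 := by
            have := hh.eq_nl
            rw [hkl] at this
            have : k + 1 = nl l := by exact_mod_cast this
            exact this.ge
          rw [logWeight, if_pos ⟨hh, hle⟩]
          linarith
      obtain ⟨h1, M', hM', h2⟩ := F.green_bound (isWeight_logWeight l (k + 1)) hc hM
        (t := 2 * k) (by linarith) hcase (fun x hx => by
          have := hb x hx
          rwa [logWeight, if_neg (fun h => absurd h.2 (not_le.2 hk)), mul_one] at this)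
      rw [e1, e2]
      refine ⟨h1, M', hM', fun x hx => ?_⟩
      have := h2 x hx
      rw [show -l + 2 * ((k + 1 : ℕ) : ℝ) = -l + 2 * k + 2 by push_cast; ring,
        show -l - 1 + 2 * ((k + 1 : ℕ) : ℝ) = -l - 1 + 2 * k + 2 by push_cast; ring]
      exact this
    · have e1 : f (k + 1) = greenOp u v u v 0 (f k) := by simp [hf, frob, not_lt.2 hk]
      have e2 : f' (k + 1) = greenOp u v u' v' 0 (f k) := by simp [hf, hf', frobDeriv, not_lt.2 hk]
      have hkn : (n : ℝ) ≤ k := by exact_mod_cast hk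
      have ew : logWeight l (k + 1) = logWeight l k := by
        ext x
        by_cases h : IsHalfInt l
        · rw [logWeight, logWeight, if_pos ⟨h, hk.trans k.le_succ⟩, if_pos ⟨h, hk⟩]
        · rw [logWeight, logWeight, if_neg fun h' => h h'.1, if_neg fun h' => h h'.1]
      obtain ⟨h1, M', hM', h2⟩ := F.volterra_bound hl (isWeight_logWeight l k) hc hM
        (s := 2 * k - 2 * l - 1) (by linarith) (fun x hx => by
          have := hb x hx
          rwa [show l + 1 + (2 * (k : ℝ) - 2 * l - 1) = -l + 2 * k by ring])
      rw [e1, e2, ew]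
      refine ⟨h1, M', hM', fun x hx => ?_⟩
      have := h2 x hx
      rw [show -l + 2 * ((k + 1 : ℕ) : ℝ) = l + 3 + (2 * (k : ℝ) - 2 * l - 1) by push_cast; ring,
        show -l - 1 + 2 * ((k + 1 : ℕ) : ℝ) = l + 2 + (2 * (k : ℝ) - 2 * l - 1) by push_cast; ring]
      exact this
  have hall : ∀ k : ℕ, ContinuousOn (f k) (Ioi 0) ∧ ∃ M, 0 ≤ M ∧ ∀ x ∈ Ioc (0 : ℝ) 1,
      ‖f k x‖ ≤ M * (x ^ (-l + 2 * k) * logWeight l k x) ∧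
      ‖f' k x‖ ≤ M * (x ^ (-l - 1 + 2 * k) * logWeight l k x) := by
    intro k
    induction k with
    | zero =>
      refine ⟨F.second.continuousOn, C, hC.le, fun x hx => ?_⟩
      have h1 := (isWeight_logWeight l 0).one_le x hx
      have h2 := Real.rpow_pos_of_pos hx.1 (-l)
      have h3 := Real.rpow_pos_of_pos hx.1 (-l - 1)
      simp only [Nat.cast_zero, mul_zero, add_zero]
      refine ⟨(hF x hx).2.2.1.trans ?_, (hF x hx).2.2.2.trans ?_⟩
      · exact mul_le_mul_of_nonneg_left (le_mul_of_one_le_right h2.le h1) hC.le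
      · exact mul_le_mul_of_nonneg_left (le_mul_of_one_le_right h3.le h1) hC.le
    | succ k ih =>
      obtain ⟨hc, M, hM, hb⟩ := ih
      obtain ⟨h1, h2⟩ := bstep k hc ⟨M, hM, fun x hx => (hb x hx).1⟩
      exact ⟨h1.continuousOn, h2⟩
  have hchain : IsChain l Q f f' := by
    refine ⟨F.second, fun k => ?_⟩
    obtain ⟨hc, M, hM, hb⟩ := hall k
    exact (bstep k hc ⟨M, hM, fun x hx => (hb x hx).1⟩).1
  -- Half of the gap 2n_l + 1 - 2l > 0: giving up x^(-δ) absorbs the possible logarithm and still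
  -- leaves s > -2.
  set δ := (2 * n + 1 - 2 * l) / 2 with hδ
  have hδ0 : 0 < δ := by rw [hδ]; linarith
  set s := 2 * n - 2 * l - 1 - δ with hs
  have hs2 : -2 < s := by rw [hs, hδ]; linarith
  obtain ⟨-, M, hM, hb⟩ := hall n
  obtain ⟨D, hD, hw⟩ := (isWeight_logWeight l n).le_rpow hδ0
  have hb0 : ∀ x ∈ Ioc (0 : ℝ) 1, ‖f (0 + n) x‖ ≤ M * D * x ^ (l + 1 + s) := fun x hx => by
    rw [zero_add]
    refine (hb x hx).1.trans ?_
    have h1 := Real.rpow_pos_of_pos hx.1 (-l + 2 * (n : ℝ))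
    calc _ ≤ M * (x ^ (-l + 2 * (n : ℝ)) * (D * x ^ (-δ))) := by
          gcongr; exact hw x hx
      _ = M * D * (x ^ (-l + 2 * (n : ℝ)) * x ^ (-δ)) := by ring
      _ = _ := by
          rw [← Real.rpow_add hx.1]; congr 2; rw [hs]; ring
  obtain ⟨-, hbd⟩ := F.volterra_chain hl (h := fun j => f (j + n)) (h' := fun j => f' (j + n))
    (hall _).1 hs2 hb0 (fun j => by
      rw [show j + 1 + n = (j + n) + 1 by ring]; simp [hf, frob])
    (fun j => by
      rw [show j + 1 + n = (j + n) + 1 by ring]; simp [hf, hf', frobDeriv])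
  have hent : LocEntire f := by
    refine LocEntire.of_tail hchain.continuousOn n ?_
    refine locEntire_of_factorial_bound (t := l + 1 + s) fun X => ?_
    obtain ⟨M, B, hM, hB, h⟩ := hbd X
    refine ⟨M, B, hM, hB, fun j x hx => ?_⟩
    have := (h j x hx).1
    rwa [← add_assoc] at this
  refine ⟨f, f', hchain, ⟨rfl, rfl⟩, hent, ?_, fun k => (hall k).2, fun ζ => ?_⟩
  · refine LocEntire.of_tail hchain.continuousOn_deriv (1 + n) ?_
    refine locEntire_of_factorial_bound (t := l + s + 2) fun X => ?_
    obtain ⟨M, B, hM, hB, h⟩ := hbd X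
    refine ⟨M * B, B, by positivity, hB, fun j x hx => ?_⟩
    have := (h j x hx).2
    rw [add_assoc] at this
    refine this.trans ?_
    rw [show l + (s + 2 * ((j : ℝ) + 1)) = l + s + 2 + 2 * j by ring]
    refine mul_le_mul_of_nonneg_right ?_ (Real.rpow_nonneg hx.1.le _)
    rw [mul_assoc, pow_succ', mul_div_assoc]
    gcongr
    exact Nat.le_succ j
  · obtain ⟨M, B, hM, hB, h⟩ := hbd 1
    exact tendsto_scale_tail (n := n) (f := f) (l := l) (s := s) hs2
      (fun j x hx => (h j x hx).1) hM hB hent ζ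

theorem IsFirstChain.tendsto_tsum {l : ℝ} {Q u u' : ℝ → ℂ} {f f' : ℕ → ℝ → ℂ}
    (h : IsFirstChain l Q u u' f f') (hu : Tendsto (scale (-(l + 1)) u) (𝓝[>] 0) (𝓝 1)) (ζ : ℂ) :
    Tendsto (scale (-(l + 1)) fun x => ∑' k, f k x * ζ ^ k) (𝓝[>] 0) (𝓝 1) := by
  have := (h.tail ζ).add hu
  rw [zero_add] at this
  refine this.congr fun x => ?_
  simp only [scale]; ring

theorem tendsto_scale_of_bound {f : ℝ → ℂ} {s t M : ℝ} (hst : 0 < s + t)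
    (h : ∀ x ∈ Ioc (0 : ℝ) 1, ‖f x‖ ≤ M * x ^ t) : Tendsto (scale s f) (𝓝[>] 0) (𝓝 0) := by
  have hlim : Tendsto (fun x : ℝ => M * x ^ (s + t)) (𝓝[>] 0) (𝓝 0) := by
    have hc : ContinuousAt (fun x : ℝ => M * x ^ (s + t)) 0 :=
      continuousAt_const.mul (continuousAt_id.rpow_const (Or.inr hst.le))
    have := hc.tendsto
    rw [Real.zero_rpow hst.ne', mul_zero] at this
    exact this.mono_left nhdsWithin_le_nhds
  refine squeeze_zero_norm' ?_ hlim
  filter_upwards [Ioc_mem_nhdsGT one_pos] with x hx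
  rw [norm_scale _ _ hx.1, Real.rpow_add hx.1]
  have := Real.rpow_pos_of_pos hx.1 s
  calc _ ≤ x ^ s * (M * x ^ t) := by gcongr; exact h x hx
    _ = _ := by ring

theorem tendsto_scale_of_weight_bound {f : ℝ → ℂ} {w : ℝ → ℝ} (hw : IsWeight w) {s t M : ℝ}
    (hM : 0 ≤ M) (hst : 0 < s + t) (h : ∀ x ∈ Ioc (0 : ℝ) 1, ‖f x‖ ≤ M * (x ^ t * w x)) :
    Tendsto (scale s f) (𝓝[>] 0) (𝓝 0) := by
  obtain ⟨D, hD, hwD⟩ := hw.le_rpow (δ := (s + t) / 2) (by linarith)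
  refine tendsto_scale_of_bound (t := t - (s + t) / 2) (M := M * D) (by linarith) fun x hx => ?_
  refine (h x hx).trans ?_
  have := Real.rpow_pos_of_pos hx.1 t
  calc _ ≤ M * (x ^ t * (D * x ^ (-((s + t) / 2)))) := by gcongr; exact hwD x hx
    _ = M * D * (x ^ t * x ^ (-((s + t) / 2))) := by ring
    _ = _ := by rw [← Real.rpow_add hx.1]; rfl

/-- After multiplication by x^l the tail is o(x^(2l+1)) and the terms 1 ≤ k ≤ n_l are of order
x^(2k), up to a logarithm. Only the term k = 0 contributes to the limit. -/
theorem IsSecondChain.tendsto_tsum {l : ℝ} (hl : -(1 / 2) < l) {Q v v' : ℝ → ℂ}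
    {f f' : ℕ → ℝ → ℂ} (h : IsSecondChain l Q v v' f f') {c : ℂ}
    (hv : Tendsto (scale l v) (𝓝[>] 0) (𝓝 c)) (ζ : ℂ) :
    Tendsto (scale l fun x => ∑' k, f k x * ζ ^ k) (𝓝[>] 0) (𝓝 c) := by
  have h1 : Tendsto (fun x => ((x ^ (2 * l + 1) : ℝ) : ℂ) * scale (-(l + 1)) (fun x =>
      (∑' k, f k x * ζ ^ k) - ∑ k ∈ Finset.range (nl l + 1), f k x * ζ ^ k) x) (𝓝[>] 0) (𝓝 0) := by
    have := (tendsto_rpow_zero (s := 2 * l + 1) (by linarith)).mul (h.tail ζ)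
    rwa [zero_mul] at this
  have h2 : Tendsto (fun x => ∑ k ∈ Finset.range (nl l + 1), ζ ^ k * scale l (f k) x) (𝓝[>] 0)
      (𝓝 (∑ k ∈ Finset.range (nl l + 1), ζ ^ k * if k = 0 then c else 0)) := by
    refine tendsto_finsetSum _ fun k _ => Tendsto.const_mul _ ?_
    split_ifs with hk
    · rw [hk, h.init.1]; exact hv
    · obtain ⟨M, hM, hb⟩ := h.bound k
      have hk1 : (1 : ℝ) ≤ k := by exact_mod_cast Nat.one_le_iff_ne_zero.2 hk
      exact tendsto_scale_of_weight_bound (isWeight_logWeight l k) hM (by linarith)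
        fun x hx => (hb x hx).1
  have e : ∑ k ∈ Finset.range (nl l + 1), ζ ^ k * (if k = 0 then c else 0) = c := by
    simp
  rw [e] at h2
  have h3 := h1.add h2
  rw [zero_add] at h3
  refine h3.congr' ?_
  filter_upwards [self_mem_nhdsWithin] with x hx
  have hx0 : (0 : ℝ) < x := hx
  have e2 : ((x ^ (2 * l + 1) : ℝ) : ℂ) * ((x ^ (-(l + 1)) : ℝ) : ℂ) = ((x ^ l : ℝ) : ℂ) := by
    rw [rpow_ofReal_mul hx0]; congr 2; ring
  simp only [scale]
  rw [← mul_assoc, e2, mul_sub, Finset.mul_sum]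
  have : ∑ k ∈ Finset.range (nl l + 1), ζ ^ k * (((x ^ l : ℝ) : ℂ) * f k x) =
      ∑ k ∈ Finset.range (nl l + 1), ((x ^ l : ℝ) : ℂ) * (f k x * ζ ^ k) :=
    Finset.sum_congr rfl fun k _ => by ring
  rw [this]; ring

/-! ### Regularity of the coefficients away from the resonance -/

theorem memLp_mul_of_bound {w f : ℝ → ℂ} {r : ℝ≥0∞} (hw : MemLp w r unitMeasure)
    (hf : ContinuousOn f (Ioi 0)) {C : ℝ} (hC : ∀ x ∈ Ioc (0 : ℝ) 1, ‖f x‖ ≤ C) :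
    MemLp (fun x => w x * f x) r unitMeasure := by
  refine MemLp.of_le_mul (c := C) hw (hw.1.mul hf.aestronglyMeasurable_unit) ?_
  filter_upwards [ae_unitMeasure] with x hx
  rw [norm_mul, mul_comm]
  exact mul_le_mul_of_nonneg_right (hC x ⟨hx.1, hx.2.le⟩) (norm_nonneg _)

theorem scale_bound {f : ℝ → ℂ} {s t M : ℝ} {w : ℝ → ℝ} (hst : s + t = 0)
    (h : ∀ x ∈ Ioc (0 : ℝ) 1, ‖f x‖ ≤ M * (x ^ t * w x)) :
    ∀ x ∈ Ioc (0 : ℝ) 1, ‖scale s f x‖ ≤ M * w x := by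
  intro x hx
  rw [norm_scale _ _ hx.1]
  have h1 := Real.rpow_pos_of_pos hx.1 s
  calc _ ≤ x ^ s * (M * (x ^ t * w x)) := by gcongr; exact h x hx
    _ = (x ^ s * x ^ t) * (M * w x) := by ring
    _ = _ := by rw [← Real.rpow_add hx.1, hst, Real.rpow_zero, one_mul]

/-- `f` is bounded on `(0, 1]` by a multiple of the weight `w`. -/
def BddBy (w : ℝ → ℝ) (f : ℝ → ℂ) : Prop := ∃ M, 0 ≤ M ∧ ∀ x ∈ Ioc (0 : ℝ) 1, ‖f x‖ ≤ M * w x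

namespace BddBy

variable {w : ℝ → ℝ} {f g : ℝ → ℂ}

theorem add (hf : BddBy w f) (hg : BddBy w g) : BddBy w fun x => f x + g x := by
  obtain ⟨M, hM, hf⟩ := hf
  obtain ⟨N, hN, hg⟩ := hg
  refine ⟨M + N, by positivity, fun x hx => (norm_add_le _ _).trans ?_⟩
  rw [add_mul]
  exact add_le_add (hf x hx) (hg x hx)

theorem const_mul (hf : BddBy w f) (c : ℂ) : BddBy w fun x => c * f x := by
  obtain ⟨M, hM, hf⟩ := hf
  refine ⟨‖c‖ * M, by positivity, fun x hx => ?_⟩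
  rw [norm_mul, mul_assoc]
  exact mul_le_mul_of_nonneg_left (hf x hx) (norm_nonneg _)

theorem sub (hf : BddBy w f) (hg : BddBy w g) : BddBy w fun x => f x - g x := by
  have := hf.add (hg.const_mul (-1))
  simpa [sub_eq_add_neg] using this

theorem log : BddBy (fun x => 1 - Real.log x) fun x => ((Real.log x : ℝ) : ℂ) := by
  refine ⟨1, zero_le_one, fun x hx => ?_⟩
  have := Real.log_nonpos hx.1.le hx.2
  rw [Complex.norm_real, Real.norm_of_nonpos this]
  linarith

theorem tendsto_rpow_mul (hw : IsWeight w) (hf : BddBy w f) {s : ℝ} (hs : 0 < s) :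
    Tendsto (fun x : ℝ => ((x ^ s : ℝ) : ℂ) * f x) (𝓝[>] 0) (𝓝 0) := by
  obtain ⟨M, hM, hf⟩ := hf
  refine tendsto_scale_of_weight_bound hw (f := f) (t := 0) hM (by linarith) fun x hx => ?_
  rw [Real.rpow_zero, one_mul]
  exact hf x hx

/-- For a negative exponent the a priori bound already supplies the boundary condition, since x^(-σ)
beats every slowly growing weight. The bounds on the iterates are needed for this reason. -/
theorem eulerCase (hw : IsWeight w) {σ : ℝ} (hσ : σ < 0) (hf : BddBy w f) (hg : BddBy w g)
    (r : ℝ≥0∞) : EulerCase σ r f g :=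
  Or.inl ⟨hσ, ((hf.const_mul σ).add hg).tendsto_rpow_mul hw (by linarith)⟩

end BddBy

theorem bddBy_upper {l m M : ℝ} {w : ℝ → ℝ} (hM : 0 ≤ M) {f f' : ℝ → ℂ}
    (h : ∀ x ∈ Ioc (0 : ℝ) 1, ‖f x‖ ≤ M * (x ^ m * w x) ∧ ‖f' x‖ ≤ M * (x ^ (m - 1) * w x)) :
    BddBy w (scale (-m) f) ∧ BddBy w (scale (1 - m) f') ∧ BddBy w (upper l m f f') ∧
      BddBy w (lower l m f f') := by
  have h1 : BddBy w (scale (-m) f) := ⟨M, hM, scale_bound (by ring) fun x hx => (h x hx).1⟩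
  have h2 : BddBy w (scale (1 - m) f') := ⟨M, hM, scale_bound (by ring) fun x hx => (h x hx).2⟩
  exact ⟨h1, h2, h2.add (h1.const_mul l), (h1.const_mul (l + 1)).sub h2⟩

/-- The coefficient functions of the first solution. -/
theorem IsFirstChain.isReg {l : ℝ} (hl : -(1 / 2) < l) {Q u u' : ℝ → ℂ} {f f' : ℕ → ℝ → ℂ}
    (h : IsFirstChain l Q u u' f f') {p : ℝ≥0∞} (hp : 1 ≤ p)
    (hQ : MemLp (fun x => x * Q x) p unitMeasure)
    (hu : Tendsto (scale (-(l + 1)) u) (𝓝[>] 0) (𝓝 1)) (k : ℕ) :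
    IsReg p (scale (-(l + 1 + 2 * k)) (f k)) ∧ IsReg p (scale (1 - (l + 1 + 2 * k)) (f' k)) ∧
      Tendsto (fun x => scale (1 - (l + 1 + 2 * k)) (f' k) x -
        ((l + 1 + 2 * k : ℝ) : ℂ) * scale (-(l + 1 + 2 * k)) (f k) x) (𝓝[>] 0) (𝓝 0) := by
  induction k with
  | zero =>
    simp only [Nat.cast_zero, mul_zero, add_zero, h.init]
    have := h.chain.zero
    rw [h.init.1, h.init.2] at this
    exact this.isReg_first hl hp hQ hu
  | succ k ih =>
    obtain ⟨M, hM, hb⟩ := h.bound (k + 1)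
    set m : ℝ := l + 1 + 2 * (k + 1 : ℕ) with hm
    have hm' : m = l + 1 + 2 * k + 2 := by rw [hm]; push_cast; ring
    have hk : (0 : ℝ) ≤ k := k.cast_nonneg
    have e1 : 2 - m = -(l + 1 + 2 * k) := by rw [hm']; ring
    obtain ⟨b1, b2, b3, b4⟩ := bddBy_upper (l := l) (w := fun _ => 1) (m := m) hM (f := f (k + 1))
      (f' := f' (k + 1)) fun x hx => by
        refine ⟨by simpa using (hb x hx).1, ?_⟩
        have := (hb x hx).2
        rwa [mul_one, show m - 1 = l + 2 * (k + 1 : ℕ) by rw [hm]; ring]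
    have hS := ih.1
    rw [← e1] at hS
    obtain ⟨N, hN, hNb⟩ := b1
    obtain ⟨c, hc⟩ := hS.exists_tendsto hp
    obtain ⟨D, hD, hDb⟩ := exists_bound_of_tendsto hS.continuousOn hc 1
    have bS : BddBy (fun _ => 1) (scale (2 - m) (f k)) := ⟨D, hD.le, by simpa using hDb⟩
    -- The exponents are -2(k+1) and -(2l+1) - 2(k+1). Both are negative, so no extra restriction on
    -- p appears.
    obtain ⟨h1, h2, h3, -⟩ := (h.chain.succ k).isReg hl m hp hS
      (memLp_mul_of_bound hQ (continuousOn_scale _ (h.chain.continuousOn _)) (C := N)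
        (by simpa using hNb))
      (b3.eulerCase isWeight_one (by rw [hm']; linarith)
        (by simpa using bS.const_mul (-1)) p)
      (b4.eulerCase isWeight_one (by rw [hm']; linarith) bS p)
    exact ⟨h1, h2, h3⟩

/-- The coefficients of the second solution below the logarithmic threshold. -/
theorem IsSecondChain.isReg {l : ℝ} (hl : -(1 / 2) < l) {Q v v' : ℝ → ℂ} {f f' : ℕ → ℝ → ℂ}
    (h : IsSecondChain l Q v v' f f') {p r : ℝ≥0∞} (hp : p ∈ expSet l) (hr : 1 ≤ r) (hrp : r ≤ p)
    (hQ : MemLp (fun x => x * Q x) p unitMeasure) {c : ℂ}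
    (hv : Tendsto (scale l v) (𝓝[>] 0) (𝓝 c)) (k : ℕ) (hk : ¬ IsHalfInt l ∨ k < nl l)
    (hcond : ∀ j : ℕ, j ≤ k → 0 < 2 * l + 1 - 2 * j → 1 - r.toReal⁻¹ < 2 * l + 1 - 2 * j) :
    IsReg r (scale (-(-l + 2 * k)) (f k)) ∧ IsReg r (scale (1 - (-l + 2 * k)) (f' k)) ∧
      Tendsto (fun x => scale (1 - (-l + 2 * k)) (f' k) x -
        ((-l + 2 * k : ℝ) : ℂ) * scale (-(-l + 2 * k)) (f k) x) (𝓝[>] 0) (𝓝 0) ∧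
      Tendsto (scale (-(-l + 2 * k)) (f k)) (𝓝[>] 0)
        (𝓝 (c * ∏ j ∈ Finset.range k, (((2 * (j + 1) * (2 * l + 1 - 2 * (j + 1)) : ℝ) : ℂ))⁻¹)) := by
  have hQr : MemLp (fun x => x * Q x) r unitMeasure := hQ.mono_exponent hrp
  induction k with
  | zero =>
    simp only [Nat.cast_zero, mul_zero, add_zero, neg_neg, Finset.range_zero, Finset.prod_empty,
      mul_one, sub_neg_eq_add, h.init]
    have := h.chain.zero
    rw [h.init.1, h.init.2] at this
    obtain ⟨h1, h2, h3⟩ := this.isReg_second hl ⟨hr, fun hl0 => hrp.trans_lt (hp.2 hl0)⟩ hQr hv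
    refine ⟨h1, h2, h3.congr fun x => ?_, hv⟩
    push_cast; ring
  | succ k ih =>
    have hk' : ¬ IsHalfInt l ∨ k < nl l := hk.imp_right fun h => (Nat.lt_succ_self k).trans h
    obtain ⟨i1, -, -, i4⟩ := ih hk' fun j hj => hcond j (hj.trans k.le_succ)
    obtain ⟨M, hM, hb⟩ := h.bound (k + 1)
    have hw1 : logWeight l (k + 1) = fun _ => 1 := by
      ext x
      rw [logWeight, if_neg]
      rintro ⟨h1, h2⟩
      exact hk.elim (fun h => h h1) fun h => absurd h2 (not_le.2 h)
    rw [hw1] at hb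
    set m : ℝ := -l + 2 * (k + 1 : ℕ) with hm
    have hm' : m = -l + 2 * k + 2 := by rw [hm]; push_cast; ring
    have hk0 : (0 : ℝ) ≤ k := k.cast_nonneg
    have e1 : 2 - m = -(-l + 2 * k) := by rw [hm']; ring
    obtain ⟨b1, b2, b3, b4⟩ := bddBy_upper (l := l) (w := fun _ => 1) (m := m) hM (f := f (k + 1))
      (f' := f' (k + 1)) fun x hx => by
        refine ⟨(hb x hx).1, ?_⟩
        have := (hb x hx).2
        rwa [show m - 1 = -l - 1 + 2 * (k + 1 : ℕ) by rw [hm]; ring]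
    rw [← e1] at i1 i4
    obtain ⟨N, hN, hNb⟩ := b1
    obtain ⟨D, hD, hDb⟩ := exists_bound_of_tendsto i1.continuousOn i4 1
    have bS : BddBy (fun _ => 1) (scale (2 - m) (f k)) := ⟨D, hD.le, by simpa using hDb⟩
    -- The upper exponent 2l+1 - 2(k+1) vanishes only at k+1 = l + 1/2, the resonance excluded by
    -- `hk`.
    have hσ0 : l + 1 - m ≠ 0 := by
      intro h0
      have hkl : l + 1 / 2 = ((k + 1 : ℕ) : ℝ) := by push_cast; rw [hm'] at h0; linarith
      have hh : IsHalfInt l := ⟨k + 1, hkl⟩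
      have h1 := hh.eq_nl
      rw [hkl] at h1
      have h2 : k + 1 = nl l := by exact_mod_cast h1
      exact hk.elim (fun h => h hh) fun h => absurd h2 h.ne
    have hcaseu : EulerCase (l + 1 - m) r (upper l m (f (k + 1)) (f' (k + 1)))
        (fun x => -scale (2 - m) (f k) x) := by
      rcases hσ0.lt_or_gt with h0 | h0
      · exact b3.eulerCase isWeight_one h0 (by simpa using bS.const_mul (-1)) r
      · refine Or.inr (Or.inl ?_)
        have h2 := hcond (k + 1) le_rfl (by push_cast; rw [hm'] at h0; linarith)
        push_cast at h2
        rw [hm']; linarith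
    obtain ⟨h1, h2, h3, h4, h5⟩ := (h.chain.succ k).isReg hl m hr i1
      (memLp_mul_of_bound hQr (continuousOn_scale _ (h.chain.continuousOn _)) (C := N)
        (by simpa using hNb)) hcaseu
      (b4.eulerCase isWeight_one (by rw [hm']; linarith) bS r)
    refine ⟨h1, h2, h3, ?_⟩
    have hl0 : (2 * l + 1 : ℂ) ≠ 0 := by
      have : (2 * l + 1 : ℝ) ≠ 0 := by linarith
      exact_mod_cast this
    have hσ1 : ((l + 1 - m : ℝ) : ℂ) ≠ 0 := by exact_mod_cast hσ0
    have hσ2 : ((-l - m : ℝ) : ℂ) ≠ 0 := by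
      have : -l - m ≠ 0 := by rw [hm']; linarith
      exact_mod_cast this
    -- Since σ y + S tends to 0 in both equations, the components converge to s/σ₁ and -s/σ₂, where
    -- s is the previous limit and σ₁, σ₂ are the upper and lower exponents. As σ₁ - σ₂ = 2l+1,
    -- recombination multiplies s by -1/(σ₁σ₂) = 1/(2(k+1)(2l+1-2(k+1))).
    have hα := (h4.add i4).const_mul (((l + 1 - m : ℝ) : ℂ)⁻¹)
    have hβ := (h5.sub i4).const_mul (((-l - m : ℝ) : ℂ)⁻¹)
    have hA := (hα.add hβ).const_mul ((2 * l + 1 : ℂ)⁻¹)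
    set s := c * ∏ j ∈ Finset.range k, (((2 * (j + 1) * (2 * l + 1 - 2 * (j + 1)) : ℝ) : ℂ))⁻¹ with hs
    have e2 : c * ∏ j ∈ Finset.range (k + 1),
        (((2 * (j + 1) * (2 * l + 1 - 2 * (j + 1)) : ℝ) : ℂ))⁻¹ =
        (2 * l + 1 : ℂ)⁻¹ * (((l + 1 - m : ℝ) : ℂ)⁻¹ * (0 + s) + ((-l - m : ℝ) : ℂ)⁻¹ * (0 - s)) := by
      rw [Finset.prod_range_succ, ← mul_assoc, ← hs]
      have e3 : ((2 * (k + 1) * (2 * l + 1 - 2 * (k + 1)) : ℝ) : ℂ) =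
          -(((-l - m : ℝ) : ℂ) * ((l + 1 - m : ℝ) : ℂ)) := by
        rw [hm']; push_cast; ring
      have e4 : (2 * l + 1 : ℂ) = ((l + 1 - m : ℝ) : ℂ) - ((-l - m : ℝ) : ℂ) := by push_cast; ring
      rw [e3]
      rw [e4] at hl0 ⊢
      field_simp
      ring
    rw [e2]
    refine hA.congr fun x => ?_
    rw [sub_add_cancel, add_sub_cancel_right, inv_mul_cancel_left₀ hσ1, inv_mul_cancel_left₀ hσ2,
      upper_add_lower, inv_mul_cancel_left₀ hl0]

/-! ### The constants C^θ and the admissible exponents -/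

theorem thetaConst_zero (l : ℝ) : thetaConst l 0 = 1 := by
  simp [thetaConst, poch]

/-- Both defining formulas obey the recursion satisfied by the limits of the coefficients. At the
resonant index both sides are 0 by the convention 0⁻¹ = 0, so that no restriction on k is needed. -/
theorem thetaConst_succ (l : ℝ) (k : ℕ) :
    thetaConst l (k + 1) = thetaConst l k * (4 * (l + 1 / 2 - (k + 1)))⁻¹ := by
  by_cases h : IsHalfInt l
  · rw [thetaConst, thetaConst, if_pos h, if_pos h, poch, poch, ascPochhammer_succ_left]
    simp only [Polynomial.eval_mul, Polynomial.eval_X, Polynomial.eval_comp, Polynomial.eval_add,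
      Polynomial.eval_one]
    rw [show l - ((k + 1 : ℕ) : ℝ) + 1 / 2 + 1 = l - k + 1 / 2 by push_cast; ring,
      show l - ((k + 1 : ℕ) : ℝ) + 1 / 2 = l + 1 / 2 - (k + 1) by push_cast; ring, pow_succ]
    simp only [one_div, mul_inv]
    ring
  · rw [thetaConst, thetaConst, if_neg h, if_neg h, poch, poch, ascPochhammer_succ_eval,
      show -l + 1 / 2 + (k : ℝ) = -(l + 1 / 2 - (k + 1)) by ring, pow_succ, pow_succ]
    simp only [div_eq_mul_inv, mul_inv, inv_neg]
    ring

theorem thetaConst_eq_prod (l : ℝ) (k : ℕ) : (thetaConst l k : ℝ) =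
    k.factorial * ∏ j ∈ Finset.range k, (2 * ((j : ℝ) + 1) * (2 * l + 1 - 2 * (j + 1)))⁻¹ := by
  induction k with
  | zero => simp [thetaConst_zero]
  | succ k ih =>
    rw [thetaConst_succ, ih, Finset.prod_range_succ, Nat.factorial_succ]
    have : (4 * (l + 1 / 2 - ((k : ℝ) + 1))) = 2 * (2 * l + 1 - 2 * ((k : ℝ) + 1)) := by ring
    rw [this]
    simp only [mul_inv]
    push_cast
    have hk : ((k : ℝ) + 1) ≠ 0 := by positivity
    field_simp

/-- Only two indices constrain r. At j = 0 the bound is I_l; for 0 < j < n_l the exponent is at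
least 2; at j = n_l ≥ 1 it equals 1 - 2ε_l, which for ε_l ≥ 0 gives r < 1/(2ε_l). The restriction
passes to all k ≥ n_l, since later coefficients are built from that one. -/
theorem coeffExpSet_inv {l : ℝ} (hl : -(1 / 2) < l) {k : ℕ} {r : ℝ≥0∞} (hr : r ∈ coeffExpSet l k)
    (j : ℕ) (hj : j ≤ k) (h0 : 0 < 2 * l + 1 - 2 * (j : ℝ)) :
    1 - r.toReal⁻¹ < 2 * l + 1 - 2 * j := by
  rcases Nat.eq_zero_or_pos j with rfl | hj0
  · have := expSet_inv hr.1
    simpa using this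
  have hn1 := nl_le hl
  have hn2 := lt_nl l
  have hr0 := zero_le_inv_toReal r
  have hjn : j ≤ nl l := by
    have : (j : ℝ) < nl l + 1 := by linarith
    exact Nat.lt_succ_iff.1 (by exact_mod_cast this)
  rcases hjn.lt_or_eq with h | h
  · have : (j : ℝ) + 1 ≤ nl l := by exact_mod_cast h
    linarith
  · subst h
    rcases lt_or_ge (epsl l) 0 with he | he
    · rw [epsl] at he; linarith
    · have := lt_inv_toReal_of_lt hr.1.1 (s := 2 * epsl l) (by linarith) (hr.2 hj hj0 he)
      rw [epsl] at this
      linarith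

theorem half_lt_inv {l : ℝ} (hl : -(1 / 2) < l) {k : ℕ} (hk : k < nl l) {r : ℝ≥0∞}
    (j : ℕ) (hj : j ≤ k) : 1 - r.toReal⁻¹ < 2 * l + 1 - 2 * j := by
  have hn1 := nl_le hl
  have hr0 := zero_le_inv_toReal r
  have : (j : ℝ) + 1 ≤ nl l := by exact_mod_cast lt_of_le_of_lt hj hk
  linarith

/-! ### The logarithmic coefficients for p > 1 -/

theorem BddBy.memLp {w : ℝ → ℝ} (hw : IsWeight w) {f : ℝ → ℂ} (hf : BddBy w f)
    (hc : ContinuousOn f (Ioi 0)) {s : ℝ≥0∞} (hs : 1 ≤ s) (hst : s ≠ ⊤) : MemLp f s unitMeasure := by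
  have hs0 : 0 < s.toReal := ENNReal.toReal_pos (zero_lt_one.trans_le hs).ne' hst
  have hi : 0 < s.toReal⁻¹ := inv_pos.2 hs0
  obtain ⟨C, hC, hwC⟩ := hw.le_rpow (δ := s.toReal⁻¹ / 2) (by linarith)
  obtain ⟨M, hM, hb⟩ := hf
  refine MemLp.of_le_mul (c := M * C) (memLp_rpow (s := -(s.toReal⁻¹ / 2)) hs (by linarith))
    hc.aestronglyMeasurable_unit ?_
  filter_upwards [ae_unitMeasure] with x hx
  have hx' : x ∈ Ioc (0 : ℝ) 1 := ⟨hx.1, hx.2.le⟩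
  rw [norm_rpow_ofReal hx.1, mul_assoc]
  exact (hb x hx').trans (mul_le_mul_of_nonneg_left (hwC x hx') hM)

/-- A function of at most logarithmic growth maps `L^p(0, 1)` to `L^r(0, 1)` for `r < p`. -/
theorem memLp_mul_of_bddBy {w : ℝ → ℝ} (hw : IsWeight w) {h f : ℝ → ℂ} (hf : BddBy w f)
    (hc : ContinuousOn f (Ioi 0)) {p r : ℝ≥0∞} (hr : 1 ≤ r) (hrp : r < p)
    (hh : MemLp h p unitMeasure) : MemLp (fun x => h x * f x) r unitMeasure := by
  -- Hölder with 1/s = 1/r - 1/p. The companion exponent s is finite because r < p, and a slowly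
  -- growing function lies in every L^s with s finite; this is the origin of the loss from p to r.
  have h1 : p⁻¹ < r⁻¹ := ENNReal.inv_lt_inv.2 hrp
  have h2 : r⁻¹ - p⁻¹ ≠ 0 := (tsub_pos_of_lt h1).ne'
  have h3 : r⁻¹ - p⁻¹ ≤ 1 := tsub_le_self.trans (ENNReal.inv_le_one.2 hr)
  have : ENNReal.HolderTriple p (r⁻¹ - p⁻¹)⁻¹ r := by
    refine ⟨?_⟩
    rw [inv_inv, add_tsub_cancel_of_le h1.le]
  have := hf.memLp hw hc (s := (r⁻¹ - p⁻¹)⁻¹) (ENNReal.one_le_inv.2 h3) (ENNReal.inv_ne_top.2 h2)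
  exact MemLp.mul' this hh

theorem isPrim_sub_log {y g : ℝ → ℂ} (h : IsPrim y g) (P : ℂ) :
    IsPrim (fun x => y x - P * Real.log x) (fun x => g x - P * ((x⁻¹ : ℝ) : ℂ)) :=
  h.sub (IsPrim.log.const_mul P)

/-- Solutions of the Euler equation with a logarithmic inhomogeneity. -/
theorem euler_log_regularity {σ : ℝ} (hσ : σ < 0) {r : ℝ≥0∞} (hr : 1 ≤ r) {y S f : ℝ → ℂ} {P d : ℂ}
    (hP : σ * P = -d)
    (hy : IsPrim y (fun x => (σ * y x + (S x + d * Real.log x)) / x + f x))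
    (hyb : BddBy (fun x => 1 - Real.log x) y) (hS : IsReg r S) (hf : MemLp f r unitMeasure) :
    IsReg r (fun x => y x - P * Real.log x) ∧
      Tendsto (fun x => σ * y x + (S x + d * Real.log x)) (𝓝[>] 0) (𝓝 P) := by
  -- The relation σP = -d makes the logarithms cancel, and differentiating P log x merely adds the
  -- constant -P to the source.
  have hy2 : IsPrim (fun x => y x - P * Real.log x)
      (fun x => (σ * (y x - P * Real.log x) + (S x - P)) / x + f x) := by
    refine (isPrim_sub_log hy P).congr (fun _ _ => rfl) fun x hx => ?_
    have hxc : (x : ℂ) ≠ 0 := by exact_mod_cast hx.ne'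
    push_cast
    field_simp
    linear_combination (-(Real.log x : ℂ)) * hP
  have hS2 : IsReg r (fun x => S x - P) := hS.sub (IsReg.const P)
  obtain ⟨c, hc⟩ := hS2.exists_tendsto hr
  obtain ⟨D, hD, hDb⟩ := exists_bound_of_tendsto hS2.continuousOn hc 1
  have bS : BddBy (fun x => 1 - Real.log x) (fun x => S x - P) :=
    ⟨D, hD.le, fun x hx => (hDb x hx).trans (le_mul_of_one_le_right hD.le (isWeight_log.one_le x hx))⟩
  obtain ⟨h1, h2⟩ := euler_regularity hr hy2 hS2 hf
    ((hyb.sub (BddBy.log.const_mul P)).eulerCase isWeight_log hσ bS r)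
  refine ⟨h1, ?_⟩
  have h3 := h2.add_const P
  rw [zero_add] at h3
  refine h3.congr fun x => ?_
  linear_combination (-(Real.log x : ℂ)) * hP

/-- Hardy's inequality for the difference quotient at `0`. -/
theorem IsReg.memLp_sub_div {p : ℝ≥0∞} (hp : 1 < p) {S : ℝ → ℂ} (hS : IsReg p S) {s : ℂ}
    (hs : Tendsto S (𝓝[>] 0) (𝓝 s)) : MemLp (fun x => (S x - s) / x) p unitMeasure := by
  obtain ⟨g, hg, hgp⟩ := id hS
  obtain ⟨c, hc, hrep⟩ := hg.exists_tendsto (hgp.integrable hp.le)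
  obtain rfl := tendsto_nhds_unique hc hs
  have hm : ContinuousOn (fun x : ℝ => (S x - c) / x) (Ioi 0) :=
    (hS.continuousOn.sub continuousOn_const).div Complex.continuous_ofReal.continuousOn fun x hx => by
      exact_mod_cast ne_of_gt (show (0 : ℝ) < x from hx)
  have hp1 : p.toReal⁻¹ < 1 := by
    rcases eq_or_ne p ⊤ with rfl | hpt
    · simp
    · refine inv_lt_one_of_one_lt₀ ?_
      rw [← ENNReal.toReal_one]; exact (ENNReal.toReal_lt_toReal ENNReal.one_ne_top hpt).2 hp
  refine memLp_of_lowerKernel_le hp.le (σ := 0) (by linarith) hgp hm.aestronglyMeasurable_unit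
    fun x hx => ?_
  rw [hrep x ⟨hx.1, hx.2.le⟩, add_sub_cancel_left, div_eq_inv_mul,
    ← intervalIntegral.integral_const_mul, intervalIntegral.integral_of_le hx.1.le]
  refine (enorm_integral_le_lintegral_enorm _).trans ?_
  rw [← lintegral_indicator measurableSet_Ioc, ← lintegral_indicator measurableSet_Ioo,
    ← lintegral_congr_ae (f := (Ioo 0 x).indicator _)
    (indicator_ae_eq_of_ae_eq_set Ioo_ae_eq_Ioc)]
  refine lintegral_mono fun t => ?_
  by_cases ht : t ∈ Ioo 0 x
  · rw [indicator_of_mem ht, indicator_of_mem (show t ∈ Ioo (0 : ℝ) 1 from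
      ⟨ht.1, ht.2.trans hx.2⟩), lowerKernel, if_pos ht.2, enorm_mul]
    gcongr
    rw [zero_sub, neg_zero, Real.rpow_zero, mul_one, Real.rpow_neg_one, ← ofReal_norm, norm_inv,
      Complex.norm_real, Real.norm_of_nonneg hx.1.le]
  · rw [indicator_of_notMem ht]; exact zero_le

/-- The resonant equation, with σ = 0: splitting S/x into s/x and (S - s)/x gives s log x plus a
remainder that Hardy's inequality controls. That inequality fails for L¹, hence the assumption p >
1. -/
theorem primitive_log_regularity {p r : ℝ≥0∞} (hp : 1 < p) (hrp : r ≤ p) {y S f : ℝ → ℂ} {s : ℂ}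
    (hy : IsPrim y (fun x => S x / x + f x)) (hS : IsReg p S) (hs : Tendsto S (𝓝[>] 0) (𝓝 s))
    (hf : MemLp f r unitMeasure) : IsReg r (fun x => y x - s * Real.log x) := by
  refine ⟨fun x => (S x - s) / x + f x, (isPrim_sub_log hy s).congr (fun _ _ => rfl) fun x hx => ?_,
    ((hS.memLp_sub_div hp hs).mono_exponent hrp).add hf⟩
  have hxc : (x : ℂ) ≠ 0 := by exact_mod_cast hx.ne'
  push_cast
  field_simp
  ring

/-- A solution with a logarithmic term at scale `x^m`, from the expansions of its components. -/
theorem log_isReg_of_components {l : ℝ} (hl : -(1 / 2) < l) (g f f' : ℝ → ℂ) (m : ℝ)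
    {r : ℝ≥0∞} {P R D : ℂ} (hPR : ((l + 1 - m : ℝ) : ℂ) * P + ((-l - m : ℝ) : ℂ) * R = 0)
    (hD : (2 * l + 1) * D = P + R)
    (hu : IsReg r (fun x => upper l m f f' x - P * Real.log x))
    (hu' : Tendsto (fun x => ((l + 1 - m : ℝ) : ℂ) * upper l m f f' x + -scale (2 - m) g x)
      (𝓝[>] 0) (𝓝 P))
    (hv : IsReg r (fun x => lower l m f f' x - R * Real.log x))
    (hv' : Tendsto (fun x => ((-l - m : ℝ) : ℂ) * lower l m f f' x + scale (2 - m) g x)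
      (𝓝[>] 0) (𝓝 R)) :
    IsReg r (fun x => scale (-m) f x - D * Real.log x) ∧
      IsReg r (fun x => scale (1 - m) f' x - m * D * Real.log x) ∧
      Tendsto (fun x => scale (1 - m) f' x - m * scale (-m) f x) (𝓝[>] 0) (𝓝 D) := by
  have hl0 : (2 * l + 1 : ℂ) ≠ 0 := by
    have : (2 * l + 1 : ℝ) ≠ 0 := by linarith
    exact_mod_cast this
  refine ⟨?_, ?_, ?_⟩
  · refine IsReg.of_const_mul hl0 ((hu.add hv).congr fun x _ => ?_)
    have := upper_add_lower l m f f' x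
    linear_combination (-1 : ℂ) * this - (Real.log x : ℂ) * hD
  · refine IsReg.of_const_mul hl0 (((hu.const_mul (l + 1)).sub (hv.const_mul l)).congr
      fun x _ => ?_)
    have := scale_deriv_eq l m f f' x
    push_cast at hPR
    linear_combination this - (m * Real.log x : ℂ) * hD + (Real.log x : ℂ) * hPR
  · have := (hu'.add hv').const_mul ((2 * l + 1 : ℂ)⁻¹)
    rw [← hD, inv_mul_cancel_left₀ hl0] at this
    refine this.congr fun x => ?_
    rw [inv_mul_eq_iff_eq_mul₀ hl0]
    simp only [upper, lower]
    push_cast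
    ring

theorem thetaLogConst_succ {l : ℝ} {k : ℕ} (hk : nl l ≤ k) (h : IsHalfInt l) :
    thetaLogConst l (k + 1) = thetaLogConst l k * (4 * ((nl l : ℝ) - (k + 1)))⁻¹ := by
  obtain ⟨j, rfl⟩ := Nat.exists_eq_add_of_le hk
  have hn := h.eq_nl
  have hn0 : (0 : ℝ) ≤ nl l := (nl l).cast_nonneg
  have h1 : (((nl l + (j + 1)).choose (nl l) : ℕ) : ℝ) * (j + 1) =
      (nl l + j).choose (nl l) * (nl l + j + 1) := by
    have e1 := Nat.add_one_mul_choose_eq (nl l + j) j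
    have e2 : (nl l + (j + 1)).choose (nl l) = (nl l + j + 1).choose (j + 1) :=
      Nat.choose_symm_of_eq_add (by ring)
    have e3 : (nl l + j).choose (nl l) = (nl l + j).choose j := Nat.choose_symm_of_eq_add (by ring)
    rw [e2, e3]
    have e4 : (((nl l + j + 1) * (nl l + j).choose j : ℕ) : ℝ) =
      ((nl l + j + 1).choose (j + 1) * (j + 1) : ℕ) := by exact_mod_cast e1
    push_cast at e4
    linarith
  have h2 : phiConst l (j + 1) = phiConst l j * (-(4 * ((nl l : ℝ) + j + 1)))⁻¹ := by
    rw [phiConst, phiConst, poch, poch, ascPochhammer_succ_eval,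
      show l + 3 / 2 + (j : ℝ) = nl l + j + 1 by linarith, pow_succ, pow_succ]
    simp only [div_eq_mul_inv, mul_inv, inv_neg]
    ring
  have hj : ((j : ℝ) + 1) ≠ 0 := by positivity
  have hnj : (nl l + j + 1 : ℝ) ≠ 0 := by positivity
  rw [thetaLogConst, thetaLogConst, add_assoc, Nat.add_sub_cancel_left, Nat.add_sub_cancel_left, h2]
  rw [div_mul_eq_mul_div]
  congr 1
  push_cast
  rw [show (nl l - (nl l + (j : ℝ) + 1)) = -(j + 1) by ring]
  field_simp
  linear_combination phiConst l j * h1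

/-- The seed of the logarithmic constants: at k = n_l the factor 4^l Γ(l + 1/2) in the definition
becomes 2 · 4^(n_l - 1) (n_l - 1)!, which matches the last regular constant. -/
theorem thetaLogConst_nl {l : ℝ} {n : ℕ} (hn : nl l = n + 1) (h : IsHalfInt l) :
    thetaLogConst l (n + 1) = -(thetaConst l n / 2) := by
  have e1 := h.eq_nl
  rw [hn] at e1
  push_cast at e1
  have e2 : l = n + 1 / 2 := by linarith
  have e3 : (4 : ℝ) ^ l = 4 ^ n * 2 := by
    rw [e2, Real.rpow_add (by norm_num), Real.rpow_natCast]
    congr 1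
    rw [← Real.sqrt_eq_rpow, show (4 : ℝ) = 2 ^ 2 by norm_num]
    exact Real.sqrt_sq (by norm_num)
  have e4 : poch (l - n + 1 / 2) n = n.factorial := by
    rw [poch, show l - n + 1 / 2 = ((1 : ℕ) : ℝ) by push_cast; linarith]
    rw [ascPochhammer_nat_eq_natCast_ascFactorial, Nat.one_ascFactorial]
  rw [thetaLogConst, thetaConst, if_pos h, hn, Nat.choose_self, Nat.sub_self, e3, e1,
    Real.Gamma_nat_eq_factorial, e4]
  simp only [phiConst, poch, ascPochhammer_zero, Polynomial.eval_one, pow_zero]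
  field_simp
  norm_num

/-- The coefficient of the logarithm in the `k`-th coefficient function. -/
def logCoeff (l : ℝ) (k : ℕ) : ℂ :=
  ((1 / (2 * l + 1) : ℝ) : ℂ) * ((thetaLogConst l k / k.factorial : ℝ) : ℂ)

/-- Past the resonance the coefficient of the logarithm is multiplied by -1/(σ₁σ₂), with σ₁, σ₂ the
two Euler exponents, exactly as the limits are before it. -/
theorem logCoeff_succ {l : ℝ} (hl : -(1 / 2) < l) {k : ℕ} (hk : nl l ≤ k) (h : IsHalfInt l) :
    (((l + 1 - (-l + 2 * (k + 1 : ℕ)) : ℝ) : ℂ) * ((-l - (-l + 2 * (k + 1 : ℕ)) : ℝ) : ℂ)) *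
      logCoeff l (k + 1) = -logCoeff l k := by
  rw [logCoeff, logCoeff, thetaLogConst_succ hk h, Nat.factorial_succ]
  have hn := h.eq_nl
  have hkn : (nl l : ℝ) ≤ k := by exact_mod_cast hk
  have h1 : (nl l - ((k : ℝ) + 1)) ≠ 0 := by
    have : nl l - ((k : ℝ) + 1) < 0 := by linarith
    exact this.ne
  have e1 : l + 1 - (-l + 2 * ((k + 1 : ℕ) : ℝ)) = 2 * (nl l - (k + 1)) := by push_cast; linarith
  have e2 : -l - (-l + 2 * ((k + 1 : ℕ) : ℝ)) = -(2 * (k + 1)) := by push_cast; ring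
  rw [e1, e2]
  norm_cast
  push_cast
  have hk1 : ((k : ℝ) + 1) ≠ 0 := by positivity
  have hf : (k.factorial : ℝ) ≠ 0 := by positivity
  have h2 : (2 * l + 1) ≠ 0 := by linarith
  field_simp
  ring

/-- At the resonance the logarithm appears only in the upper component, with coefficient minus the
limit of the preceding coefficient function. -/
theorem logCoeff_nl {l : ℝ} {n : ℕ} (hn : nl l = n + 1) (h : IsHalfInt l) :
    (2 * l + 1) * logCoeff l (n + 1) = -(((1 / (2 * l + 1) : ℝ) : ℂ) *
      ∏ j ∈ Finset.range n, (((2 * (j + 1) * (2 * l + 1 - 2 * (j + 1)) : ℝ) : ℂ))⁻¹) := by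
  have e0 := thetaConst_eq_prod l n
  have e1 := h.eq_nl
  rw [hn] at e1
  have hl1 : 2 * l + 1 = 2 * (n + 1) := by push_cast at e1; linarith
  have hp : ∏ j ∈ Finset.range n, (((2 * (j + 1) * (2 * l + 1 - 2 * (j + 1)) : ℝ) : ℂ))⁻¹ =
      ((thetaConst l n / n.factorial : ℝ) : ℂ) := by
    rw [e0, mul_div_cancel_left₀ _ (by positivity)]
    push_cast
    rfl
  rw [hp, logCoeff, thetaLogConst_nl hn h, Nat.factorial_succ,
    show (2 * (l : ℂ) + 1) = ((2 * (n + 1) : ℝ) : ℂ) by rw [← hl1]; push_cast; ring, hl1]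
  norm_cast
  push_cast
  have hk1 : ((n : ℝ) + 1) ≠ 0 := by positivity
  have hf : (n.factorial : ℝ) ≠ 0 := by positivity
  field_simp

section Log

variable {l : ℝ} {Q v v' : ℝ → ℂ} {f f' : ℕ → ℝ → ℂ}

theorem IsSecondChain.bddBy_log (h : IsSecondChain l Q v v' f f') (hh : IsHalfInt l) {k : ℕ}
    (hk : nl l ≤ k) :
    BddBy (fun x => 1 - Real.log x) (scale (-(-l + 2 * k)) (f k)) ∧
      BddBy (fun x => 1 - Real.log x) (scale (1 - (-l + 2 * k)) (f' k)) ∧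
      BddBy (fun x => 1 - Real.log x) (upper l (-l + 2 * k) (f k) (f' k)) ∧
      BddBy (fun x => 1 - Real.log x) (lower l (-l + 2 * k) (f k) (f' k)) := by
  obtain ⟨M, hM, hb⟩ := h.bound k
  refine bddBy_upper (l := l) hM fun x hx => ?_
  have := hb x hx
  simp only [logWeight, if_pos (And.intro hh hk)] at this
  rwa [show -l + 2 * (k : ℝ) - 1 = -l - 1 + 2 * k by ring]

/-- The coefficients of the second solution above the logarithmic threshold. -/
theorem IsSecondChain.log_isReg (hl : -(1 / 2) < l) (hh : IsHalfInt l)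
    (h : IsSecondChain l Q v v' f f') {p r : ℝ≥0∞} (hp1 : 1 < p) (hp : p ∈ expSet l) (hr : 1 ≤ r)
    (hrp : r < p) (hQ : MemLp (fun x => x * Q x) p unitMeasure)
    (hv : Tendsto (scale l v) (𝓝[>] 0) (𝓝 ((1 / (2 * l + 1) : ℝ) : ℂ))) (k : ℕ) (hk : nl l ≤ k) :
    IsReg r (fun x => scale (-(-l + 2 * k)) (f k) x - logCoeff l k * Real.log x) ∧
      IsReg r (fun x => scale (1 - (-l + 2 * k)) (f' k) x -
        ((-l + 2 * k : ℝ) : ℂ) * logCoeff l k * Real.log x) ∧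
      Tendsto (fun x => scale (1 - (-l + 2 * k)) (f' k) x -
        ((-l + 2 * k : ℝ) : ℂ) * scale (-(-l + 2 * k)) (f k) x) (𝓝[>] 0) (𝓝 (logCoeff l k)) := by
  have hn := hh.eq_nl
  have hl0 : (2 * l + 1 : ℂ) ≠ 0 := by
    have : (2 * l + 1 : ℝ) ≠ 0 := by linarith
    exact_mod_cast this
  induction k, hk using Nat.le_induction with
  | base =>
    obtain ⟨n, hnn⟩ := Nat.exists_eq_succ_of_ne_zero (Nat.one_le_iff_ne_zero.1 (hh.one_le_nl hl))
    rw [Nat.succ_eq_add_one] at hnn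
    obtain ⟨b1, b2, b3, b4⟩ := h.bddBy_log hh le_rfl
    obtain ⟨i1, -, -, i4⟩ := h.isReg hl hp hp.1 le_rfl hQ hv n (Or.inr (by omega))
      fun j hj _ => half_lt_inv hl (by omega) j hj
    have hs := logCoeff_nl hnn hh
    rw [hnn] at hn b1 b2 b3 b4 ⊢
    set m : ℝ := -l + 2 * (n + 1 : ℕ) with hm
    have e1 : -(-l + 2 * (n : ℝ)) = 2 - m := by rw [hm]; push_cast; ring
    have e2 : l + 1 - m = 0 := by rw [hm]; linarith
    rw [e1] at i1 i4
    set s := ((1 / (2 * l + 1) : ℝ) : ℂ) *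
      ∏ j ∈ Finset.range n, (((2 * (j + 1) * (2 * l + 1 - 2 * (j + 1)) : ℝ) : ℂ))⁻¹ with hsdef
    have hc := continuousOn_scale (-m) (h.chain.continuousOn (n + 1))
    have hw := memLp_mul_of_bddBy isWeight_log b1 hc hr hrp hQ
    have hwn : MemLp (fun x => -((x * Q x) * scale (-m) (f (n + 1)) x)) r unitMeasure := hw.neg
    have hσ2 : -l - m < 0 := by rw [hm]; push_cast; linarith [(n.cast_nonneg : (0 : ℝ) ≤ n)]
    have hS1 : IsReg p (fun x => -scale (2 - m) (f n) x) :=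
      (i1.const_mul (-1)).congr fun _ _ => by ring
    -- The upper exponent vanishes here, so the equation integrates to -s log x plus a regular
    -- function. The lower exponent is still negative and produces no logarithm.
    have u1 := primitive_log_regularity hp1 hrp.le
      (((h.chain.succ n).isPrim_upper m).congr (fun _ _ => rfl) fun x _ => by
        rw [e2, Complex.ofReal_zero, zero_mul, zero_add]) hS1 i4.neg hw
    have u2 := euler_log_regularity (P := 0) (d := 0) hσ2 hr (by simp)
      (((h.chain.succ n).isPrim_lower m).congr (fun _ _ => rfl) fun x _ => by
        rw [zero_mul, add_zero]) b4 (i1.mono hrp.le) hwn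
    refine log_isReg_of_components hl (f n) (f (n + 1)) (f' (n + 1)) m (P := -s) (R := 0) ?_ ?_ u1 ?_ u2.1 ?_
    · rw [e2]; simp
    · rw [hs, add_zero]
    · simpa only [e2, Complex.ofReal_zero, zero_mul, zero_add] using i4.neg
    · simpa using u2.2
  | succ k hk ih =>
    have hrec := logCoeff_succ hl hk hh
    obtain ⟨b1, b2, b3, b4⟩ := h.bddBy_log hh (hk.trans k.le_succ)
    have i1 := ih.1
    have hkn : (nl l : ℝ) ≤ k := by exact_mod_cast hk
    set m : ℝ := -l + 2 * (k + 1 : ℕ) with hm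
    have hm' : m = -l + 2 * k + 2 := by rw [hm]; push_cast; ring
    have e1 : -(-l + 2 * (k : ℝ)) = 2 - m := by rw [hm']; ring
    rw [e1] at i1
    have hσ1 : l + 1 - m < 0 := by rw [hm']; linarith
    have hσ2 : -l - m < 0 := by rw [hm']; linarith
    have hσ1' : ((l + 1 - m : ℝ) : ℂ) ≠ 0 := by exact_mod_cast hσ1.ne
    have hσ2' : ((-l - m : ℝ) : ℂ) ≠ 0 := by exact_mod_cast hσ2.ne
    have hw := memLp_mul_of_bddBy isWeight_log b1
      (continuousOn_scale (-m) (h.chain.continuousOn (k + 1))) hr hrp hQ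
    have hwn : MemLp (fun x => -((x * Q x) * scale (-m) (f (k + 1)) x)) r unitMeasure := hw.neg
    set d := logCoeff l k with hd
    -- The sources contain ∓d log x. P and R are the coefficients of log x in the upper and lower
    -- components that cancel these terms in the two Euler equations.
    set P := ((l + 1 - m : ℝ) : ℂ)⁻¹ * d with hP
    set R := -(((-l - m : ℝ) : ℂ)⁻¹ * d) with hR
    have hPe : ((l + 1 - m : ℝ) : ℂ) * P = d := by rw [hP, mul_inv_cancel_left₀ hσ1']
    have hRe : ((-l - m : ℝ) : ℂ) * R = -d := by rw [hR, mul_neg, mul_inv_cancel_left₀ hσ2']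
    have i2 : IsReg r (fun x => -(scale (2 - m) (f k) x - d * Real.log x)) :=
      (i1.const_mul (-1)).congr fun _ _ => by ring
    have u1 := euler_log_regularity (P := P) (d := -d) hσ1 hr (by rw [hPe, neg_neg])
      (((h.chain.succ k).isPrim_upper m).congr (fun _ _ => rfl) fun x _ => by ring) b3 i2 hw
    have u2 := euler_log_regularity (P := R) (d := d) hσ2 hr hRe
      (((h.chain.succ k).isPrim_lower m).congr (fun _ _ => rfl) fun x _ => by ring) b4 i1 hwn
    refine log_isReg_of_components hl (f k) (f (k + 1)) (f' (k + 1)) m (P := P) (R := R) ?_ ?_ u1.1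
      (u1.2.congr fun x => by ring) u2.1 (u2.2.congr fun x => by ring)
    · rw [hPe, hRe, add_neg_cancel]
    · have e4 : (2 * l + 1 : ℂ) = ((l + 1 - m : ℝ) : ℂ) - ((-l - m : ℝ) : ℂ) := by push_cast; ring
      refine mul_left_cancel₀ (mul_ne_zero hσ1' hσ2') ?_
      rw [e4, hP, hR]
      field_simp
      linear_combination (((l + 1 - m : ℝ) : ℂ) - ((-l - m : ℝ) : ℂ)) * hrec

end Log

/-! ### The logarithmic coefficients for p = 1: leading asymptotics -/

/-- A positive function on `(0, ∞)` that is asymptotic to `-log x` at `0`. -/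
def logScale (x : ℝ) : ℝ := 1 + Real.log (1 + x) - Real.log x

theorem one_le_logScale {x : ℝ} (hx : 0 < x) : 1 ≤ logScale x := by
  have := Real.log_le_log hx (by linarith : x ≤ 1 + x)
  rw [logScale]; linarith

theorem logScale_pos {x : ℝ} (hx : 0 < x) : 0 < logScale x := one_pos.trans_le (one_le_logScale hx)

theorem logScale_ne {x : ℝ} (hx : 0 < x) : (logScale x : ℂ) ≠ 0 := by
  exact_mod_cast (logScale_pos hx).ne'

theorem le_logScale {x : ℝ} (hx : 0 < x) : 1 - Real.log x ≤ logScale x := by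
  have := Real.log_nonneg (by linarith : 1 ≤ 1 + x)
  rw [logScale]; linarith

theorem hasDerivAt_logScale {x : ℝ} (hx : 0 < x) :
    HasDerivAt logScale (-(x * (1 + x))⁻¹) x := by
  have h1 : HasDerivAt (fun x : ℝ => 1 + x) 1 x := (hasDerivAt_id x).const_add 1
  have h2 := ((h1.log (by positivity)).const_add 1).sub (Real.hasDerivAt_log hx.ne')
  refine h2.congr_deriv ?_
  have hx1 : 1 + x ≠ 0 := by positivity
  have hx0 := hx.ne'
  field_simp
  ring

theorem continuousOn_logScale : ContinuousOn (fun x => (logScale x : ℂ)) (Ioi 0) :=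
  Complex.continuous_ofReal.comp_continuousOn fun _ hx =>
    (hasDerivAt_logScale hx).continuousAt.continuousWithinAt

theorem continuousOn_div_logScale {f : ℝ → ℂ} (hf : ContinuousOn f (Ioi 0)) :
    ContinuousOn (fun x => f x / logScale x) (Ioi 0) :=
  hf.div continuousOn_logScale fun _ hx => logScale_ne hx

theorem logScale_antitone {x y : ℝ} (hx : 0 < x) (hxy : x ≤ y) : logScale y ≤ logScale x := by
  have hy : 0 < y := hx.trans_le hxy
  -- In the form 1 + log(1 + 1/z) the monotonicity is visible.
  have e : ∀ z : ℝ, 0 < z → logScale z = 1 + Real.log (1 + z⁻¹) := fun z hz => by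
    rw [logScale, add_sub_assoc, ← Real.log_div (by positivity) hz.ne']
    congr 2
    field_simp
    ring
  rw [e x hx, e y hy]
  have : y⁻¹ ≤ x⁻¹ := inv_anti₀ hx hxy
  have h3 : 0 < y⁻¹ := by positivity
  have := Real.log_le_log (by positivity : 0 < 1 + y⁻¹) (by linarith : 1 + y⁻¹ ≤ 1 + x⁻¹)
  linarith

theorem tendsto_logScale_div_log : Tendsto (fun x => (logScale x : ℂ) / ((Real.log x : ℝ) : ℂ))
    (𝓝[>] 0) (𝓝 (-1)) := by
  have h1 : Tendsto (fun x : ℝ => (Real.log x)⁻¹) (𝓝[>] 0) (𝓝 0) :=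
    Real.tendsto_log_nhdsGT_zero.inv_tendsto_atBot
  have h2 : Tendsto (fun x : ℝ => 1 + Real.log (1 + x)) (𝓝[>] 0) (𝓝 1) := by
    have hc : ContinuousAt (fun x : ℝ => 1 + Real.log (1 + x)) 0 :=
      continuousAt_const.add ((continuousAt_const.add continuousAt_id).log (by simp))
    have := hc.tendsto
    simp only [add_zero, Real.log_one] at this
    exact this.mono_left nhdsWithin_le_nhds
  have h3 := (h2.mul h1).sub_const 1
  rw [mul_zero, zero_sub] at h3
  have h4 := (Complex.continuous_ofReal.tendsto (-1)).comp h3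
  push_cast at h4
  refine h4.congr' ?_
  filter_upwards [Ioo_mem_nhdsGT one_pos] with x hx
  have hl : Real.log x ≠ 0 := (Real.log_neg hx.1 hx.2).ne
  rw [← Complex.ofReal_div]
  simp only [Function.comp, logScale]
  congr 1
  field_simp

theorem tendsto_inv_logScale : Tendsto (fun x => (logScale x : ℂ)⁻¹) (𝓝[>] 0) (𝓝 0) := by
  have h1 : Tendsto logScale (𝓝[>] 0) atTop := by
    have h2 : Tendsto (fun x : ℝ => 1 + -Real.log x) (𝓝[>] 0) atTop :=
      tendsto_atTop_add_const_left _ _ (tendsto_neg_atBot_atTop.comp Real.tendsto_log_nhdsGT_zero)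
    refine tendsto_atTop_mono' _ ?_ h2
    filter_upwards [self_mem_nhdsWithin] with x hx
    have := le_logScale (show (0 : ℝ) < x from hx)
    linarith
  have h3 := (Complex.continuous_ofReal.tendsto 0).comp h1.inv_tendsto_atTop
  rw [Complex.ofReal_zero] at h3
  exact h3.congr fun x => by simp

theorem BddBy.div_logScale {f : ℝ → ℂ} (hf : BddBy (fun x => 1 - Real.log x) f) :
    ∃ C, ∀ x ∈ Ioc (0 : ℝ) 1, ‖f x / logScale x‖ ≤ C := by
  obtain ⟨M, hM, hb⟩ := hf
  refine ⟨M, fun x hx => ?_⟩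
  rw [norm_div, Complex.norm_real, Real.norm_of_nonneg (logScale_pos hx.1).le,
    div_le_iff₀ (logScale_pos hx.1)]
  exact (hb x hx).trans (mul_le_mul_of_nonneg_left (le_logScale hx.1) hM)

theorem intervalIntegrable_of_unit {f : ℝ → ℝ} (hf : IntegrableOn f (Ioo 0 1)) {a b : ℝ} (ha : 0 ≤ a)
    (hb : b ≤ 1) (hab : a ≤ b) : IntervalIntegrable f volume a b := by
  have hi : IntervalIntegrable f volume 0 1 := by
    rwa [intervalIntegrable_iff_integrableOn_Ioo_of_le zero_le_one]
  refine hi.mono_set ?_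
  rw [uIcc_of_le hab, uIcc_of_le zero_le_one]
  exact Icc_subset_Icc ha hb

theorem tendsto_integral_norm {h : ℝ → ℂ} (hh : IntegrableOn h (Ioo 0 1)) :
    Tendsto (fun x => ∫ t in (0 : ℝ)..x, ‖h t‖) (𝓝[>] 0) (𝓝 0) := by
  have hi := intervalIntegrable_of_unit hh.norm le_rfl le_rfl zero_le_one
  have hc := intervalIntegral.continuousOn_primitive_interval' hi left_mem_uIcc 0 left_mem_uIcc
  rw [ContinuousWithinAt, intervalIntegral.integral_same] at hc
  refine hc.mono_left (nhdsWithin_le_iff.2 ?_)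
  rw [uIcc_of_le zero_le_one]
  exact mem_of_superset (Ioc_mem_nhdsGT one_pos) Ioc_subset_Icc_self

/-- Here the source e merely tends to 0, with no derivative to exploit. Integrating x^(-σ) E from 0,
a source of size η contributes at most η/(-σ), and h contributes at most its integral over (0, x).
-/
theorem euler_vanishing {σ : ℝ} (hσ : σ < 0) {E e h : ℝ → ℂ}
    (hE : IsPrim E (fun x => (σ * E x + e x) / x + h x)) (he : ContinuousOn e (Ioi 0))
    (he0 : Tendsto e (𝓝[>] 0) (𝓝 0)) (hh : IntegrableOn h (Ioo 0 1))
    (h0 : Tendsto (fun x : ℝ => ((x ^ (-σ) : ℝ) : ℂ) * E x) (𝓝[>] 0) (𝓝 0)) :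
    Tendsto E (𝓝[>] 0) (𝓝 0) := by
  have hD : IsPrim (fun x => ((x ^ (-σ) : ℝ) : ℂ) * E x)
      (fun x => ((x ^ (-σ - 1) : ℝ) : ℂ) * e x + ((x ^ (-σ) : ℝ) : ℂ) * h x) := by
    refine ((IsPrim.cpow_ofReal (-σ)).mul hE).congr (fun _ _ => rfl) fun x hx => ?_
    have hxc : (x : ℂ) ≠ 0 := by exact_mod_cast hx.ne'
    rw [Real.rpow_sub_one hx.ne']
    push_cast
    field_simp
    ring
  have h1 : MemLp (fun x : ℝ => ((x ^ (-σ - 1) : ℝ) : ℂ) * e x) 1 unitMeasure :=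
    memLp_mul_of_tendsto (memLp_rpow le_rfl (by simp; linarith)) he he0
  have h2 : MemLp (fun x : ℝ => h x * ((x ^ (-σ) : ℝ) : ℂ)) 1 unitMeasure :=
    memLp_mul_of_tendsto (memLp_one_iff_integrable.2 hh) (continuousOn_rpow_ofReal _)
      (tendsto_rpow_zero (by linarith))
  have hint : IntegrableOn (fun x : ℝ => ((x ^ (-σ - 1) : ℝ) : ℂ) * e x + ((x ^ (-σ) : ℝ) : ℂ) * h x)
      (Ioo 0 1) := by
    refine (memLp_one_iff_integrable.1 (h1.add h2)).congr (Eventually.of_forall fun x => ?_)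
    simp only [Pi.add_apply]; ring
  obtain ⟨c, hc, hrep⟩ := hD.exists_tendsto hint
  obtain rfl := tendsto_nhds_unique hc h0
  rw [Metric.tendsto_nhds]
  intro ε hε
  -- Chosen so that the source contributes at most ε/2.
  have hη : 0 < ε * -σ / 2 := by have := neg_pos.2 hσ; positivity
  obtain ⟨δ, hδ, hδe⟩ := mem_nhdsGT_iff_exists_Ioo_subset.1
    (he0.norm.eventually_lt_const (u := ε * -σ / 2) (by simpa using hη))
  have hδ0 : (0 : ℝ) < δ := hδ
  filter_upwards [Ioo_mem_nhdsGT one_pos, Ioo_mem_nhdsGT hδ0,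
    (tendsto_integral_norm hh).eventually_lt_const (half_pos hε)] with x hx hxδ hxi
  have hE' : E x = ((x ^ σ : ℝ) : ℂ) * (((x ^ (-σ) : ℝ) : ℂ) * E x) := by
    rw [← mul_assoc, rpow_ofReal_mul hx.1, add_neg_cancel, Real.rpow_zero]; simp
  have hxs := Real.rpow_pos_of_pos hx.1 σ
  have hi := intervalIntegrable_of_unit hh.norm le_rfl hx.2.le hx.1.le
  have hi2 : IntervalIntegrable (fun t : ℝ => (ε * -σ / 2) * t ^ (-σ - 1)) volume 0 x :=
    (intervalIntegral.intervalIntegrable_rpow' (by linarith)).const_mul _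
  have hb : ‖∫ t in (0 : ℝ)..x, (((t ^ (-σ - 1) : ℝ) : ℂ) * e t + ((t ^ (-σ) : ℝ) : ℂ) * h t)‖ ≤
      ∫ t in (0 : ℝ)..x, ((ε * -σ / 2) * t ^ (-σ - 1) + x ^ (-σ) * ‖h t‖) := by
    refine intervalIntegral.norm_integral_le_of_norm_le hx.1.le ?_ (hi2.add (hi.const_mul _))
    filter_upwards with t ht
    refine (norm_add_le _ _).trans (add_le_add ?_ ?_)
    · rw [norm_mul, norm_rpow_ofReal ht.1, mul_comm]
      exact mul_le_mul_of_nonneg_right (hδe ⟨ht.1, ht.2.trans_lt hxδ.2⟩).le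
        (Real.rpow_nonneg ht.1.le _)
    · rw [norm_mul, norm_rpow_ofReal ht.1]
      exact mul_le_mul_of_nonneg_right (Real.rpow_le_rpow ht.1.le ht.2 (by linarith)) (norm_nonneg _)
  rw [intervalIntegral.integral_add hi2 (hi.const_mul _), intervalIntegral.integral_const_mul,
    intervalIntegral.integral_const_mul, integral_rpow_zero (by linarith), sub_add_cancel] at hb
  rw [dist_zero_right, hE', norm_mul, norm_rpow_ofReal hx.1, hrep x ⟨hx.1, hx.2.le⟩, zero_add]
  have e1 : x ^ σ * x ^ (-σ) = 1 := by rw [← Real.rpow_add hx.1]; simp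
  calc _ ≤ x ^ σ * _ := mul_le_mul_of_nonneg_left hb hxs.le
    _ = (x ^ σ * x ^ (-σ)) * (ε / 2 + ∫ t in (0 : ℝ)..x, ‖h t‖) := by
        have : σ ≠ 0 := hσ.ne
        field_simp
    _ < ε := by rw [e1, one_mul]; linarith

/-- Leading behaviour for the Euler equation with an inhomogeneity of logarithmic size. -/
theorem euler_log_asymptotics {σ : ℝ} (hσ : σ < 0) {y S f : ℝ → ℂ} {c : ℂ}
    (hy : IsPrim y (fun x => (σ * y x + S x) / x + f x))
    (hyb : BddBy (fun x => 1 - Real.log x) y) (hSc : ContinuousOn S (Ioi 0))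
    (hS : Tendsto (fun x => S x / logScale x) (𝓝[>] 0) (𝓝 (-(σ * c))))
    (hf : IntegrableOn (fun x => f x / logScale x) (Ioo 0 1)) :
    Tendsto (fun x => y x / logScale x) (𝓝[>] 0) (𝓝 c) := by
  have hinv : IsPrim (fun x => (logScale x : ℂ)⁻¹)
      (fun x => ((x * (1 + x) : ℝ) : ℂ)⁻¹ / (logScale x : ℂ) ^ 2) := by
    refine IsPrim.of_hasDerivAt (fun x hx => ?_) ?_
    · have := ((hasDerivAt_logScale hx).inv (logScale_pos hx).ne').ofReal_comp
      simpa using this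
    · refine ContinuousOn.div (ContinuousOn.inv₀ (by fun_prop) fun x hx => ?_)
        (continuousOn_logScale.pow 2) fun x hx => pow_ne_zero _ (logScale_ne hx)
      have hx0 : (0 : ℝ) < x := hx
      exact_mod_cast (by positivity : x * (1 + x) ≠ 0)
  -- Write L for `logScale`. As L' = -1/(x(1+x)), dividing the equation by L adds the term (y/L) /
  -- ((1+x) L) to the source; it vanishes at 0 because y/L is bounded and L tends to infinity.
  set e : ℝ → ℂ := fun x => (S x / logScale x + σ * c) +
    (y x / logScale x) * (((1 + x : ℝ) : ℂ)⁻¹ * (logScale x : ℂ)⁻¹) with he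
  have hE : IsPrim (fun x => y x / logScale x - c)
      (fun x => (σ * (y x / logScale x - c) + e x) / x + f x / logScale x) := by
    refine ((hy.mul hinv).sub (IsPrim.const c)).congr (fun x _ => by rw [div_eq_mul_inv])
      fun x hx => ?_
    have hxc : (x : ℂ) ≠ 0 := by exact_mod_cast hx.ne'
    have hLc := logScale_ne hx
    have hx1 : (1 + x : ℂ) ≠ 0 := by exact_mod_cast (by positivity : 1 + x ≠ 0)
    simp only [he]
    push_cast
    field_simp
    ring
  have hYc := continuousOn_div_logScale hy.continuousOn
  have h1c : ContinuousOn (fun x : ℝ => ((1 + x : ℝ) : ℂ)⁻¹) (Ioi 0) := by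
    refine ContinuousOn.inv₀ (by fun_prop) fun x hx => ?_
    have hx0 : (0 : ℝ) < x := hx
    exact_mod_cast (by positivity : 1 + x ≠ 0)
  have hec : ContinuousOn e (Ioi 0) :=
    ((continuousOn_div_logScale hSc).add continuousOn_const).add
      (hYc.mul (h1c.mul (continuousOn_logScale.inv₀ fun x hx => logScale_ne hx)))
  obtain ⟨C, hC⟩ := hyb.div_logScale
  have he0 : Tendsto e (𝓝[>] 0) (𝓝 0) := by
    have h1 := hS.add_const (σ * c)
    rw [neg_add_cancel] at h1
    have h2 : Tendsto (fun x : ℝ => (y x / logScale x) * (((1 + x : ℝ) : ℂ)⁻¹ * (logScale x : ℂ)⁻¹))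
        (𝓝[>] 0) (𝓝 0) := by
      have h3 := tendsto_inv_logScale.norm.const_mul C
      rw [norm_zero, mul_zero] at h3
      refine squeeze_zero_norm' ?_ h3
      filter_upwards [Ioo_mem_nhdsGT one_pos] with x hx
      have hb := hC x ⟨hx.1, hx.2.le⟩
      rw [norm_mul, norm_mul]
      have h4 : ‖((1 + x : ℝ) : ℂ)⁻¹‖ ≤ 1 := by
        rw [norm_inv, Complex.norm_real, Real.norm_of_nonneg (by linarith [hx.1])]
        exact inv_le_one_of_one_le₀ (by linarith [hx.1])
      have h5 : ‖((1 + x : ℝ) : ℂ)⁻¹‖ * ‖(logScale x : ℂ)⁻¹‖ ≤ ‖(logScale x : ℂ)⁻¹‖ :=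
        mul_le_of_le_one_left (norm_nonneg _) h4
      exact mul_le_mul hb h5 (by positivity) ((norm_nonneg _).trans hb)
    simpa [he] using h1.add h2
  have h0 : Tendsto (fun x : ℝ => ((x ^ (-σ) : ℝ) : ℂ) * (y x / logScale x - c)) (𝓝[>] 0) (𝓝 0) := by
    refine tendsto_scale_of_bound (f := fun x => y x / logScale x - c) (t := 0) (M := C + ‖c‖)
      (by linarith) fun x hx => ?_
    rw [Real.rpow_zero, mul_one]
    exact (norm_sub_le _ _).trans (by linarith [hC x hx])
  have := (euler_vanishing hσ hE hec he0 hf h0).add_const c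
  rw [zero_add] at this
  exact this.congr fun x => by ring

/-- The resonant equation for p = 1. With L = `logScale`, adding s L to y removes the leading
singularity, and the sum Z has to be o(L). On [x, δ] the remaining source contributes at most (ε/4)
log(δ/x); the other term is at most L(x) ∫ |f|/L because L decreases; and Z(δ) is fixed while L(x)
tends to infinity. -/
theorem primitive_log_asymptotics {y S f : ℝ → ℂ} {s : ℂ}
    (hy : IsPrim y (fun x => S x / x + f x)) (hS : Tendsto S (𝓝[>] 0) (𝓝 s))
    (hf : IntegrableOn (fun x => f x / logScale x) (Ioo 0 1)) :
    Tendsto (fun x => y x / logScale x) (𝓝[>] 0) (𝓝 (-s)) := by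
  set Z : ℝ → ℂ := fun x => y x + s * logScale x with hZdef
  set e : ℝ → ℂ := fun x => S x - s * ((1 + x : ℝ) : ℂ)⁻¹ with he
  have hL : IsPrim (fun x => (logScale x : ℂ)) (fun x => -((x * (1 + x) : ℝ) : ℂ)⁻¹) := by
    refine IsPrim.of_hasDerivAt (fun x hx => ?_) ?_
    · have := (hasDerivAt_logScale hx).ofReal_comp
      simpa using this
    · refine (ContinuousOn.inv₀ (by fun_prop) fun x hx => ?_).neg
      have hx0 : (0 : ℝ) < x := hx
      exact_mod_cast (by positivity : x * (1 + x) ≠ 0)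
  have hZ : IsPrim Z (fun x => e x / x + f x) := by
    refine (hy.add (hL.const_mul s)).congr (fun _ _ => rfl) fun x hx => ?_
    have hxc : (x : ℂ) ≠ 0 := by exact_mod_cast hx.ne'
    have hx1 : (1 + x : ℂ) ≠ 0 := by exact_mod_cast (by positivity : 1 + x ≠ 0)
    simp only [he]
    push_cast
    field_simp
    ring
  have he0 : Tendsto e (𝓝[>] 0) (𝓝 0) := by
    have hc : ContinuousAt (fun x : ℝ => s * ((1 + x : ℝ) : ℂ)⁻¹) 0 :=
      continuousAt_const.mul (ContinuousAt.inv₀ (by fun_prop) (by simp))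
    have h1 := hS.sub (hc.tendsto.mono_left (nhdsWithin_le_nhds (s := Ioi 0)))
    simpa [he] using h1
  have key : Tendsto (fun x => Z x / logScale x) (𝓝[>] 0) (𝓝 0) := by
    rw [Metric.tendsto_nhds]
    intro ε hε
    have hη : 0 < ε / 4 := by positivity
    have hev := (he0.norm.eventually_lt_const (u := ε / 4) (by simpa using hη)).and
      ((tendsto_integral_norm hf).eventually_lt_const hη)
    obtain ⟨δ₀, hδ₀, hδe⟩ := mem_nhdsGT_iff_exists_Ioo_subset.1 hev
    have hδ₀0 : (0 : ℝ) < δ₀ := hδ₀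
    set δ := min (δ₀ / 2) (1 / 2) with hδ
    have hδ0 : 0 < δ := lt_min (by positivity) (by norm_num)
    have hδ1 : δ < 1 := (min_le_right _ _).trans_lt (by norm_num)
    have hδδ : δ < δ₀ := (min_le_left _ _).trans_lt (by linarith)
    have hlim : Tendsto (fun x => ‖Z δ‖ * ‖(logScale x : ℂ)⁻¹‖) (𝓝[>] 0) (𝓝 0) := by
      simpa using tendsto_inv_logScale.norm.const_mul ‖Z δ‖
    filter_upwards [Ioo_mem_nhdsGT hδ0, hlim.eventually_lt_const hη] with x hx hxZ
    have hx1 : x < 1 := hx.2.trans hδ1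
    have hLx := logScale_pos hx.1
    have hi1 : IntervalIntegrable (fun t : ℝ => t⁻¹) volume x δ :=
      intervalIntegral.intervalIntegrable_inv (fun t ht => by
        rw [uIcc_of_le hx.2.le] at ht; exact (hx.1.trans_le ht.1).ne') continuousOn_id
    have hi2 := intervalIntegrable_of_unit hf.norm hx.1.le hδ1.le hx.2.le
    have hb : ‖∫ t in x..δ, (e t / t + f t)‖ ≤
        ∫ t in x..δ, ((ε / 4) * t⁻¹ + logScale x * ‖f t / logScale t‖) := by
      refine intervalIntegral.norm_integral_le_of_norm_le hx.2.le ?_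
        ((hi1.const_mul _).add (hi2.const_mul _))
      filter_upwards with t ht
      have ht0 : 0 < t := hx.1.trans ht.1
      refine (norm_add_le _ _).trans (add_le_add ?_ ?_)
      · rw [norm_div, Complex.norm_real, Real.norm_of_nonneg ht0.le, div_eq_mul_inv]
        exact mul_le_mul_of_nonneg_right (hδe ⟨ht0, ht.2.trans_lt hδδ⟩).1.le (inv_nonneg.2 ht0.le)
      · have : ‖f t‖ = logScale t * ‖f t / logScale t‖ := by
          rw [norm_div, Complex.norm_real, Real.norm_of_nonneg (logScale_pos ht0).le,
            mul_div_cancel₀ _ (logScale_pos ht0).ne']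
        rw [this]
        exact mul_le_mul_of_nonneg_right (logScale_antitone hx.1 ht.1.le) (norm_nonneg _)
    rw [intervalIntegral.integral_add (hi1.const_mul _) (hi2.const_mul _),
      intervalIntegral.integral_const_mul, intervalIntegral.integral_const_mul,
      integral_inv_of_pos hx.1 hδ0, Real.log_div hδ0.ne' hx.1.ne'] at hb
    have h3 : ∫ t in x..δ, ‖f t / logScale t‖ ≤ ε / 4 := by
      have h4 := intervalIntegral.integral_mono_interval (μ := volume) hx.1.le hx.2.le le_rfl
        (f := fun t => ‖f t / logScale t‖) (Eventually.of_forall fun t => norm_nonneg _)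
        (intervalIntegrable_of_unit hf.norm le_rfl hδ1.le hδ0.le)
      exact h4.trans (hδe ⟨hδ0, hδδ⟩).2.le
    have h5 : Real.log δ - Real.log x ≤ logScale x := by
      have := Real.log_nonpos hδ0.le hδ1.le
      have := le_logScale hx.1
      linarith
    have h6 := hZ.sub_eq x δ hx.1 hδ0
    have h7 : ‖Z x‖ ≤ ‖Z δ‖ + logScale x * (ε / 2) := by
      have : Z x = Z δ - ∫ t in x..δ, (e t / t + f t) := by rw [← h6]; ring
      rw [this]
      refine (norm_sub_le _ _).trans (add_le_add le_rfl (hb.trans ?_))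
      have := mul_le_mul_of_nonneg_left h5 hη.le
      have := mul_le_mul_of_nonneg_left h3 hLx.le
      linarith
    rw [dist_zero_right, norm_div, Complex.norm_real, Real.norm_of_nonneg hLx.le, div_lt_iff₀ hLx]
    rw [norm_inv, Complex.norm_real, Real.norm_of_nonneg hLx.le, ← div_eq_mul_inv,
      div_lt_iff₀ hLx] at hxZ
    have := mul_pos hε hLx
    linarith
  have := key.sub_const s
  rw [zero_sub] at this
  refine this.congr' ?_
  filter_upwards [self_mem_nhdsWithin] with x hx
  have := logScale_ne (show (0 : ℝ) < x from hx)
  simp only [hZdef]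
  field_simp
  ring

theorem integrableOn_mul_div_logScale {h f : ℝ → ℂ} (hf : BddBy (fun x => 1 - Real.log x) f)
    (hc : ContinuousOn f (Ioi 0)) (hh : MemLp h 1 unitMeasure) :
    IntegrableOn (fun x => (h x * f x) / logScale x) (Ioo 0 1) := by
  obtain ⟨C, hC⟩ := hf.div_logScale
  refine (memLp_one_iff_integrable.1 (memLp_mul_of_bound hh (continuousOn_div_logScale hc) hC)).congr
    (Eventually.of_forall fun x => ?_)
  simp only [mul_div_assoc]

theorem tendsto_div_log {f : ℝ → ℂ} {c : ℂ}
    (hf : Tendsto (fun x => f x / logScale x) (𝓝[>] 0) (𝓝 c)) :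
    Tendsto (fun x => f x / ((Real.log x : ℝ) : ℂ)) (𝓝[>] 0) (𝓝 (-c)) := by
  have := hf.mul tendsto_logScale_div_log
  rw [mul_neg_one] at this
  refine this.congr' ?_
  filter_upwards [self_mem_nhdsWithin] with x hx
  rw [div_mul_div_cancel₀ (logScale_ne (show (0 : ℝ) < x from hx))]

/-- Leading behaviour of the coefficients of the second solution above the logarithmic threshold. -/
theorem IsSecondChain.log_asymptotics {l : ℝ} {Q v v' : ℝ → ℂ} {f f' : ℕ → ℝ → ℂ}
    (hl : -(1 / 2) < l) (hh : IsHalfInt l)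
    (h : IsSecondChain l Q v v' f f') (hp : 1 ∈ expSet l)
    (hQ : MemLp (fun x => x * Q x) 1 unitMeasure)
    (hv : Tendsto (scale l v) (𝓝[>] 0) (𝓝 ((1 / (2 * l + 1) : ℝ) : ℂ))) (k : ℕ) (hk : nl l ≤ k) :
    Tendsto (fun x => scale (-(-l + 2 * k)) (f k) x / logScale x) (𝓝[>] 0) (𝓝 (-logCoeff l k)) ∧
      Tendsto (fun x => scale (1 - (-l + 2 * k)) (f' k) x / logScale x) (𝓝[>] 0)
        (𝓝 (-(((-l + 2 * k : ℝ) : ℂ) * logCoeff l k))) := by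
  have hn := hh.eq_nl
  have hl0 : (2 * l + 1 : ℂ) ≠ 0 := by
    have : (2 * l + 1 : ℝ) ≠ 0 := by linarith
    exact_mod_cast this
  -- Converts leading coefficients of the two components into those of the function and its
  -- derivative. The minus signs appear because `logScale` behaves like -log x; the first relation
  -- ties the coefficient of the derivative to m D.
  have combine : ∀ (m : ℝ) (y y' : ℝ → ℂ) (P R D : ℂ),
      ((l + 1 - m : ℝ) : ℂ) * P + ((-l - m : ℝ) : ℂ) * R = 0 → (2 * l + 1) * D = P + R →
      Tendsto (fun x => upper l m y y' x / logScale x) (𝓝[>] 0) (𝓝 (-P)) →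
      Tendsto (fun x => lower l m y y' x / logScale x) (𝓝[>] 0) (𝓝 (-R)) →
      Tendsto (fun x => scale (-m) y x / logScale x) (𝓝[>] 0) (𝓝 (-D)) ∧
        Tendsto (fun x => scale (1 - m) y' x / logScale x) (𝓝[>] 0) (𝓝 (-(m * D))) := by
    intro m y y' P R D h1 h2 hu hw
    constructor
    · have := (hu.add hw).const_mul (2 * l + 1 : ℂ)⁻¹
      have e : (2 * l + 1 : ℂ)⁻¹ * (-P + -R) = -D := by
        rw [inv_mul_eq_iff_eq_mul₀ hl0]; linear_combination h2
      rw [e] at this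
      refine this.congr fun x => ?_
      rw [← add_div, upper_add_lower, mul_div_assoc, inv_mul_cancel_left₀ hl0]
    · have := ((hu.const_mul (l + 1 : ℂ)).sub (hw.const_mul (l : ℂ))).const_mul (2 * l + 1 : ℂ)⁻¹
      have e : (2 * l + 1 : ℂ)⁻¹ * ((l + 1) * -P - l * -R) = -(m * D) := by
        rw [inv_mul_eq_iff_eq_mul₀ hl0]
        push_cast at h1
        linear_combination m * h2 - h1
      rw [e] at this
      refine this.congr fun x => ?_
      rw [← mul_div_assoc, ← mul_div_assoc, ← sub_div, ← scale_deriv_eq, mul_div_assoc,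
        inv_mul_cancel_left₀ hl0]
  induction k, hk using Nat.le_induction with
  | base =>
    obtain ⟨n, hnn⟩ := Nat.exists_eq_succ_of_ne_zero (Nat.one_le_iff_ne_zero.1 (hh.one_le_nl hl))
    rw [Nat.succ_eq_add_one] at hnn
    obtain ⟨b1, b2, b3, b4⟩ := h.bddBy_log hh le_rfl
    obtain ⟨i1, -, -, i4⟩ := h.isReg hl hp le_rfl le_rfl hQ hv n (Or.inr (by omega))
      fun j hj _ => half_lt_inv hl (by omega) j hj
    have hs := logCoeff_nl hnn hh
    rw [hnn] at hn b1 b2 b3 b4 ⊢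
    set m : ℝ := -l + 2 * (n + 1 : ℕ) with hm
    have e1 : -(-l + 2 * (n : ℝ)) = 2 - m := by rw [hm]; push_cast; ring
    have e2 : l + 1 - m = 0 := by rw [hm]; linarith
    rw [e1] at i1 i4
    set s := ((1 / (2 * l + 1) : ℝ) : ℂ) *
      ∏ j ∈ Finset.range n, (((2 * (j + 1) * (2 * l + 1 - 2 * (j + 1)) : ℝ) : ℂ))⁻¹ with hsdef
    have hw := integrableOn_mul_div_logScale b1
      (continuousOn_scale (-m) (h.chain.continuousOn (n + 1))) hQ
    have hwn : IntegrableOn (fun x => -((x * Q x) * scale (-m) (f (n + 1)) x) / logScale x)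
        (Ioo 0 1) := hw.neg.congr (Eventually.of_forall fun x => (neg_div _ _).symm)
    have hσ2 : -l - m < 0 := by rw [hm]; push_cast; linarith [(n.cast_nonneg : (0 : ℝ) ≤ n)]
    have u1 := primitive_log_asymptotics (((h.chain.succ n).isPrim_upper m).congr
      (fun _ _ => rfl) fun x _ => by rw [e2, Complex.ofReal_zero, zero_mul, zero_add])
      i4.neg hw
    have u2 := euler_log_asymptotics (c := 0) hσ2 ((h.chain.succ n).isPrim_lower m) b4
      i1.continuousOn (by simpa [div_eq_mul_inv] using i4.mul tendsto_inv_logScale)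
      hwn
    refine combine m _ _ (-s) 0 _ (by rw [e2]; simp) (by rw [hs, add_zero]) u1 ?_
    rwa [neg_zero]
  | succ k hk ih =>
    have hrec := logCoeff_succ hl hk hh
    obtain ⟨b1, b2, b3, b4⟩ := h.bddBy_log hh (hk.trans k.le_succ)
    have i1 := ih.1
    have hkn : (nl l : ℝ) ≤ k := by exact_mod_cast hk
    set m : ℝ := -l + 2 * (k + 1 : ℕ) with hm
    have hm' : m = -l + 2 * k + 2 := by rw [hm]; push_cast; ring
    have e1 : -(-l + 2 * (k : ℝ)) = 2 - m := by rw [hm']; ring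
    rw [e1] at i1
    have hσ1 : l + 1 - m < 0 := by rw [hm']; linarith
    have hσ2 : -l - m < 0 := by rw [hm']; linarith
    have hσ1' : ((l + 1 - m : ℝ) : ℂ) ≠ 0 := by exact_mod_cast hσ1.ne
    have hσ2' : ((-l - m : ℝ) : ℂ) ≠ 0 := by exact_mod_cast hσ2.ne
    have hw := integrableOn_mul_div_logScale b1
      (continuousOn_scale (-m) (h.chain.continuousOn (k + 1))) hQ
    have hwn : IntegrableOn (fun x => -((x * Q x) * scale (-m) (f (k + 1)) x) / logScale x)
        (Ioo 0 1) := hw.neg.congr (Eventually.of_forall fun x => (neg_div _ _).symm)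
    have hSc := continuousOn_scale (2 - m) (h.chain.continuousOn k)
    set d := logCoeff l k with hd
    set P := ((l + 1 - m : ℝ) : ℂ)⁻¹ * d with hP
    set R := -(((-l - m : ℝ) : ℂ)⁻¹ * d) with hR
    have hPe : ((l + 1 - m : ℝ) : ℂ) * P = d := by rw [hP, mul_inv_cancel_left₀ hσ1']
    have hRe : ((-l - m : ℝ) : ℂ) * R = -d := by rw [hR, mul_neg, mul_inv_cancel_left₀ hσ2']
    have u1 := euler_log_asymptotics (c := -P) hσ1 ((h.chain.succ k).isPrim_upper m) b3
      hSc.neg (by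
        rw [mul_neg, hPe, neg_neg]
        simpa only [neg_div, neg_neg] using i1.neg) hw
    have u2 := euler_log_asymptotics (c := -R) hσ2 ((h.chain.succ k).isPrim_lower m) b4
      hSc (by rwa [mul_neg, hRe, neg_neg]) hwn
    refine combine m _ _ P R _ (by rw [hPe, hRe, add_neg_cancel]) ?_ u1 u2
    have e4 : (2 * l + 1 : ℂ) = ((l + 1 - m : ℝ) : ℂ) - ((-l - m : ℝ) : ℂ) := by push_cast; ring
    refine mul_left_cancel₀ (mul_ne_zero hσ1' hσ2') ?_
    rw [e4, hP, hR]
    field_simp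
    linear_combination (((l + 1 - m : ℝ) : ℂ) - ((-l - m : ℝ) : ℂ)) * hrec

/-! ### The coefficient functions of θ and their stated properties -/

/-- The normalised coefficient functions `(2l+1) k! x^(e-2k) F_k(x)` of an expansion. -/
def coeffFun (l e : ℝ) (F : ℕ → ℝ → ℂ) (k : ℕ) : ℝ → ℂ := fun x =>
  (((2 * l + 1) * k.factorial : ℝ) : ℂ) * scale (e - 2 * k) (F k) x

/-- The factor x^(2k) cancels the power in the normalisation, so the prefactor no longer depends on
k. The exponent is e = l for θ and e = l+1 for θ'. -/
theorem coeffFun_series {l : ℝ} (hl : -(1 / 2) < l) (e : ℝ) {F : ℕ → ℝ → ℂ} {x : ℝ} (hx : 0 < x)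
    {ζ : ℂ} (hF : Summable fun k => F k x * ζ ^ k) :
    Summable (fun k : ℕ => (x : ℂ) ^ (2 * k) * coeffFun l e F k x / (k.factorial : ℂ) * ζ ^ k) ∧
      ((x ^ (-e) / (2 * l + 1) : ℝ) : ℂ) *
        (∑' k : ℕ, (x : ℂ) ^ (2 * k) * coeffFun l e F k x / (k.factorial : ℂ) * ζ ^ k) =
        ∑' k, F k x * ζ ^ k := by
  have hl0 : 2 * l + 1 ≠ 0 := by linarith
  have key : ∀ k : ℕ, (x : ℂ) ^ (2 * k) * coeffFun l e F k x / (k.factorial : ℂ) * ζ ^ k =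
      (((2 * l + 1) * x ^ e : ℝ) : ℂ) * (F k x * ζ ^ k) := by
    intro k
    have h1 : (x : ℂ) ^ (2 * k) * ((x ^ (e - 2 * k) : ℝ) : ℂ) = ((x ^ e : ℝ) : ℂ) := by
      have h2 : x ^ e = x ^ (2 * k) * x ^ (e - 2 * k) := by
        rw [← Real.rpow_natCast, ← Real.rpow_add hx]; congr 1; push_cast; ring
      rw [h2]; push_cast; ring
    have h3 : (k.factorial : ℂ) ≠ 0 := by exact_mod_cast k.factorial_ne_zero
    simp only [coeffFun, scale]
    push_cast
    rw [← h1]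
    field_simp
  simp only [key]
  refine ⟨hF.mul_left _, ?_⟩
  rw [tsum_mul_left, ← mul_assoc, ← Complex.ofReal_mul]
  have : x ^ (-e) / (2 * l + 1) * ((2 * l + 1) * x ^ e) = 1 := by
    rw [div_mul_eq_mul_div, mul_left_comm, mul_div_cancel_left₀ _ hl0, ← Real.rpow_add hx]
    simp
  rw [this, Complex.ofReal_one, one_mul]

theorem hasDerivAt_scale {s : ℝ} {f : ℝ → ℂ} {d : ℂ} {x : ℝ} (hx : 0 < x) (hf : HasDerivAt f d x) :
    HasDerivAt (scale s f) (((s * x ^ (s - 1) : ℝ) : ℂ) * f x + ((x ^ s : ℝ) : ℂ) * d) x := by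
  have h1 := (Real.hasDerivAt_rpow_const (p := s) (Or.inl hx.ne')).ofReal_comp
  refine (h1.mul hf).congr_deriv ?_
  push_cast
  ring

theorem mul_deriv_scale {s : ℝ} {f : ℝ → ℂ} {d : ℂ} {x : ℝ} (hx : 0 < x) (hf : HasDerivAt f d x) :
    (x : ℂ) * deriv (scale s f) x = ((x ^ (s + 1) : ℝ) : ℂ) * d + s * scale s f x := by
  rw [(hasDerivAt_scale hx hf).deriv, Real.rpow_sub_one hx.ne', Real.rpow_add_one hx.ne']
  have hxc : (x : ℂ) ≠ 0 := by exact_mod_cast hx.ne'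
  simp only [scale]
  push_cast
  field_simp
  ring

theorem MemW1.const_mul {r : ℝ≥0∞} {f : ℝ → ℂ} (hf : MemW1 r f) (a : ℂ) :
    MemW1 r fun x => a * f x := by
  obtain ⟨c, g, hg, h⟩ := hf
  refine ⟨a * c, fun x => a * g x, hg.const_mul a, fun x hx => ?_⟩
  simp only [h x hx]
  rw [intervalIntegral.integral_const_mul, mul_add]

theorem MemW1.add {r : ℝ≥0∞} (hr : 1 ≤ r) {f₁ f₂ : ℝ → ℂ} (h₁ : MemW1 r f₁) (h₂ : MemW1 r f₂) :
    MemW1 r fun x => f₁ x + f₂ x := by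
  obtain ⟨c₁, g₁, hg₁, h₁⟩ := h₁
  obtain ⟨c₂, g₂, hg₂, h₂⟩ := h₂
  refine ⟨c₁ + c₂, fun x => g₁ x + g₂ x, hg₁.add hg₂, fun x hx => ?_⟩
  have hi : ∀ g : ℝ → ℂ, MemLp g r unitMeasure → IntervalIntegrable g volume 0 x := fun g hg => by
    have h01 : IntervalIntegrable g volume 0 1 := by
      rw [intervalIntegrable_iff_integrableOn_Ioo_of_le zero_le_one]; exact hg.integrable hr
    refine h01.mono_set ?_
    rw [uIcc_of_le hx.1.le, uIcc_of_le zero_le_one]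
    exact Icc_subset_Icc_right hx.2.le
  simp only [h₁ x hx, h₂ x hx]
  rw [intervalIntegral.integral_add (hi g₁ hg₁) (hi g₂ hg₂)]
  ring

theorem MemW1.congr {r : ℝ≥0∞} {f g : ℝ → ℂ} (hf : MemW1 r f) (h : ∀ x, g x = f x) : MemW1 r g := by
  obtain rfl : g = f := funext h
  exact hf

theorem tendsto_of_sub_mul {f g : ℝ → ℂ} {m : ℂ} {c : ℂ} (hf : Tendsto f (𝓝[>] 0) (𝓝 c))
    (h : Tendsto (fun x => g x - m * f x) (𝓝[>] 0) (𝓝 0)) : Tendsto g (𝓝[>] 0) (𝓝 (m * c)) := by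
  have := h.add (hf.const_mul m)
  rw [zero_add] at this
  exact this.congr fun x => by ring

section Theta

variable {l : ℝ} {Q v v' : ℝ → ℂ} {f f' : ℕ → ℝ → ℂ}

theorem factor_mul_prod (hl : -(1 / 2) < l) (k : ℕ) :
    (((2 * l + 1) * k.factorial : ℝ) : ℂ) * (((1 / (2 * l + 1) : ℝ) : ℂ) *
      ∏ j ∈ Finset.range k, (((2 * (j + 1) * (2 * l + 1 - 2 * (j + 1)) : ℝ) : ℂ))⁻¹) =
      (thetaConst l k : ℂ) := by
  have hl0 : (2 * l + 1 : ℝ) ≠ 0 := by linarith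
  rw [thetaConst_eq_prod]
  norm_cast
  field_simp

theorem factor_mul_logCoeff (hl : -(1 / 2) < l) (k : ℕ) :
    (((2 * l + 1) * k.factorial : ℝ) : ℂ) * logCoeff l k = (thetaLogConst l k : ℂ) := by
  have hl0 : (2 * l + 1 : ℝ) ≠ 0 := by linarith
  have hk : (k.factorial : ℝ) ≠ 0 := by exact_mod_cast k.factorial_ne_zero
  rw [logCoeff]
  norm_cast
  field_simp

theorem IsChain.hasDerivAt (h : IsChain l Q f f') (k : ℕ) {x : ℝ} (hx : 0 < x) :
    HasDerivAt (f k) (f' k x) x := by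
  cases k with
  | zero => exact h.zero.hasDerivAt hx
  | succ k => exact (h.succ k).hasDerivAt hx

variable {p : ℝ≥0∞}

theorem IsSecondChain.nature (hl : -(1 / 2) < l) (h : IsSecondChain l Q v v' f f')
    (hp : p ∈ expSet l) (hQ : MemLp (fun x => x * Q x) p unitMeasure)
    (hv : Tendsto (scale l v) (𝓝[>] 0) (𝓝 ((1 / (2 * l + 1) : ℝ) : ℂ))) (k : ℕ) :
    CoeffNature l p k (thetaConst l k) (thetaLogConst l k) (coeffFun l l f k) ∧
      CoeffNature l p k ((-l + 2 * k) * thetaConst l k) ((-l + 2 * k) * thetaLogConst l k)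
        (coeffFun l (l + 1) f' k) := by
  have e1 : -(-l + 2 * (k : ℝ)) = l - 2 * k := by ring
  have e2 : 1 - (-l + 2 * (k : ℝ)) = l + 1 - 2 * k := by ring
  set N : ℂ := (((2 * l + 1) * k.factorial : ℝ) : ℂ) with hN
  have hprod := factor_mul_prod hl k
  have hlog := factor_mul_logCoeff hl k
  rw [← hN] at hprod hlog
  have hlim : (¬ IsHalfInt l ∨ k < nl l) →
      Tendsto (coeffFun l l f k) (𝓝[>] 0) (𝓝 (thetaConst l k)) ∧
      Tendsto (coeffFun l (l + 1) f' k) (𝓝[>] 0)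
        (𝓝 (((-l + 2 * k) * thetaConst l k : ℝ) : ℂ)) := by
    intro hk
    obtain ⟨-, -, h3, h4⟩ := h.isReg hl hp le_rfl hp.1 hQ hv k hk fun j _ h0 => by simpa using h0
    rw [e1, e2] at h3
    rw [e1] at h4
    have h5 := h4.const_mul N
    rw [hprod] at h5
    refine ⟨h5, ?_⟩
    have h6 := (tendsto_of_sub_mul h4 h3).const_mul N
    rw [mul_left_comm, hprod] at h6
    rw [Complex.ofReal_mul]
    exact h6
  have hreg : ∀ r : ℝ≥0∞, 1 ≤ r → r ≤ p → (¬ IsHalfInt l ∨ k < nl l) →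
      (∀ j : ℕ, j ≤ k → 0 < 2 * l + 1 - 2 * (j : ℝ) → 1 - r.toReal⁻¹ < 2 * l + 1 - 2 * j) →
      MemW1 r (coeffFun l l f k) ∧ MemW1 r (coeffFun l (l + 1) f' k) := by
    intro r hr hrp hk hc
    obtain ⟨h1, h2, -, -⟩ := h.isReg hl hp hr hrp hQ hv k hk hc
    rw [e1] at h1
    rw [e2] at h2
    exact ⟨(h1.memW1 hr).const_mul _, (h2.memW1 hr).const_mul _⟩
  have hge : IsHalfInt l → nl l ≤ k → 1 < p → ∀ r : ℝ≥0∞, 1 ≤ r → r < p →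
      MemW1 r (fun x => coeffFun l l f k x - ((thetaLogConst l k * Real.log x : ℝ) : ℂ)) ∧
      MemW1 r (fun x => coeffFun l (l + 1) f' k x -
        (((-l + 2 * k) * thetaLogConst l k * Real.log x : ℝ) : ℂ)) := by
    intro hh hk hp1 r hr hrp
    obtain ⟨h1, h2, -⟩ := h.log_isReg hl hh hp1 hp hr hrp hQ hv k hk
    rw [e1] at h1
    rw [e2] at h2
    refine ⟨((h1.memW1 hr).const_mul N).congr fun x => ?_, ((h2.memW1 hr).const_mul N).congr fun x => ?_⟩
    · simp only [coeffFun, ← hN]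
      rw [Complex.ofReal_mul, ← hlog]; ring
    · simp only [coeffFun, ← hN]
      rw [Complex.ofReal_mul, Complex.ofReal_mul, ← hlog]; ring
  have hone : IsHalfInt l → nl l ≤ k → p = 1 →
      Tendsto (fun x => coeffFun l l f k x / ((Real.log x : ℝ) : ℂ)) (𝓝[>] 0)
        (𝓝 (thetaLogConst l k : ℂ)) ∧
      Tendsto (fun x => coeffFun l (l + 1) f' k x / ((Real.log x : ℝ) : ℂ)) (𝓝[>] 0)
        (𝓝 (((-l + 2 * k) * thetaLogConst l k : ℝ) : ℂ)) := by
    rintro hh hk rfl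
    obtain ⟨h1, h2⟩ := h.log_asymptotics hl hh hp hQ hv k hk
    rw [e1] at h1
    rw [e2] at h2
    have h3 := (tendsto_div_log h1).const_mul N
    have h4 := (tendsto_div_log h2).const_mul N
    rw [neg_neg] at h3 h4
    rw [hlog] at h3
    rw [mul_left_comm, hlog] at h4
    rw [Complex.ofReal_mul]
    exact ⟨h3.congr fun x => by simp only [coeffFun]; ring,
      h4.congr fun x => by simp only [coeffFun]; ring⟩
  constructor
  · exact ⟨fun hh => ⟨fun r hr hrp => (hreg r hr.1.1 hrp (Or.inl hh) (coeffExpSet_inv hl hr)).1,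
        (hlim (Or.inl hh)).1⟩,
      fun _ hk => ⟨(hreg p hp.1 le_rfl (Or.inr hk) fun j hj _ => half_lt_inv hl hk j hj).1,
        (hlim (Or.inr hk)).1⟩,
      fun hh hk hp1 r hr hrp => (hge hh hk hp1 r hr hrp).1, fun hh hk hp1 => (hone hh hk hp1).1⟩
  · exact ⟨fun hh => ⟨fun r hr hrp => (hreg r hr.1.1 hrp (Or.inl hh) (coeffExpSet_inv hl hr)).2,
        (hlim (Or.inl hh)).2⟩,
      fun _ hk => ⟨(hreg p hp.1 le_rfl (Or.inr hk) fun j hj _ => half_lt_inv hl hk j hj).2,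
        (hlim (Or.inr hk)).2⟩,
      fun hh hk hp1 r hr hrp => (hge hh hk hp1 r hr hrp).2, fun hh hk hp1 => (hone hh hk hp1).2⟩

/-- Differentiating x^(l-2k) f_k and multiplying by x gives exactly the combination of f_k' and f_k
whose limit comes with the Euler equations. For p = 1 above the threshold only logarithmic bounds
are available, and any x^ε absorbs them. -/
theorem IsSecondChain.derivLimits (hl : -(1 / 2) < l) (h : IsSecondChain l Q v v' f f')
    (hp : p ∈ expSet l) (hQ : MemLp (fun x => x * Q x) p unitMeasure)
    (hv : Tendsto (scale l v) (𝓝[>] 0) (𝓝 ((1 / (2 * l + 1) : ℝ) : ℂ))) (k : ℕ) :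
    DerivLimits l p k (coeffFun l l f k) := by
  have e1 : -(-l + 2 * (k : ℝ)) = l - 2 * k := by ring
  have e2 : 1 - (-l + 2 * (k : ℝ)) = l + 1 - 2 * k := by ring
  set N : ℂ := (((2 * l + 1) * k.factorial : ℝ) : ℂ) with hN
  set q : ℝ → ℂ := fun x => scale (l + 1 - 2 * k) (f' k) x -
    ((-l + 2 * k : ℝ) : ℂ) * scale (l - 2 * k) (f k) x with hq
  have hd : ∀ x, 0 < x → DifferentiableAt ℝ (coeffFun l l f k) x := fun x hx =>
    ((hasDerivAt_scale hx (h.chain.hasDerivAt k hx)).differentiableAt).const_mul N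
  have hxd : ∀ x : ℝ, 0 < x → (x : ℂ) * deriv (coeffFun l l f k) x = N * q x := by
    intro x hx
    have h1 : deriv (coeffFun l l f k) x = N * deriv (scale (l - 2 * k) (f k)) x :=
      deriv_const_mul N (hasDerivAt_scale hx (h.chain.hasDerivAt k hx)).differentiableAt
    rw [h1, mul_left_comm, mul_deriv_scale hx (h.chain.hasDerivAt k hx),
      show l - 2 * (k : ℝ) + 1 = l + 1 - 2 * k by ring]
    simp only [hq, scale]
    push_cast
    ring
  have hlim : ∀ c : ℂ, Tendsto q (𝓝[>] 0) (𝓝 c) →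
      Tendsto (fun x : ℝ => (x : ℂ) * deriv (coeffFun l l f k) x) (𝓝[>] 0) (𝓝 (N * c)) := by
    intro c hc
    refine (hc.const_mul N).congr' ?_
    filter_upwards [self_mem_nhdsWithin] with x hx using (hxd x hx).symm
  refine ⟨hd, fun hk => ?_, fun hh hk hp1 => ?_, fun hh hk hp1 ε hε => ?_⟩
  · obtain ⟨-, -, h3, -⟩ := h.isReg hl hp le_rfl hp.1 hQ hv k hk fun j _ h0 => by simpa using h0
    rw [e1, e2] at h3
    simpa using hlim 0 h3
  · obtain ⟨-, -, h3⟩ := h.log_isReg hl hh hp1 hp le_rfl hp1 hQ hv k hk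
    rw [e1, e2] at h3
    rw [← factor_mul_logCoeff hl]
    exact hlim _ h3
  · obtain ⟨b1, b2, -, -⟩ := h.bddBy_log hh hk
    rw [e1] at b1
    rw [e2] at b2
    have := ((b2.sub (b1.const_mul ((-l + 2 * k : ℝ) : ℂ))).const_mul N).tendsto_rpow_mul
      isWeight_log hε
    refine this.congr' ?_
    filter_upwards [self_mem_nhdsWithin] with x hx
    have hx0 : (0 : ℝ) < x := hx
    rw [add_comm 1 ε, Real.rpow_add_one hx0.ne', Complex.ofReal_mul, mul_assoc, hxd x hx0]

end Theta

/-! ### Absorbing polynomials into the series -/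

/-- A perturbation that does not affect the behaviour of the `k`-th coefficient function. -/
structure IsNegligible (l : ℝ) (p : ℝ≥0∞) (k : ℕ) (g : ℝ → ℂ) : Prop where
  regular : ¬ IsHalfInt l → ∀ r ∈ coeffExpSet l k, r ≤ p → MemW1 r g
  half : IsHalfInt l → MemW1 p g
  limit : ∃ t, Tendsto g (𝓝[>] 0) (𝓝 t) ∧ ((¬ IsHalfInt l ∨ k < nl l) → t = 0)

/-- A nonzero limit of the perturbation is allowed only where a logarithm is present: there it
belongs to the regular part for p > 1 and is dominated by the logarithm for p = 1. -/
theorem CoeffNature.add {l : ℝ} {p : ℝ≥0∞} (hp : 1 ≤ p) {k : ℕ} {c d : ℝ} {f g : ℝ → ℂ}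
    (hf : CoeffNature l p k c d f) (hg : IsNegligible l p k g) :
    CoeffNature l p k c d fun x => f x + g x := by
  obtain ⟨t, ht, ht0⟩ := hg.limit
  refine ⟨fun hh => ⟨fun r hr hrp => ?_, ?_⟩, fun hh hk => ⟨?_, ?_⟩, fun hh hk hp1 r hr hrp => ?_,
    fun hh hk hp1 => ?_⟩
  · exact ((hf.regular hh).1 r hr hrp).add hr.1.1 (hg.regular hh r hr hrp)
  · have := (hf.regular hh).2.add ht
    rwa [ht0 (Or.inl hh), add_zero] at this
  · exact (hf.half_lt hh hk).1.add hp (hg.half hh)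
  · have := (hf.half_lt hh hk).2.add ht
    rwa [ht0 (Or.inr hk), add_zero] at this
  · obtain ⟨c', g', hg', h'⟩ := hg.half hh
    exact ((hf.half_ge hh hk hp1 r hr hrp).add hr ⟨c', g', hg'.mono_exponent hrp.le, h'⟩).congr
      fun x => by ring
  · have h1 : Tendsto (fun x : ℝ => ((Real.log x : ℝ) : ℂ)⁻¹) (𝓝[>] 0) (𝓝 0) := by
      have := (Complex.continuous_ofReal.tendsto 0).comp
        Real.tendsto_log_nhdsGT_zero.inv_tendsto_atBot
      rw [Complex.ofReal_zero] at this
      exact this.congr fun x => by simp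
    have := (hf.half_ge_one hh hk hp1).add (ht.mul h1)
    rw [mul_zero, add_zero] at this
    exact this.congr fun x => by rw [add_div, div_eq_mul_inv (g x)]

theorem DerivLimits.add {l : ℝ} {p : ℝ≥0∞} {k : ℕ} {f g : ℝ → ℂ} (hf : DerivLimits l p k f)
    (hg : ∀ x, 0 < x → DifferentiableAt ℝ g x)
    (hg0 : Tendsto (fun x : ℝ => (x : ℂ) * deriv g x) (𝓝[>] 0) (𝓝 0)) :
    DerivLimits l p k fun x => f x + g x := by
  have hd : ∀ x : ℝ, 0 < x → deriv (fun x => f x + g x) x = deriv f x + deriv g x := fun x hx =>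
    deriv_add (hf.differentiableAt x hx) (hg x hx)
  have hsum : ∀ c : ℂ, Tendsto (fun x : ℝ => (x : ℂ) * deriv f x) (𝓝[>] 0) (𝓝 c) →
      Tendsto (fun x : ℝ => (x : ℂ) * deriv (fun x => f x + g x) x) (𝓝[>] 0) (𝓝 c) := by
    intro c hc
    have := hc.add hg0
    rw [add_zero] at this
    refine this.congr' ?_
    filter_upwards [self_mem_nhdsWithin] with x hx
    rw [hd x hx, mul_add]
  refine ⟨fun x hx => (hf.differentiableAt x hx).add (hg x hx), fun hk => hsum _ (hf.regular hk),
    fun hh hk hp1 => hsum _ (hf.half_ge hh hk hp1), fun hh hk hp1 ε hε => ?_⟩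
  have := (hf.half_ge_one hh hk hp1 ε hε).add ((tendsto_rpow_zero hε).mul hg0)
  rw [mul_zero, add_zero] at this
  refine this.congr' ?_
  filter_upwards [self_mem_nhdsWithin] with x hx
  have hx0 : (0 : ℝ) < x := hx
  rw [hd x hx, mul_add, add_comm 1 ε, Real.rpow_add_one hx0.ne', Complex.ofReal_mul, mul_assoc,
    mul_assoc]

/-- `x^s y` for a regular function `y`. -/
theorem IsReg.scale {r : ℝ≥0∞} (hr : 1 ≤ r) {y : ℝ → ℂ} (hy : IsReg r y) {s : ℝ}
    (hs : s = 0 ∨ 0 < s ∧ 1 - r.toReal⁻¹ < s) : IsReg r (scale s y) := by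
  rcases hs with rfl | ⟨hs0, hs⟩
  · exact hy.congr fun x _ => by simp [Bessel.scale]
  · obtain ⟨c, hc⟩ := hy.exists_tendsto hr
    obtain ⟨g, hg, hgr⟩ := id hy
    refine ⟨_, (IsPrim.cpow_ofReal s).mul hg, ?_⟩
    have h1 : MemLp (fun x : ℝ => ((x ^ (s - 1) : ℝ) : ℂ) * y x) r unitMeasure :=
      memLp_mul_of_tendsto (memLp_rpow hr (by linarith)) hy.continuousOn hc
    have h2 : MemLp (fun x : ℝ => g x * ((x ^ s : ℝ) : ℂ)) r unitMeasure :=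
      memLp_mul_of_tendsto hgr (continuousOn_rpow_ofReal s) (tendsto_rpow_zero hs0)
    refine ((h1.const_mul (s : ℂ)).add h2).ae_eq (Eventually.of_forall fun x => ?_)
    simp only [Pi.add_apply]; ring

theorem one_sub_inv_toReal_lt_two (r : ℝ≥0∞) : 1 - r.toReal⁻¹ < 2 := by
  linarith [zero_le_inv_toReal r]

/-- The exponent 2l+1-2j is nonnegative because j ≤ n_l, and when positive it meets the same
inequality as the coefficients themselves. It is zero only if j = n_l = l + 1/2, and then j ≤ k puts
k above the logarithmic threshold, where a nonzero limit is harmless. -/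
theorem isNegligible_scale {l : ℝ} (hl : -(1 / 2) < l) {p : ℝ≥0∞} (hp : 1 ≤ p) {y : ℝ → ℂ}
    (hy : IsReg p y) {j k : ℕ} (hj : j ≤ nl l) (hjk : j ≤ k) (c : ℂ) :
    IsNegligible l p k fun x => c * scale (2 * l + 1 - 2 * j) y x := by
  have hjn : (j : ℝ) ≤ nl l := by exact_mod_cast hj
  obtain ⟨t, ht⟩ := hy.exists_tendsto hp
  refine ⟨fun hh r hr hrp => ?_, fun hh => ?_, ?_⟩
  · have hs : 0 < 2 * l + 1 - 2 * (j : ℝ) := by linarith [nl_lt_of_not_isHalfInt hl hh]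
    exact (((hy.mono hrp).scale hr.1.1 (Or.inr ⟨hs, coeffExpSet_inv hl hr j hjk hs⟩)).memW1
      hr.1.1).const_mul c
  · refine ((hy.scale hp ?_).memW1 hp).const_mul c
    have hn := hh.eq_nl
    rcases hj.eq_or_lt with h | h
    · exact Or.inl (by rw [h]; linarith)
    · have h2 : (j : ℝ) + 1 ≤ nl l := by exact_mod_cast h
      have := one_sub_inv_toReal_lt_two p
      exact Or.inr ⟨by linarith, by linarith⟩
  · rcases (show 2 * l + 1 - 2 * (j : ℝ) = 0 ∨ 0 < 2 * l + 1 - 2 * (j : ℝ) by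
      rcases (show (0 : ℝ) ≤ 2 * l + 1 - 2 * j by linarith [nl_le hl]).eq_or_lt with h | h
      · exact Or.inl h.symm
      · exact Or.inr h) with h | h
    · refine ⟨c * t, ?_, fun h' => ?_⟩
      · rw [h]
        exact (ht.const_mul c).congr fun x => by simp [scale]
      · have h1 : l + 1 / 2 = (j : ℝ) := by linarith
        have hh : IsHalfInt l := ⟨j, h1⟩
        have h2 : j = nl l := by exact_mod_cast h1.symm.trans hh.eq_nl
        exact absurd h' (by push Not; exact ⟨hh, h2 ▸ hjk⟩)
    · refine ⟨c * (0 * t), ((tendsto_rpow_zero h).mul ht).const_mul c, fun _ => by simp⟩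

/-- A multiple of `(z - z₀)^j`, `j ≤ n_l`, can be moved from `F` to the series. -/
theorem IsFrobeniusRep.shift {l : ℝ} (hl : -(1 / 2) < l) {p : ℝ≥0∞} (hp : 1 ≤ p)
    {φ θ : ℂ → ℝ → ℂ} {F : ℂ → ℂ} {z₀ : ℂ} {a b : ℕ → ℝ → ℂ}
    (h : IsFrobeniusRep l p φ θ F z₀ a b) {Q u u' : ℝ → ℂ} {f f' : ℕ → ℝ → ℂ}
    (hf : IsFirstChain l Q u u' f f') (hQ : MemLp (fun x => x * Q x) p unitMeasure)
    (hu : Tendsto (scale (-(l + 1)) u) (𝓝[>] 0) (𝓝 1))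
    (hφ : ∀ (z : ℂ) (x : ℝ), 0 < x → φ z x = ∑' k, f k x * (z - z₀) ^ k)
    (hφ' : ∀ (z : ℂ) (x : ℝ), 0 < x → deriv (φ z) x = ∑' k, f' k x * (z - z₀) ^ k)
    {j : ℕ} (hj : j ≤ nl l) (c : ℂ) :
    ∃ a₁ b₁, IsFrobeniusRep l p φ θ (fun z => F z - c * (z - z₀) ^ j) z₀ a₁ b₁ := by
  set s : ℝ := 2 * l + 1 - 2 * j with hs
  -- The coefficients of c (z - z₀)^j times a power series.
  set shift : (ℕ → ℝ → ℂ) → ℕ → ℝ → ℂ := fun g k => if j ≤ k then fun x => c * g (k - j) x else 0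
    with hshift
  have hser : ∀ g : ℕ → ℝ → ℂ, ∀ x : ℝ, ∀ ζ : ℂ, Summable (fun k => g k x * ζ ^ k) →
      HasSum (fun k => shift g k x * ζ ^ k) (c * ζ ^ j * ∑' k, g k x * ζ ^ k) := by
    intro g x ζ hg
    rw [← hasSum_nat_add_iff' j]
    have e0 : ∑ i ∈ Finset.range j, shift g i x * ζ ^ i = 0 := by
      refine Finset.sum_eq_zero fun i hi => ?_
      simp [hshift, not_le.2 (Finset.mem_range.1 hi)]
    rw [e0, sub_zero]
    have e1 : (fun k => shift g (k + j) x * ζ ^ (k + j)) = fun k => c * ζ ^ j * (g k x * ζ ^ k) := by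
      ext k
      simp only [hshift, if_pos (Nat.le_add_left j k), Nat.add_sub_cancel, pow_add]
      ring
    rw [e1]
    exact hg.hasSum.mul_left _
  -- The power x^(e-2k) splits into x^(2l+1-2j) and the power that normalises the (k-j)-th
  -- coefficient of the first solution, or of its derivative.
  have hform : ∀ (e : ℝ) (g : ℕ → ℝ → ℂ) (k : ℕ) (x : ℝ), j ≤ k → 0 < x →
      coeffFun l e (shift g) k x = (((2 * l + 1) * k.factorial : ℝ) : ℂ) * c *
        scale s (scale (e - 2 * l - 1 - 2 * (k - j : ℕ)) (g (k - j))) x := by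
    intro e g k x hjk hx
    rw [scale_scale _ _ _ hx]
    simp only [coeffFun, hshift, if_pos hjk, scale]
    rw [show s + (e - 2 * l - 1 - 2 * ((k - j : ℕ) : ℝ)) = e - 2 * k by
      rw [hs, Nat.cast_sub hjk]; ring]
    ring
  have hzero : ∀ (e : ℝ) (g : ℕ → ℝ → ℂ) (k : ℕ), ¬ j ≤ k → coeffFun l e (shift g) k = fun _ => 0 := by
    intro e g k hjk
    ext x
    simp [coeffFun, hshift, if_neg hjk, scale]
  have hneg0 : ∀ k, IsNegligible l p k fun _ => 0 := fun k =>
    ⟨fun _ r hr _ => (IsReg.const 0).memW1 hr.1.1, fun _ => (IsReg.const 0).memW1 hp,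
      0, tendsto_const_nhds, fun _ => rfl⟩
  have hnegl : ∀ (e : ℝ) (g : ℕ → ℝ → ℂ) (k : ℕ),
      (∀ i : ℕ, IsReg p (scale (e - 2 * l - 1 - 2 * i) (g i))) →
      IsNegligible l p k fun x => coeffFun l e (shift g) k x := by
    intro e g k hg
    by_cases hjk : j ≤ k
    · have h1 := isNegligible_scale hl hp (hg (k - j)) hj hjk (((2 * l + 1) * k.factorial : ℝ) * c)
      have ev : ∀ x ∈ Ioo (0 : ℝ) 1, coeffFun l e (shift g) k x =
          ((2 * l + 1) * k.factorial : ℝ) * c *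
            scale s (scale (e - 2 * l - 1 - 2 * (k - j : ℕ)) (g (k - j))) x :=
        fun x hx => hform e g k x hjk hx.1
      have hmem : ∀ r, MemW1 r (fun x => ((2 * l + 1) * k.factorial : ℝ) * c *
          scale s (scale (e - 2 * l - 1 - 2 * (k - j : ℕ)) (g (k - j))) x) →
          MemW1 r fun x => coeffFun l e (shift g) k x := by
        rintro r ⟨c', g', hg', h'⟩
        exact ⟨c', g', hg', fun x hx => (ev x hx).trans (h' x hx)⟩
      obtain ⟨t, ht, ht0⟩ := h1.limit
      refine ⟨fun hh r hr hrp => hmem r (h1.regular hh r hr hrp), fun hh => hmem p (h1.half hh),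
        t, ht.congr' ?_, ht0⟩
      filter_upwards [Ioo_mem_nhdsGT one_pos] with x hx using (ev x hx).symm
    · rw [hzero e g k hjk]
      exact hneg0 k
  have hreg := hf.isReg hl hp hQ hu
  have e1 : ∀ i : ℕ, l - 2 * l - 1 - 2 * (i : ℝ) = -(l + 1 + 2 * i) := fun i => by ring
  have e2 : ∀ i : ℕ, l + 1 - 2 * l - 1 - 2 * (i : ℝ) = 1 - (l + 1 + 2 * i) := fun i => by ring
  have hna := fun k => hnegl l f k fun i => by rw [e1]; exact (hreg i).1
  have hnb := fun k => hnegl (l + 1) f' k fun i => by rw [e2]; exact (hreg i).2.1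
  have hshd : ∀ (k : ℕ) (x : ℝ), 0 < x → HasDerivAt (shift f k) (shift f' k x) x := by
    intro k x hx
    by_cases hjk : j ≤ k
    · simp only [hshift, if_pos hjk]
      exact (hf.chain.hasDerivAt (k - j) hx).const_mul c
    · simp only [hshift, if_neg hjk]
      exact hasDerivAt_const x 0
  have hder : ∀ (k : ℕ) (x : ℝ), 0 < x → HasDerivAt (coeffFun l l (shift f) k)
      ((((2 * l + 1) * k.factorial : ℝ) : ℂ) * (((l - 2 * k : ℝ) * x ^ (l - 2 * k - 1) : ℝ) *
        shift f k x + ((x ^ (l - 2 * k) : ℝ) : ℂ) * shift f' k x)) x := fun k x hx =>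
    (hasDerivAt_scale hx (hshd k x hx)).const_mul _
  have hxd : ∀ (k : ℕ), Tendsto (fun x : ℝ => (x : ℂ) * deriv (coeffFun l l (shift f) k) x)
      (𝓝[>] 0) (𝓝 0) := by
    intro k
    by_cases hjk : j ≤ k
    · have hsn : 0 ≤ s := by
        have : (j : ℝ) ≤ nl l := by exact_mod_cast hj
        rw [hs]; linarith [nl_le hl]
      obtain ⟨r1, r2, r3⟩ := hreg (k - j)
      obtain ⟨t, ht⟩ := r1.exists_tendsto hp
      set m : ℝ := l + 1 + 2 * (k - j : ℕ) with hm
      set N : ℂ := (((2 * l + 1) * k.factorial : ℝ) : ℂ) * c with hN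
      have hsk : l - 2 * (k : ℝ) = s - m := by rw [hs, hm, Nat.cast_sub hjk]; ring
      -- This is x d/dx of x^s times the normalised coefficient. If s = 0 the term with factor s
      -- drops out, and otherwise x^s tends to 0.
      have hmain : Tendsto (fun x : ℝ => N * (((x ^ s : ℝ) : ℂ) *
          (scale (1 - m) (f' (k - j)) x - (m : ℂ) * scale (-m) (f (k - j)) x) +
          (s : ℂ) * (((x ^ s : ℝ) : ℂ) * scale (-m) (f (k - j)) x))) (𝓝[>] 0) (𝓝 0) := by
        have hb : Tendsto (fun x : ℝ => (s : ℂ) * (((x ^ s : ℝ) : ℂ) * scale (-m) (f (k - j)) x))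
            (𝓝[>] 0) (𝓝 0) := by
          rcases hsn.eq_or_lt with h0 | h0
          · rw [← h0]; simp
          · simpa using ((tendsto_rpow_zero h0).mul ht).const_mul (s : ℂ)
        have ha : Tendsto (fun x : ℝ => ((x ^ s : ℝ) : ℂ) *
            (scale (1 - m) (f' (k - j)) x - (m : ℂ) * scale (-m) (f (k - j)) x)) (𝓝[>] 0) (𝓝 0) := by
          rcases hsn.eq_or_lt with h0 | h0
          · rw [← h0]; simpa using r3
          · simpa using (tendsto_rpow_zero h0).mul r3
        simpa using (ha.add hb).const_mul N
      refine hmain.congr' ?_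
      filter_upwards [self_mem_nhdsWithin] with x hx
      have hx0 : (0 : ℝ) < x := hx
      rw [(hder k x hx0).deriv]
      simp only [hshift, if_pos hjk, scale, hN]
      have p1 : x ^ (l - 2 * (k : ℝ)) = x ^ s * x ^ (-m) := by
        rw [← Real.rpow_add hx0, hsk]; rfl
      have p2 : x ^ (1 - m) = x * x ^ (-m) := by
        rw [sub_eq_add_neg, Real.rpow_add hx0, Real.rpow_one]
      rw [Real.rpow_sub_one hx0.ne', p1, p2, hsk]
      have hxc : (x : ℂ) ≠ 0 := by exact_mod_cast hx0.ne'
      push_cast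
      field_simp
      ring
    · rw [hzero l f k hjk]
      simp
  have hadd : ∀ (e : ℝ) (g a : ℕ → ℝ → ℂ) (z : ℂ) (x : ℝ), 0 < x →
      Summable (fun k => g k x * (z - z₀) ^ k) →
      Summable (fun k : ℕ => (x : ℂ) ^ (2 * k) * a k x / (k.factorial : ℂ) * (z - z₀) ^ k) →
      Summable (fun k : ℕ => (x : ℂ) ^ (2 * k) * (a k x + coeffFun l e (shift g) k x) /
        (k.factorial : ℂ) * (z - z₀) ^ k) ∧
      ((x ^ (-e) / (2 * l + 1) : ℝ) : ℂ) * (∑' k : ℕ, (x : ℂ) ^ (2 * k) *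
        (a k x + coeffFun l e (shift g) k x) / (k.factorial : ℂ) * (z - z₀) ^ k) =
      ((x ^ (-e) / (2 * l + 1) : ℝ) : ℂ) *
        (∑' k : ℕ, (x : ℂ) ^ (2 * k) * a k x / (k.factorial : ℂ) * (z - z₀) ^ k) +
      c * (z - z₀) ^ j * ∑' k, g k x * (z - z₀) ^ k := by
    intro e g a z x hx hg ha
    have h1 := hser g x (z - z₀) hg
    obtain ⟨s1, s2⟩ := coeffFun_series hl e hx h1.summable
    rw [h1.tsum_eq] at s2
    have ht : ∀ k : ℕ, (x : ℂ) ^ (2 * k) * (a k x + coeffFun l e (shift g) k x) /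
        (k.factorial : ℂ) * (z - z₀) ^ k =
        (x : ℂ) ^ (2 * k) * a k x / (k.factorial : ℂ) * (z - z₀) ^ k +
        (x : ℂ) ^ (2 * k) * coeffFun l e (shift g) k x / (k.factorial : ℂ) * (z - z₀) ^ k :=
      fun k => by ring
    simp only [ht]
    refine ⟨ha.add s1, ?_⟩
    rw [ha.tsum_add s1, mul_add, s2]
  have eb : ∀ x : ℝ, x ^ (-l - 1) = x ^ (-(l + 1)) := fun x => by congr 1; ring
  refine ⟨fun k x => a k x + coeffFun l l (shift f) k x,
    fun k x => b k x + coeffFun l (l + 1) (shift f') k x, ?_, ?_, ?_, ?_, ?_, ?_, ?_⟩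
  · exact fun z x hx => (hadd l f a z x hx (hf.entire.summable hx _) (h.summable z x hx)).1
  · intro z x hx
    rw [(hadd l f a z x hx (hf.entire.summable hx _) (h.summable z x hx)).2, h.eq_series z x hx,
      ← hφ z x hx]
    ring
  · exact fun z x hx => (hadd (l + 1) f' b z x hx (hf.entire_deriv.summable hx _)
      (h.summable_deriv z x hx)).1
  · intro z x hx
    have h1 := (hadd (l + 1) f' b z x hx (hf.entire_deriv.summable hx _)
      (h.summable_deriv z x hx)).2
    have h2 := h.deriv_eq_series z x hx
    rw [eb] at h2 ⊢
    rw [h1, h2, ← hφ' z x hx]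
    ring
  · exact fun k => (h.nature k).add hp (hna k)
  · exact fun k => (h.nature_deriv k).add hp (hnb k)
  · exact fun k => (h.limits k).add (fun x hx => (hder k x hx).differentiableAt) (hxd k)

/-! ### Uniqueness of the solutions, and of F modulo polynomials -/

theorem intervalIntegrable_of_locallyIntegrableOn {q : ℝ → ℝ}
    (hq : LocallyIntegrableOn q (Ioi (0 : ℝ))) (z : ℂ) (a b : ℝ) (ha : 0 < a) (hb : 0 < b) :
    IntervalIntegrable (fun x => (q x : ℂ) - z) volume a b := by
  have h1 : IntegrableOn q (uIcc a b) :=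
    hq.integrableOn_compact_subset (uIcc_subset_Ioi ha hb) isCompact_uIcc
  have h2 : IntegrableOn (fun x => (q x : ℂ)) (uIcc a b) := h1.ofReal
  exact h2.intervalIntegrable.sub intervalIntegrable_const

theorem memLp_potential {q : ℝ → ℝ} {p : ℝ≥0∞} (hqp : MemLp (fun x => x * q x) p unitMeasure)
    (z : ℂ) : MemLp (fun x : ℝ => (x : ℂ) * ((q x : ℂ) - z)) p unitMeasure := by
  have h1 : MemLp (fun x : ℝ => ((x * q x : ℝ) : ℂ)) p unitMeasure := hqp.ofReal
  have h2 : MemLp (fun x : ℝ => (x : ℂ) * z) p unitMeasure := by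
    refine MemLp.of_bound (Continuous.aestronglyMeasurable (by fun_prop)) ‖z‖ ?_
    filter_upwards [ae_unitMeasure] with x hx
    rw [norm_mul, Complex.norm_real, Real.norm_of_nonneg hx.1.le]
    exact mul_le_of_le_one_left (norm_nonneg _) hx.2.le
  refine (h1.sub h2).ae_eq (Eventually.of_forall fun x => ?_)
  simp only [Pi.sub_apply]
  push_cast
  ring

/-- A solution that is small compared to `x^(-l)` is a multiple of the first solution. -/
theorem IsFund.eq_const_mul_first {l : ℝ} (hl : -(1 / 2) < l) {Q u u' v v' e e' : ℝ → ℂ}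
    (F : IsFund l Q u u' v v') (hu : Tendsto (scale (-(l + 1)) u) (𝓝[>] 0) (𝓝 1)) {c : ℂ}
    (hc : c ≠ 0) (hv : Tendsto (scale l v) (𝓝[>] 0) (𝓝 c)) (he : IsSol l Q (fun _ => 0) e e')
    (he0 : Tendsto (scale l e) (𝓝[>] 0) (𝓝 0)) : ∃ a : ℂ, ∀ x, 0 < x → e x = a * u x := by
  set a := v 1 * e' 1 - v' 1 * e 1 with ha
  set d := u 1 * e' 1 - u' 1 * e 1 with hd
  -- Expansion of e in the fundamental system: the coefficients are its Wronskians with v and u,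
  -- constant in x, evaluated at 1.
  have hrep : ∀ x, 0 < x → e x = a * u x - d * v x := fun x hx => by
    rw [ha, hd, F.second.wronskian he one_pos hx, F.first.wronskian he one_pos hx]
    linear_combination (-(e x)) * F.wronskian x hx
  have hu0 : Tendsto (scale l u) (𝓝[>] 0) (𝓝 0) := by
    have := (tendsto_rpow_zero (s := 2 * l + 1) (by linarith)).mul hu
    rw [zero_mul] at this
    refine this.congr' ?_
    filter_upwards [self_mem_nhdsWithin] with x hx
    have := scale_scale (2 * l + 1) (-(l + 1)) u (show (0 : ℝ) < x from hx)
    rw [show 2 * l + 1 + -(l + 1) = l by ring] at this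
    exact this
  have hlim : Tendsto (scale l e) (𝓝[>] 0) (𝓝 (a * 0 - d * c)) := by
    refine ((hu0.const_mul a).sub (hv.const_mul d)).congr' ?_
    filter_upwards [self_mem_nhdsWithin] with x hx
    simp only [scale]
    rw [hrep x hx]; ring
  have h0 := tendsto_nhds_unique hlim he0
  have hd0 : d = 0 := by
    have : d * c = 0 := by linear_combination -h0
    exact (mul_eq_zero.1 this).resolve_right hc
  exact ⟨a, fun x hx => by rw [hrep x hx, hd0]; ring⟩

/-- `θ(z, x) = P_x(z) + x^(l+1) (G(z) + o(1))` with polynomials `P_x` of degree at most `n`. -/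
def HasPolyExpansion (l : ℝ) (n : ℕ) (θ : ℂ → ℝ → ℂ) (G : ℂ → ℂ) : Prop :=
  ∃ P : ℝ → Polynomial ℂ, (∀ x, P x ∈ Polynomial.degreeLT ℂ (n + 1)) ∧
    ∀ z, Tendsto (scale (-(l + 1)) fun x => θ z x - (P x).eval z) (𝓝[>] 0) (𝓝 (G z))

theorem HasPolyExpansion.conj {l : ℝ} {n : ℕ} {θ : ℂ → ℝ → ℂ} {G : ℂ → ℂ}
    (h : HasPolyExpansion l n θ G) (hθ : ∀ x, 0 < x → IsRealEntire fun z => θ z x) :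
    HasPolyExpansion l n θ fun z => starRingEnd ℂ (G (starRingEnd ℂ z)) := by
  obtain ⟨P, hP, hG⟩ := h
  refine ⟨fun x => (P x).map (starRingEnd ℂ), fun x => ?_, fun z => ?_⟩
  · rw [Polynomial.mem_degreeLT]
    exact Polynomial.degree_map_le.trans_lt (Polynomial.mem_degreeLT.1 (hP x))
  · have h1 := (Complex.continuous_conj.tendsto _).comp (hG (starRingEnd ℂ z))
    refine h1.congr' ?_
    filter_upwards [self_mem_nhdsWithin] with x hx
    have h2 : starRingEnd ℂ ((P x).eval (starRingEnd ℂ z)) = ((P x).map (starRingEnd ℂ)).eval z := by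
      rw [← Polynomial.eval₂_at_apply, Complex.conj_conj, Polynomial.eval_map]
    simp only [Function.comp, scale]
    rw [map_mul, map_sub, Complex.conj_ofReal, h2, (hθ x hx).real, Complex.conj_conj]

theorem HasPolyExpansion.average {l : ℝ} {n : ℕ} {θ : ℂ → ℝ → ℂ} {G H : ℂ → ℂ}
    (hG : HasPolyExpansion l n θ G) (hH : HasPolyExpansion l n θ H) :
    HasPolyExpansion l n θ fun z => (1 / 2 : ℂ) * (G z + H z) := by
  obtain ⟨P, hP, hG⟩ := hG
  obtain ⟨R, hR, hH⟩ := hH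
  refine ⟨fun x => (1 / 2 : ℂ) • (P x + R x),
    fun x => Submodule.smul_mem _ _ (Submodule.add_mem _ (hP x) (hR x)), fun z => ?_⟩
  refine (((hG z).add (hH z)).const_mul (1 / 2 : ℂ)).congr fun x => ?_
  simp only [scale, Polynomial.eval_smul, Polynomial.eval_add, smul_eq_mul]
  ring

/-- The function `G` in such an expansion is unique up to polynomials of degree at most `n`. -/
theorem HasPolyExpansion.sub_eq_eval {l : ℝ} {n : ℕ} {θ : ℂ → ℝ → ℂ} {G H : ℂ → ℂ}
    (hG : HasPolyExpansion l n θ G) (hH : HasPolyExpansion l n θ H) :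
    ∃ R : Polynomial ℂ, R.natDegree ≤ n ∧ ∀ z, G z - H z = R.eval z := by
  obtain ⟨P, hP, hG⟩ := hG
  obtain ⟨S, hS, hH⟩ := hH
  -- A polynomial of degree at most n is a fixed linear combination of its values at the nodes 0, …,
  -- n, and this identity passes to the limit x → 0. So G - H is its own Lagrange interpolant,
  -- although the polynomials S_x - P_x themselves depend on x.
  set s := Finset.range (n + 1) with hs
  set w : ℕ → ℂ := fun i => i with hw
  have hinj : InjOn w s := fun i _ j _ hij => by simpa [hw] using hij
  have hev : ∀ r : ℕ → ℂ, ∀ z, (Lagrange.interpolate s w r).eval z =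
      ∑ i ∈ s, r i * (Lagrange.basis s w i).eval z := fun r z => by
    rw [Lagrange.interpolate_apply, Polynomial.eval_finsetSum]
    simp
  refine ⟨Lagrange.interpolate s w fun i => G (w i) - H (w i), ?_, fun z => ?_⟩
  · have h1 := Lagrange.degree_interpolate_lt (fun i => G (w i) - H (w i)) hinj
    rw [hs, Finset.card_range] at h1
    rw [Polynomial.natDegree_le_iff_coeff_eq_zero]
    exact fun N hN => Polynomial.degree_lt_iff_coeff_zero _ _ |>.1 h1 N hN
  · have hlim : ∀ z, Tendsto (scale (-(l + 1)) fun x => (S x - P x).eval z) (𝓝[>] 0)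
        (𝓝 (G z - H z)) := fun z => by
      refine ((hG z).sub (hH z)).congr fun x => ?_
      simp only [scale, Polynomial.eval_sub]; ring
    have h2 := tendsto_finsetSum s fun i (_ : i ∈ s) =>
      (hlim (w i)).mul_const ((Lagrange.basis s w i).eval z)
    rw [hev]
    refine tendsto_nhds_unique (hlim z) (h2.congr fun x => ?_)
    have h3 : S x - P x ∈ Polynomial.degreeLT ℂ (n + 1) := Submodule.sub_mem _ (hS x) (hP x)
    have h4 := Lagrange.eq_interpolate (f := S x - P x) hinj (by
      rw [hs, Finset.card_range]; exact Polynomial.mem_degreeLT.1 h3)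
    simp only [scale]
    conv_rhs => rw [h4, hev]
    rw [Finset.mul_sum]
    exact Finset.sum_congr rfl fun i _ => by ring

/-! ### Assembly: representations at each z₀ and a common real entire F -/

/-- The hypotheses on the potential and on the two solutions. -/
structure IsSystem (l : ℝ) (q : ℝ → ℝ) (p : ℝ≥0∞) (φ θ : ℂ → ℝ → ℂ) : Prop where
  lt : -(1 / 2) < l
  locallyIntegrable : LocallyIntegrableOn q (Ioi (0 : ℝ))
  mem : p ∈ expSet l
  memLp : MemLp (fun x => x * q x) p (volume.restrict (Ioo (0 : ℝ) 1))
  first : IsFirstSolution l q φ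
  second : IsSecondSolution l q θ

namespace IsSystem

variable {l : ℝ} {q : ℝ → ℝ} {p : ℝ≥0∞} {φ θ : ℂ → ℝ → ℂ}

theorem isSol_first (h : IsSystem l q p φ θ) (z : ℂ) :
    IsSol l (fun x => (q x : ℂ) - z) (fun _ => 0) (φ z) (deriv (φ z)) :=
  (h.first.solution z).isSol (intervalIntegrable_of_locallyIntegrableOn h.locallyIntegrable z)

theorem isSol_second (h : IsSystem l q p φ θ) (z : ℂ) :
    IsSol l (fun x => (q x : ℂ) - z) (fun _ => 0) (θ z) (deriv (θ z)) :=
  (h.second.solution z).isSol (intervalIntegrable_of_locallyIntegrableOn h.locallyIntegrable z)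

theorem isFund (h : IsSystem l q p φ θ) (z : ℂ) :
    IsFund l (fun x => (q x : ℂ) - z) (φ z) (deriv (φ z)) (θ z) (deriv (θ z)) :=
  isFund_of_asymptotics h.lt h.mem (memLp_potential h.memLp z) (h.isSol_first z) (h.isSol_second z)
    (h.first.asymptotics z) (h.second.asymptotics z)

theorem const_ne_zero (h : IsSystem l q p φ θ) : ((1 / (2 * l + 1) : ℝ) : ℂ) ≠ 0 := by
  have : 0 < 1 / (2 * l + 1) := one_div_pos.2 (by linarith [h.lt])
  exact_mod_cast this.ne'

theorem isSol_tsum (h : IsSystem l q p φ θ) {z₀ : ℂ} {f f' : ℕ → ℝ → ℂ}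
    (hf : IsChain l (fun x => (q x : ℂ) - z₀) f f') (h1 : LocEntire f) (h2 : LocEntire f') (z : ℂ) :
    IsSol l (fun x => (q x : ℂ) - z) (fun _ => 0) (fun x => ∑' k, f k x * (z - z₀) ^ k)
      (fun x => ∑' k, f' k x * (z - z₀) ^ k) := by
  have := hf.tsum (intervalIntegrable_of_locallyIntegrableOn h.locallyIntegrable z₀) h1 h2 (z - z₀)
  have e : (fun x => (q x : ℂ) - z₀ - (z - z₀)) = fun x => (q x : ℂ) - z := by ext x; ring
  rwa [e] at this

/-- The sum solves the same equation with the same leading term, so the difference is a multiple of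
φ(z,·) that is o(x^(l+1)), hence zero. Equality on the open half-line then passes to the
derivatives. -/
theorem first_eq_tsum (h : IsSystem l q p φ θ) {z₀ : ℂ} {f f' : ℕ → ℝ → ℂ}
    (hf : IsFirstChain l (fun x => (q x : ℂ) - z₀) (φ z₀) (deriv (φ z₀)) f f') (z : ℂ) :
    (∀ x, 0 < x → φ z x = ∑' k, f k x * (z - z₀) ^ k) ∧
      ∀ x, 0 < x → deriv (φ z) x = ∑' k, f' k x * (z - z₀) ^ k := by
  have hs := h.isSol_tsum hf.chain hf.entire hf.entire_deriv z
  have ht := hf.tendsto_tsum (h.first.asymptotics z₀) (z - z₀)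
  have hd := ((h.isSol_first z).sub hs)
  simp only [sub_zero] at hd
  have hd0 : Tendsto (scale (-(l + 1)) fun x => φ z x - ∑' k, f k x * (z - z₀) ^ k) (𝓝[>] 0)
      (𝓝 0) := by
    have := (h.first.asymptotics z).sub ht
    rw [sub_self] at this
    exact this.congr fun x => by simp only [scale]; ring
  have hd1 : Tendsto (scale l fun x => φ z x - ∑' k, f k x * (z - z₀) ^ k) (𝓝[>] 0) (𝓝 0) := by
    have := (tendsto_rpow_zero (s := 2 * l + 1) (by linarith [h.lt])).mul hd0
    rw [zero_mul] at this
    refine this.congr' ?_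
    filter_upwards [self_mem_nhdsWithin] with x hx
    have := scale_scale (2 * l + 1) (-(l + 1)) (fun x => φ z x - ∑' k, f k x * (z - z₀) ^ k)
      (show (0 : ℝ) < x from hx)
    rw [show 2 * l + 1 + -(l + 1) = l by ring] at this
    exact this
  obtain ⟨a, ha⟩ := (h.isFund z).eq_const_mul_first h.lt (h.first.asymptotics z) h.const_ne_zero
    (h.second.asymptotics z) hd hd1
  have ha0 : a = 0 := by
    have h1 : Tendsto (scale (-(l + 1)) fun x => φ z x - ∑' k, f k x * (z - z₀) ^ k) (𝓝[>] 0)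
        (𝓝 (a * 1)) := by
      refine ((h.first.asymptotics z).const_mul a).congr' ?_
      filter_upwards [self_mem_nhdsWithin] with x hx
      simp only [scale]
      rw [ha x hx]; ring
    simpa using tendsto_nhds_unique h1 hd0
  have heq : ∀ x, 0 < x → φ z x = ∑' k, f k x * (z - z₀) ^ k := fun x hx => by
    have := ha x hx
    rw [ha0, zero_mul] at this
    exact sub_eq_zero.1 this
  refine ⟨heq, fun x hx => ?_⟩
  have : φ z =ᶠ[𝓝 x] fun x => ∑' k, f k x * (z - z₀) ^ k := by
    filter_upwards [Ioi_mem_nhds hx] with y hy using heq y hy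
  rw [this.deriv_eq, (hs.hasDerivAt hx).deriv]

/-- The representation of `θ` around a single spectral parameter. -/
theorem exists_rep (h : IsSystem l q p φ θ) (z₀ : ℂ) : ∃ G : ℂ → ℂ, Differentiable ℂ G ∧
    HasPolyExpansion l (nl l) θ G ∧ ∃ a b, IsFrobeniusRep l p φ θ G z₀ a b := by
  obtain ⟨f, f', hf⟩ := (h.isFund z₀).exists_secondChain h.lt
  have hs := fun z => h.isSol_tsum hf.chain hf.entire hf.entire_deriv z
  have hv := h.second.asymptotics z₀
  -- The series and θ(z,·) have the same leading term at 0, so their difference is a solution that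
  -- is o(x^(-l)), hence a multiple of φ(z,·).
  have hex : ∀ z, ∃ a : ℂ, ∀ x, 0 < x → θ z x - ∑' k, f k x * (z - z₀) ^ k = a * φ z x := by
    intro z
    have hd := ((h.isSol_second z).sub (hs z))
    simp only [sub_zero] at hd
    refine (h.isFund z).eq_const_mul_first h.lt (h.first.asymptotics z) h.const_ne_zero
      (h.second.asymptotics z) hd ?_
    have := (h.second.asymptotics z).sub (hf.tendsto_tsum h.lt hv (z - z₀))
    rw [sub_self] at this
    exact this.congr fun x => by simp only [scale]; ring
  choose G hG using hex
  have hθ : ∀ z x, 0 < x → θ z x = (∑' k, f k x * (z - z₀) ^ k) + G z * φ z x := fun z x hx => by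
    rw [← hG z x hx]; ring
  refine ⟨G, fun z₁ => ?_, ?_, coeffFun l l f, coeffFun l (l + 1) f', ?_⟩
  -- Near z₁, G is a quotient of entire functions at a fixed point x where φ(z₁, x) ≠ 0; such an x
  -- exists by the asymptotics at 0.
  · obtain ⟨x, hx, hφx⟩ : ∃ x : ℝ, 0 < x ∧ φ z₁ x ≠ 0 := by
      have h1 := ((h.first.asymptotics z₁).eventually_ne one_ne_zero).and self_mem_nhdsWithin
      obtain ⟨x, hx1, hx2⟩ := h1.exists
      exact ⟨x, hx2, fun h0 => hx1 (by rw [h0, mul_zero])⟩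
    have d1 := (h.first.realEntire x hx).differentiable
    have d2 := (h.second.realEntire x hx).differentiable
    have d3 : Differentiable ℂ fun z => ∑' k, f k x * (z - z₀) ^ k :=
      (hf.entire.differentiable hx).comp (differentiable_id.sub_const z₀)
    have d4 : DifferentiableAt ℂ (fun z => (θ z x - ∑' k, f k x * (z - z₀) ^ k) / φ z x) z₁ :=
      ((d2 z₁).sub (d3 z₁)).div (d1 z₁) hφx
    refine d4.congr_of_eventuallyEq ?_
    filter_upwards [(d1 z₁).continuousAt.eventually_ne hφx] with z hz
    rw [hG z x hx, mul_div_cancel_right₀ _ hz]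
  · refine ⟨fun x => ∑ k ∈ Finset.range (nl l + 1),
      Polynomial.C (f k x) * (Polynomial.X - Polynomial.C z₀) ^ k, fun x => ?_, fun z => ?_⟩
    · refine Submodule.sum_mem _ fun k hk => ?_
      rw [Polynomial.mem_degreeLT, ← Polynomial.smul_eq_C_mul]
      refine (Polynomial.degree_smul_le _ _).trans_lt ?_
      rw [Polynomial.degree_pow, Polynomial.degree_X_sub_C]
      rw [nsmul_one]
      exact_mod_cast Finset.mem_range.1 hk
    · have h1 := (hf.tail (z - z₀)).add ((h.first.asymptotics z).const_mul (G z))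
      rw [zero_add, mul_one] at h1
      refine h1.congr' ?_
      filter_upwards [self_mem_nhdsWithin] with x hx
      simp only [scale, Polynomial.eval_finsetSum, Polynomial.eval_mul, Polynomial.eval_C,
        Polynomial.eval_pow, Polynomial.eval_sub, Polynomial.eval_X]
      rw [hθ z x hx]
      ring
  · have hQ := memLp_potential h.memLp z₀
    refine ⟨fun z x hx => (coeffFun_series h.lt l hx (hf.entire.summable hx _)).1, fun z x hx => ?_,
      fun z x hx => (coeffFun_series h.lt (l + 1) hx (hf.entire_deriv.summable hx _)).1,
      fun z x hx => ?_, fun k => (hf.nature h.lt h.mem hQ hv k).1,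
      fun k => (hf.nature h.lt h.mem hQ hv k).2, fun k => hf.derivLimits h.lt h.mem hQ hv k⟩
    · rw [(coeffFun_series h.lt l hx (hf.entire.summable hx _)).2, hθ z x hx]
    · rw [show x ^ (-l - 1) = x ^ (-(l + 1)) by congr 1; ring,
        (coeffFun_series h.lt (l + 1) hx (hf.entire_deriv.summable hx _)).2]
      have h1 : θ z =ᶠ[𝓝 x] fun x => (∑' k, f k x * (z - z₀) ^ k) + G z * φ z x := by
        filter_upwards [Ioi_mem_nhds hx] with y hy using hθ z y hy
      rw [h1.deriv_eq]
      exact (((hs z).hasDerivAt hx).add (((h.isSol_first z).hasDerivAt hx).const_mul (G z))).deriv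

/-- Polynomials of degree at most `n_l` can be absorbed in the series. -/
theorem rep_sub_polynomial (h : IsSystem l q p φ θ) {F : ℂ → ℂ} {z₀ : ℂ}
    (hF : ∃ a b, IsFrobeniusRep l p φ θ F z₀ a b) {P : Polynomial ℂ} (hP : P.natDegree ≤ nl l) :
    ∃ a b, IsFrobeniusRep l p φ θ (fun z => F z - P.eval z) z₀ a b := by
  obtain ⟨f, f', hf⟩ := (h.isFund z₀).exists_firstChain h.lt
  have hφ := fun z => h.first_eq_tsum hf z
  -- The polynomial is re-expanded at z₀ by Taylor's formula, and its monomials are moved one at a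
  -- time.
  have hind : ∀ m : ℕ, m ≤ nl l + 1 → ∃ a b, IsFrobeniusRep l p φ θ (fun z => F z -
      ∑ j ∈ Finset.range m, (Polynomial.taylor z₀ P).coeff j * (z - z₀) ^ j) z₀ a b := by
    intro m
    induction m with
    | zero => intro _; simpa using hF
    | succ m ih =>
      intro hm
      obtain ⟨a, b, hab⟩ := ih (by omega)
      obtain ⟨a₁, b₁, h1⟩ := hab.shift h.lt h.mem.1 hf (memLp_potential h.memLp z₀)
        (h.first.asymptotics z₀) (fun z => (hφ z).1) (fun z => (hφ z).2) (j := m) (by omega)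
        ((Polynomial.taylor z₀ P).coeff m)
      refine ⟨a₁, b₁, ?_⟩
      have e : (fun z => F z - ∑ j ∈ Finset.range (m + 1),
          (Polynomial.taylor z₀ P).coeff j * (z - z₀) ^ j) = fun z => F z -
          (∑ j ∈ Finset.range m, (Polynomial.taylor z₀ P).coeff j * (z - z₀) ^ j) -
          (Polynomial.taylor z₀ P).coeff m * (z - z₀) ^ m := by
        ext z; rw [Finset.sum_range_succ]; ring
      rw [e]
      exact h1
  have e : (fun z => F z - P.eval z) = fun z => F z -
      ∑ j ∈ Finset.range (nl l + 1), (Polynomial.taylor z₀ P).coeff j * (z - z₀) ^ j := by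
    ext z
    rw [← Polynomial.taylor_eval_sub z₀ P z, Polynomial.eval_eq_sum_range'
      (n := nl l + 1) (by rw [Polynomial.natDegree_taylor]; omega)]
  rw [e]
  exact hind _ le_rfl

/-- Conjugation symmetry of θ makes z ↦ conj G(conj z) another admissible coefficient in the
polynomial expansion, so its average F with G is real entire and still admissible. At any z₀ the
local coefficient differs from F by a polynomial of degree at most n_l, which is absorbed. F does
not depend on z₀, since the expansion does not involve it. -/
theorem exists_realEntire (h : IsSystem l q p φ θ) :
    ∃ F : ℂ → ℂ, IsRealEntire F ∧ HasFrobeniusRep l p φ θ F := by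
  obtain ⟨G, hGd, hG, -⟩ := h.exists_rep 0
  have hθ := h.second.realEntire
  have hF := hG.average (hG.conj hθ)
  refine ⟨fun z => (1 / 2 : ℂ) * (G z + starRingEnd ℂ (G (starRingEnd ℂ z))), ⟨?_, fun z => ?_⟩,
    fun z₀ => ?_⟩
  · exact (hGd.add fun z => differentiableAt_star_conj_iff.2 (hGd (starRingEnd ℂ z))).const_mul _
  · simp only [map_mul, map_add, Complex.conj_conj, map_div₀, map_one, Complex.conj_ofNat]
    ring
  · obtain ⟨H, -, hH, hrep⟩ := h.exists_rep z₀
    obtain ⟨R, hR, hRe⟩ := hH.sub_eq_eval hF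
    have := h.rep_sub_polynomial hrep hR
    simpa only [← hRe, sub_sub_cancel] using this

end IsSystem

end Bessel

end

theorem lemma3p7 (l : ℝ) (hl : -(1 / 2) < l) (q : ℝ → ℝ)
    (hq : LocallyIntegrableOn q (Ioi (0 : ℝ)))
    (p : ℝ≥0∞) (hp : p ∈ Bessel.expSet l)
    (hqp : MemLp (fun x => x * q x) p (volume.restrict (Ioo (0 : ℝ) 1)))
    (φ θ : ℂ → ℝ → ℂ)
    (hφ : Bessel.IsFirstSolution l q φ) (hθ : Bessel.IsSecondSolution l q θ) :
    (∃ F : ℂ → ℂ, Bessel.IsRealEntire F ∧ Bessel.HasFrobeniusRep l p φ θ F) ∧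
    (∀ F : ℂ → ℂ, Bessel.IsRealEntire F → Bessel.HasFrobeniusRep l p φ θ F →
      ∀ P : Polynomial ℝ, P.natDegree ≤ Bessel.nl l →
        Bessel.HasFrobeniusRep l p φ θ (fun z => F z - Polynomial.aeval z P)) := by
  have h : Bessel.IsSystem l q p φ θ := ⟨hl, hq, hp, hqp, hφ, hθ⟩
  refine ⟨h.exists_realEntire, fun F _ hF P hP z₀ => ?_⟩
  have := h.rep_sub_polynomial (hF z₀) (P := P.map (algebraMap ℝ ℂ))
    (Polynomial.natDegree_map_le.trans hP)
  simpa only [Polynomial.eval_map_algebraMap] using this
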